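/- **Setting.** Fix $0<p<1$, $L\in\mathbb{Z}_{\ge 0}$ and $\gamma,\tau,\mu_1,\dots,\mu_L\in\mathbb{C}$, and let $$[z]=\tfrac12\sum_{n\in\mathbb{Z}}(-1)^{n-\frac12}\,p^{(n+\frac12)^2}e^{-(2n+1)z},\qquad (-1)^{n-\frac12}=-\mathrm{i}(-1)^n .$$ Assume $[\tau+n\gamma]\neq 0$ for $1\le n\le L+1$. The domain-wall partition function of the elliptic SOS (8VSOS) model is $$Z_\tau(y_1,\dots,y_L)=\sum_{\{h_{i,j}\}}\prod_{i,j=1}^L w_{ij}\begin{pmatrix}h_{i+1,j}&h_{i+1,j+1}\\h_{i,j}&h_{i,j+1}\end{pmatrix},$$ the sum running over all heights $h_{i,j}=\tau+n_{i,j}\gamma$, $n_{i,j}\in\mathbb{Z}$, $1\le i,j\le L+1$, such that the integers $n_{i,j}$ at neighbouring sites differ by $\pm1$ and $h_{1,j}=h_{j,1}=\tau+(L+2-j)\gamma$, $h_{L+1,j}=h_{j,L+1}=\tau+j\gamma$. With $u=y_i-\mu_j$ the weights are $$w_{ij}\begin{pmatrix}t\pm\gamma&t\\t&t\mp\gamma\end{pmatrix}=[u+\gamma],\quad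 w_{ij}\begin{pmatrix}t&t\pm\gamma\\t\mp\gamma&t\end{pmatrix}=\frac{[t\pm\gamma][u]}{[t]},\quad w_{ij}\begin{pmatrix}t&t\mp\gamma\\t\mp\gamma&t\end{pmatrix}=\frac{[t\pm u][\gamma]}{[t]} .$$ **Coefficients.** For $x=(x_0,x_1,\dots,x_L,x_{\bar0})\in\mathbb{C}^{L+2}$ write $X=(x_1,\dots,x_L)$, $X_0^0=X$; for $1\le i\le L$ let $X_i^0$, $X_i^{\bar0}$ be $X$ with $x_i$ replaced by $x_0$, $x_{\bar0}$ respectively; for $i<j$ let $X_{i,j}^{0,\bar0}$ be $X$ with $x_i,x_j$ replaced by $x_0,x_{\bar0}$. For $T=A$ put $$M_0=\prod_{j=1}^L\frac{[x_{\bar0}-\mu_j+\gamma][x_j-x_{\bar0}+\gamma]}{[x_{\bar0}-\mu_j][x_j-x_{\bar0}]}-\prod_{j=1}^L\frac{[x_0-\mu_j+\gamma][x_j-x_0+\gamma]}{[x_0-\mu_j][x_j-x_0]},$$ $$N_i=\frac{[\gamma][\tau+\gamma+x_0-x_i]}{[\tau+\gamma][x_i-x_0]}\prod_{j=1}^L\frac{[x_i-\mu_j+\gamma]}{[x_0-\mu_j]}\prod_{j\ne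 i}\frac{[x_j-x_i+\gamma]}{[x_j-x_i]},$$ $$\bar N_i=\frac{[\gamma][\tau+\gamma+x_{\bar0}-x_i]}{[\tau+\gamma][x_{\bar0}-x_i]}\prod_{j=1}^L\frac{[x_i-\mu_j+\gamma]}{[x_{\bar0}-\mu_j]}\prod_{j\ne i}\frac{[x_j-x_i+\gamma]}{[x_j-x_i]},$$ and for $T=D$ put $$M_0=\prod_{j=1}^L\frac{[x_{\bar0}-\mu_j][x_{\bar0}-x_j+\gamma]}{[x_{\bar0}-\mu_j+\gamma][x_{\bar0}-x_j]}-\prod_{j=1}^L\frac{[x_0-\mu_j][x_0-x_j+\gamma]}{[x_0-\mu_j+\gamma][x_0-x_j]},$$ $$N_i=\frac{[\gamma][\tau+(L+1)\gamma+x_0-x_i]}{[\tau+(L+1)\gamma][x_0-x_i]}\prod_{j=1}^L\frac{[x_i-\mu_j]}{[x_0-\mu_j+\gamma]}\prod_{j\ne i}\frac{[x_i-x_j+\gamma]}{[x_i-x_j]},$$ $$\bar N_i=\frac{[\gamma][\tau+(L+1)\gamma+x_{\bar0}-x_i]}{[\tau+(L+1)\gamma][x_i-x_{\bar0}]}\prod_{j=1}^L\frac{[x_i-\mu_j]}{[x_{\bar0}-\mu_j+\gamma]}\prod_{j\ne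 i}\frac{[x_i-x_j+\gamma]}{[x_i-x_j]}.$$ Let $\Pi_{a,b}$ act on functions of $x$ by exchanging $x_a$ and $x_b$. For $r=(0,0)$ put $P^{r}=M_0$, $Q^{r}_j=N_j$, $\bar Q^{r}_j=\bar N_j$, $R^{r}_{ij}=0$. For $r=(0,m)$, $1\le m\le L$, with $\Pi=\Pi_{\bar0,m}$, put $P^{r}=\Pi\bar N_m$; $Q^{r}_m=\Pi N_m$ and $Q^r_j=0$ for $j\neq m$; $\bar Q^{r}_m=\Pi M_0$ and $\bar Q^{r}_j=\Pi\bar N_j$ for $j\ne m$; and, for $i<j$, $R^{r}_{im}=\Pi N_i$, $R^{r}_{mj}=\Pi N_j$, all other $R^r_{ij}=0$. For $r=(l,m)$, $1\le l<m\le L$, with $\Pi=\Pi_{\bar0,m}\circ\Pi_{0,l}$, put $P^{r}=0$; $Q^{r}_l=\Pi\bar N_m$, $Q^{r}_m=\Pi N_m$, other $Q^r_j=0$; $\bar Q^{r}_l=\Pi\bar N_l$, $\bar Q^{r}_m=\Pi N_l$, other $\bar Q^r_j=0$; and, for $i<j$, $R^{r}_{ij}$ equal to $\Pi M_0$ if $(i,j)=(l,m)$,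 to $\Pi\bar N_j$ if $i=l$, $j\ne m$, to $\Pi N_j$ if $i=m$, to $\Pi\bar N_i$ if $j=l$, to $\Pi N_i$ if $j=m$, $i\ne l$, and to $0$ otherwise. For $0\le k\le L$ let $\Omega_k^{(T)}=(\hat P_k\ \hat Q\ \hat R)$ be the square matrix of size $\frac{L(L+1)+2}{2}$ whose row number $m_{i,j}=Li-\frac{i(i+1)}2+j+1$ belongs to $r=(i,j)$, where $i=j=0$ or $0\le i<j\le L$. Its first column $\hat P_k$ has the entries $P^{r}$ if $k=0$ and $Q^{r}_k$ if $k\ge1$; its next $L$ columns are $\bar Q^{r}_1,\dots,\bar Q^{r}_L$; its last $\frac{L(L-1)}{2}$ columns are $R^{r}_{kl}$, $1\le k<l\le L$, with $R^r_{kl}$ in the column number $n_{k,l}=L(k-1)-\frac{k(k+1)}2+l$ of $\hat R$. Put $H_i^{(T)}=\det\Omega_i^{(T)}$. **Theorem.** $Z_\tau$ is a symmetric function of its $L$ arguments. Moreover, let $T\in\{A,D\}$ and let $x\in\mathbb{C}^{L+2}$ be such that $[x_a-x_b]\ne0$ for all distinct indices $a,b\in\{0,1,\dots,L,\bar0\}$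 and, for all $a\in\{0,1,\dots,L,\bar0\}$ and $1\le j\le L$, $[x_a-\mu_j]\neq0$ if $T=A$, respectively $[x_a-\mu_j+\gamma]\ne0$ if $T=D$. Then, with all coefficients evaluated at $x$, 1. for every label $r$ the orbit equation $$P^{r}Z_\tau(X)+\sum_{i=1}^LQ^{r}_iZ_\tau(X_i^0)+\sum_{i=1}^L\bar Q^{r}_iZ_\tau(X_i^{\bar0})+\sum_{1\le i<j\le L}R^{r}_{ij}Z_\tau(X_{i,j}^{0,\bar0})=0$$ holds; 2. the fundamental functional equation $$\sum_{i=0}^{L}H_i^{(T)}\,Z_\tau(X_i^0)=0$$ holds. -/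

import Mathlib

open scoped BigOperators

namespace EightVSOS

/-- The theta function
`[z] = (1/2) ∑_{n ∈ ℤ} (-1)^(n - 1/2) p^((n + 1/2)^2) e^(-(2n+1) z)` of nome `p`,
where `(-1)^(n - 1/2) = e^(iπ(n - 1/2)) = -i (-1)^n`. -/
noncomputable def theta (p : ℝ) (z : ℂ) : ℂ :=
  (1 / 2) * ∑' n : ℤ, (-Complex.I * (-1 : ℂ) ^ n) *
    ((p ^ (((n : ℝ) + 1 / 2) ^ 2) : ℝ) : ℂ) * Complex.exp (-(2 * (n : ℂ) + 1) * z)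

/-- Numerical parameters of the `L × L` model: elliptic nome `p`, anisotropy `γ`,
dynamical parameter `τ`, and inhomogeneities `μ_1, …, μ_L`. -/
structure Params (L : ℕ) where
  p : ℝ
  γ : ℂ
  τ : ℂ
  μ : Fin L → ℂ

/-! ### The partition function -/

/-- Admissible height configurations `h_{i,j} = τ + n_{i,j} γ`, `1 ≤ i, j ≤ L + 1`
(the indices are shifted to start at `0` below): neighbouring heights differ by `± γ`, and the
domain-wall boundary heights are `h_{1,j} = h_{j,1} = τ + (L + 2 - j) γ` and
`h_{L+1,j} = h_{j,L+1} = τ + j γ`. -/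
def IsHeightConfig (L : ℕ) (n : Fin (L + 1) → Fin (L + 1) → ℤ) : Prop :=
  (∀ j : Fin (L + 1), n 0 j = (L : ℤ) + 1 - (j : ℕ) ∧ n j 0 = (L : ℤ) + 1 - (j : ℕ) ∧
    n (Fin.last L) j = ((j : ℕ) : ℤ) + 1 ∧ n j (Fin.last L) = ((j : ℕ) : ℤ) + 1) ∧
  (∀ (i : Fin (L + 1)) (j : Fin L), |n i j.succ - n i j.castSucc| = 1) ∧
  (∀ (i : Fin L) (j : Fin (L + 1)), |n i.succ j - n i.castSucc j| = 1)

theorem finite_heightConfigs (L : ℕ) : {n | IsHeightConfig L n}.Finite := by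
  have hfin : {n : Fin (L + 1) → Fin (L + 1) → ℤ |
      ∀ i j, n i j ∈ Set.Icc (-(2 * (L : ℤ) + 2)) (2 * L + 2)}.Finite := by
    have h1 : {f : Fin (L + 1) → ℤ |
        ∀ j, f j ∈ Set.Icc (-(2 * (L : ℤ) + 2)) (2 * L + 2)}.Finite :=
      Set.Finite.pi' fun _ => Set.finite_Icc _ _
    exact Set.Finite.pi' fun _ : Fin (L + 1) => h1
  refine hfin.subset ?_
  rintro n ⟨hb, hr, -⟩ i j
  have key : ∀ j : Fin (L + 1), |n i j - n i 0| ≤ ((j : ℕ) : ℤ) := by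
    intro j
    induction j using Fin.induction with
    | zero => simp
    | succ j ih =>
      have h1 := hr i j
      have h2 := abs_sub_le (n i j.succ) (n i j.castSucc) (n i 0)
      have h3 : ((j.castSucc : Fin (L + 1)) : ℕ) = (j : ℕ) := rfl
      rw [h3] at ih
      rw [Fin.val_succ]
      push_cast
      linarith
  have h1 := abs_le.mp (key j)
  have h2 := (hb i).2.1
  have hi := i.is_lt
  have hj := j.is_lt
  constructor <;> omega

/-- The finite set of admissible height configurations. -/
noncomputable def heightConfigs (L : ℕ) : Finset (Fin (L + 1) → Fin (L + 1) → ℤ) :=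
  (finite_heightConfigs L).toFinset

/-- Statistical weight of a plaquette with heights
`(h_{i+1,j}, h_{i+1,j+1}; h_{i,j}, h_{i,j+1}) = τ + γ (a, b; c, d)` and `u = x_i - μ_j`.
In terms of heights, and with `t` standing for the height `h_{i+1,j}` in the last two lines:
`w(t ± γ, t; t, t ∓ γ) = [u + γ]`,
`w(t, t ± γ; t ∓ γ, t) = [t ± γ] [u] / [t]`,
`w(t, t ∓ γ; t ∓ γ, t) = [t ± u] [γ] / [t]`;
every other plaquette is forbidden. -/
noncomputable def weight {L : ℕ} (P : Params L) (u : ℂ) (a b c d : ℤ) : ℂ :=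
  if b = c ∧ ((a = b + 1 ∧ d = b - 1) ∨ (a = b - 1 ∧ d = b + 1)) then
    theta P.p (u + P.γ)
  else if a = d ∧ b = a + 1 ∧ c = a - 1 then
    theta P.p (P.τ + a * P.γ + P.γ) * theta P.p u / theta P.p (P.τ + a * P.γ)
  else if a = d ∧ b = a - 1 ∧ c = a + 1 then
    theta P.p (P.τ + a * P.γ - P.γ) * theta P.p u / theta P.p (P.τ + a * P.γ)
  else if a = d ∧ b = a - 1 ∧ c = a - 1 then
    theta P.p (P.τ + a * P.γ + u) * theta P.p P.γ / theta P.p (P.τ + a * P.γ)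
  else if a = d ∧ b = a + 1 ∧ c = a + 1 then
    theta P.p (P.τ + a * P.γ - u) * theta P.p P.γ / theta P.p (P.τ + a * P.γ)
  else 0

/-- The domain-wall partition function `Z_τ(y_1, …, y_L ∣ μ_1, …, μ_L)`. -/
noncomputable def Z {L : ℕ} (P : Params L) (y : Fin L → ℂ) : ℂ :=
  ∑ n ∈ heightConfigs L, ∏ i : Fin L, ∏ j : Fin L,
    weight P (y i - P.μ j) (n i.succ j.castSucc) (n i.succ j.succ)
      (n i.castSucc j.castSucc) (n i.castSucc j.succ)

/-! ### Spectral variables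

A point of `ℂ^(L+2)` is `x = (x_0, x_1, …, x_L, x_0bar) : Fin (L + 2) → ℂ`; the last coordinate is
the variable `x_0bar`, and `k : Fin L` stands for the index `k + 1 ∈ {1, …, L}`. -/

/-- The position of the variable with index `k + 1 ∈ {1, …, L}`. -/
def pos {L : ℕ} (k : Fin L) : Fin (L + 2) := k.succ.castSucc

/-- The position of the variable `x_0bar`. -/
def bar (L : ℕ) : Fin (L + 2) := Fin.last (L + 1)

/-- `X = (x_1, …, x_L)`. -/
def X {L : ℕ} (x : Fin (L + 2) → ℂ) : Fin L → ℂ := fun k => x (pos k)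

/-- `X_i^0` for `0 ≤ i ≤ L`: the variable `x_i` is replaced by `x_0` (and `X_0^0 = X`). -/
def X0 {L : ℕ} (x : Fin (L + 2) → ℂ) (i : Fin (L + 1)) : Fin L → ℂ :=
  fun k => if k.succ = i then x 0 else x (pos k)

/-- `X_i^{0bar}` for `1 ≤ i ≤ L`: the variable `x_i` is replaced by `x_0bar`. -/
def Xbar {L : ℕ} (x : Fin (L + 2) → ℂ) (i : Fin L) : Fin L → ℂ :=
  fun k => if k = i then x (bar L) else x (pos k)

/-- `X_{i,j}^{0,0bar}`: the variables `x_i, x_j` are replaced by `x_0, x_0bar`. -/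
def X0bar {L : ℕ} (x : Fin (L + 2) → ℂ) (i j : Fin L) : Fin L → ℂ :=
  fun k => if k = i then x 0 else if k = j then x (bar L) else x (pos k)

/-- The action `Π_{a,b}` of the transposition of the variables in positions `a`, `b` on functions
of `x_0, x_1, …, x_L, x_0bar`. -/
def Pi {L : ℕ} (a b : Fin (L + 2)) (F : (Fin (L + 2) → ℂ) → ℂ) : (Fin (L + 2) → ℂ) → ℂ :=
  fun x => F (x ∘ Equiv.swap a b)

/-! ### The coefficients of the modified equations -/

/-- The two types of equations. -/
inductive EqType
  | A
  | D

/-- The coefficient `M_0` of `Z_τ(X)`. -/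
noncomputable def M {L : ℕ} (P : Params L) : EqType → (Fin (L + 2) → ℂ) → ℂ
  | .A, x =>
    (∏ j : Fin L, (theta P.p (x (bar L) - P.μ j + P.γ) * theta P.p (x (pos j) - x (bar L) + P.γ)) /
      (theta P.p (x (bar L) - P.μ j) * theta P.p (x (pos j) - x (bar L)))) -
    ∏ j : Fin L, (theta P.p (x 0 - P.μ j + P.γ) * theta P.p (x (pos j) - x 0 + P.γ)) /
      (theta P.p (x 0 - P.μ j) * theta P.p (x (pos j) - x 0))
  | .D, x =>
    (∏ j : Fin L, (theta P.p (x (bar L) - P.μ j) * theta P.p (x (bar L) - x (pos j) + P.γ)) /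
      (theta P.p (x (bar L) - P.μ j + P.γ) * theta P.p (x (bar L) - x (pos j)))) -
    ∏ j : Fin L, (theta P.p (x 0 - P.μ j) * theta P.p (x 0 - x (pos j) + P.γ)) /
      (theta P.p (x 0 - P.μ j + P.γ) * theta P.p (x 0 - x (pos j)))

/-- The coefficient `N_i` of `Z_τ(X_i^0)`. -/
noncomputable def N {L : ℕ} (P : Params L) : EqType → Fin L → (Fin (L + 2) → ℂ) → ℂ
  | .A, i, x =>
    (theta P.p P.γ * theta P.p (P.τ + P.γ + x 0 - x (pos i))) /
      (theta P.p (P.τ + P.γ) * theta P.p (x (pos i) - x 0)) *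
    (∏ j : Fin L, theta P.p (x (pos i) - P.μ j + P.γ) / theta P.p (x 0 - P.μ j)) *
    ∏ j ∈ Finset.univ.erase i,
      theta P.p (x (pos j) - x (pos i) + P.γ) / theta P.p (x (pos j) - x (pos i))
  | .D, i, x =>
    (theta P.p P.γ * theta P.p (P.τ + (L + 1) * P.γ + x 0 - x (pos i))) /
      (theta P.p (P.τ + (L + 1) * P.γ) * theta P.p (x 0 - x (pos i))) *
    (∏ j : Fin L, theta P.p (x (pos i) - P.μ j) / theta P.p (x 0 - P.μ j + P.γ)) *
    ∏ j ∈ Finset.univ.erase i,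
      theta P.p (x (pos i) - x (pos j) + P.γ) / theta P.p (x (pos i) - x (pos j))

/-- The coefficient `N̄_i` of `Z_τ(X_i^{0bar})`. -/
noncomputable def Nbar {L : ℕ} (P : Params L) : EqType → Fin L → (Fin (L + 2) → ℂ) → ℂ
  | .A, i, x =>
    (theta P.p P.γ * theta P.p (P.τ + P.γ + x (bar L) - x (pos i))) /
      (theta P.p (P.τ + P.γ) * theta P.p (x (bar L) - x (pos i))) *
    (∏ j : Fin L, theta P.p (x (pos i) - P.μ j + P.γ) / theta P.p (x (bar L) - P.μ j)) *
    ∏ j ∈ Finset.univ.erase i,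
      theta P.p (x (pos j) - x (pos i) + P.γ) / theta P.p (x (pos j) - x (pos i))
  | .D, i, x =>
    (theta P.p P.γ * theta P.p (P.τ + (L + 1) * P.γ + x (bar L) - x (pos i))) /
      (theta P.p (P.τ + (L + 1) * P.γ) * theta P.p (x (pos i) - x (bar L))) *
    (∏ j : Fin L, theta P.p (x (pos i) - P.μ j) / theta P.p (x (bar L) - P.μ j + P.γ)) *
    ∏ j ∈ Finset.univ.erase i,
      theta P.p (x (pos i) - x (pos j) + P.γ) / theta P.p (x (pos i) - x (pos j))

/-! ### The orbit of the modified equations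

The equations are labelled by `(0, 0)` (the modified equation itself), by `(0, m)` with
`1 ≤ m ≤ L`, and by `(l, m)` with `1 ≤ l < m ≤ L`. The unknowns `Z_τ(X)`, `Z_τ(X_k^{0bar})`,
`Z_τ(X_{k,l}^{0,0bar})` that are eliminated are labelled in the same way. -/

/-- Labels `(0, 0)`, `(0, m)`, `(l, m)`. -/
abbrev Label (L : ℕ) : Type := Unit ⊕ (Fin L ⊕ {q : Fin L × Fin L // q.1 < q.2})

/-- The coefficient of `Z_τ(X)` in the equation with a given label. -/
noncomputable def coeffP {L : ℕ} (P : Params L) (T : EqType) : Label L → (Fin (L + 2) → ℂ) → ℂ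
  | .inl _ => M P T
  | .inr (.inl m) => Pi (bar L) (pos m) (Nbar P T m)
  | .inr (.inr _) => 0

/-- The coefficient of `Z_τ(X_j^0)` in the equation with a given label. -/
noncomputable def coeffQ {L : ℕ} (P : Params L) (T : EqType) :
    Label L → Fin L → (Fin (L + 2) → ℂ) → ℂ
  | .inl _, j => N P T j
  | .inr (.inl m), j => if j = m then Pi (bar L) (pos m) (N P T m) else 0
  | .inr (.inr ⟨(l, m), _⟩), j =>
    if j = l then Pi (bar L) (pos m) (Pi 0 (pos l) (Nbar P T m))
    else if j = m then Pi (bar L) (pos m) (Pi 0 (pos l) (N P T m))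
    else 0

/-- The coefficient of `Z_τ(X_j^{0bar})` in the equation with a given label. -/
noncomputable def coeffQbar {L : ℕ} (P : Params L) (T : EqType) :
    Label L → Fin L → (Fin (L + 2) → ℂ) → ℂ
  | .inl _, j => Nbar P T j
  | .inr (.inl m), j =>
    if j = m then Pi (bar L) (pos m) (M P T) else Pi (bar L) (pos m) (Nbar P T j)
  | .inr (.inr ⟨(l, m), _⟩), j =>
    if j = l then Pi (bar L) (pos m) (Pi 0 (pos l) (Nbar P T l))
    else if j = m then Pi (bar L) (pos m) (Pi 0 (pos l) (N P T l))
    else 0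

/-- The coefficient of `Z_τ(X_{i,j}^{0,0bar})`, `i < j`, in the equation with a given label. -/
noncomputable def coeffR {L : ℕ} (P : Params L) (T : EqType) :
    Label L → Fin L → Fin L → (Fin (L + 2) → ℂ) → ℂ
  | .inl _, _, _ => 0
  | .inr (.inl m), i, j =>
    if j = m then Pi (bar L) (pos m) (N P T i)
    else if i = m then Pi (bar L) (pos m) (N P T j)
    else 0
  | .inr (.inr ⟨(l, m), _⟩), i, j =>
    if i = l ∧ j = m then Pi (bar L) (pos m) (Pi 0 (pos l) (M P T))
    else if i = l then Pi (bar L) (pos m) (Pi 0 (pos l) (Nbar P T j))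
    else if i = m then Pi (bar L) (pos m) (Pi 0 (pos l) (N P T j))
    else if j = l then Pi (bar L) (pos m) (Pi 0 (pos l) (Nbar P T i))
    else if j = m then Pi (bar L) (pos m) (Pi 0 (pos l) (N P T i))
    else 0

/-! ### The matrices `Ω_k` -/

/-- `m_{i,j} = L i - i (i + 1) / 2 + j + 1`. -/
def mIndex (L : ℕ) (i j : ℤ) : ℤ := L * i - i * (i + 1) / 2 + j + 1

/-- `n_{k,l} = L (k - 1) - k (k + 1) / 2 + l`. -/
def nIndex (L : ℕ) (k l : ℤ) : ℤ := L * (k - 1) - k * (k + 1) / 2 + l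

/-- The pair `(i, j)` of a label, `(0, 0)` or `0 ≤ i < j ≤ L`. -/
def Label.pair {L : ℕ} : Label L → ℤ × ℤ
  | .inl _ => (0, 0)
  | .inr (.inl m) => (0, ((m : ℕ) : ℤ) + 1)
  | .inr (.inr ⟨(l, m), _⟩) => (((l : ℕ) : ℤ) + 1, ((m : ℕ) : ℤ) + 1)

theorem two_mul_tri (i : ℤ) : 2 * (i * (i + 1) / 2) = i * (i + 1) :=
  Int.mul_ediv_cancel' (Int.even_mul_succ_self i).two_dvd

theorem Label.pair_cases {L : ℕ} (a : Label L) :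
    a.pair = (0, 0) ∨ (0 ≤ a.pair.1 ∧ a.pair.1 < a.pair.2 ∧ a.pair.2 ≤ L) := by
  rcases a with _ | m | ⟨⟨l, m⟩, h⟩
  · exact Or.inl rfl
  · have := m.is_lt
    right
    simp only [Label.pair]
    omega
  · have := m.is_lt
    have h' : (l : ℕ) < m := h
    right
    simp only [Label.pair]
    omega

theorem Label.pair_injective {L : ℕ} : Function.Injective (Label.pair (L := L)) := by
  rintro (_ | m | ⟨⟨l, m⟩, h⟩) (_ | m' | ⟨⟨l', m'⟩, h'⟩) hh <;>
    simp only [Label.pair, Prod.mk.injEq] at hh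
  · rfl
  · omega
  · omega
  · omega
  · have : m = m' := Fin.ext (by omega)
    rw [this]
  · omega
  · omega
  · omega
  · have h1 : l = l' := Fin.ext (by omega)
    have h2 : m = m' := Fin.ext (by omega)
    subst h1 h2
    rfl

theorem mIndex_lt {L : ℕ} {i j i' j' : ℤ} (hj : j ≤ L) (hi' : i < i')
    (hij' : i' < j') (hj' : j' ≤ L) : mIndex L i j < mIndex L i' j' := by
  have h1 := two_mul_tri i
  have h2 := two_mul_tri i'
  unfold mIndex
  obtain ⟨d, rfl⟩ : ∃ d, i' = i + 1 + d := ⟨i' - i - 1, by ring⟩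
  have hd : 0 ≤ d := by linarith
  have h3 : 0 ≤ d * (2 * L - 2 * (i + 1 + d) + d + 1) := mul_nonneg hd (by linarith)
  nlinarith

theorem mIndex_pair_pos {L : ℕ} (a : Label L) : 1 ≤ mIndex L a.pair.1 a.pair.2 := by
  rcases a.pair_cases with h | ⟨h1, h2, h3⟩
  · rw [h]; simp [mIndex]
  · have h4 := two_mul_tri a.pair.1
    unfold mIndex
    nlinarith [mul_nonneg h1 (by linarith : (0 : ℤ) ≤ 2 * L - a.pair.1 - 1)]

theorem mIndex_pair_le {L : ℕ} (a : Label L) :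
    mIndex L a.pair.1 a.pair.2 ≤ ((L * (L + 1) + 2) / 2 : ℕ) := by
  have hN : 2 * ((L * (L + 1) + 2) / 2) = L * (L + 1) + 2 :=
    Nat.mul_div_cancel' ((Nat.even_mul_succ_self L).two_dvd.add dvd_rfl)
  have hN' : 2 * (((L * (L + 1) + 2) / 2 : ℕ) : ℤ) = L * (L + 1) + 2 := by exact_mod_cast hN
  rcases a.pair_cases with h | ⟨h1, h2, h3⟩
  · have h4 : mIndex L 0 0 = 1 := by simp [mIndex]
    rw [h, h4]
    nlinarith [Int.natCast_nonneg L]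
  · have h4 := two_mul_tri a.pair.1
    unfold mIndex
    have h5 : 0 ≤ ((L : ℤ) - 1 - a.pair.1) * (L - a.pair.1) :=
      mul_nonneg (by linarith) (by linarith)
    nlinarith

theorem mIndex_pair_injective {L : ℕ} :
    Function.Injective fun a : Label L => mIndex L a.pair.1 a.pair.2 := by
  have h0 : ∀ a : Label L, a.pair ≠ (0, 0) → 1 < mIndex L a.pair.1 a.pair.2 := by
    intro a ha
    rcases a.pair_cases with h | ⟨h1, h2, h3⟩
    · exact absurd h ha
    · have h4 := two_mul_tri a.pair.1
      unfold mIndex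
      nlinarith [mul_nonneg h1 (by linarith : (0 : ℤ) ≤ 2 * L - a.pair.1 - 1)]
  have h00 : mIndex L 0 0 = 1 := by simp [mIndex]
  intro a b hab
  simp only at hab
  apply Label.pair_injective
  rcases a.pair_cases with ha | ⟨ha1, ha2, ha3⟩
  · by_contra hne
    have := h0 b (fun hb => hne (ha.trans hb.symm))
    rw [← hab, ha, h00] at this
    exact lt_irrefl _ this
  rcases b.pair_cases with hb | ⟨hb1, hb2, hb3⟩
  · by_contra hne
    have := h0 a (fun ha => hne (ha.trans hb.symm))
    rw [hab, hb, h00] at this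
    exact lt_irrefl _ this
  rcases lt_trichotomy a.pair.1 b.pair.1 with hlt | heq | hgt
  · exact absurd hab (mIndex_lt ha3 hlt hb2 hb3).ne
  · refine Prod.ext heq ?_
    rw [heq] at hab
    unfold mIndex at hab
    linarith
  · exact absurd hab (mIndex_lt hb3 hgt ha2 ha3).ne'

theorem card_label (L : ℕ) : Fintype.card (Label L) = (L * (L + 1) + 2) / 2 := by
  have hpairs : Fintype.card {q : Fin L × Fin L // q.1 < q.2} = L * (L - 1) / 2 := by
    rw [Fintype.card_subtype, Finset.card_filter, Fintype.sum_prod_type_right]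
    have : ∀ y : Fin L, (∑ x : Fin L, if x < y then 1 else 0) = (y : ℕ) := by
      intro y
      rw [← Finset.card_filter, ← Fin.card_Iio y]
      congr 1
      ext z
      simp
    rw [Finset.sum_congr rfl fun y _ => this y]
    rw [Fin.sum_univ_eq_sum_range (fun i => i) L, Finset.sum_range_id]
  rw [Fintype.card_sum, Fintype.card_sum, hpairs, Fintype.card_unit, Fintype.card_fin]
  have h1 := Nat.mul_div_cancel' ((Nat.even_mul_pred_self L).two_dvd)
  have h2 : L * (L + 1) = L * (L - 1) + 2 * L := by
    cases L with
    | zero => rfl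
    | succ k => rw [Nat.add_sub_cancel]; ring
  omega

/-- The numbering of labels by `1, …, (L (L + 1) + 2) / 2`; in terms of pairs it is `m_{i,j}`
(shifted by one, since `Fin` starts at `0`). -/
noncomputable def labelEquiv (L : ℕ) : Label L ≃ Fin ((L * (L + 1) + 2) / 2) :=
  Equiv.ofBijective
    (fun a => ⟨(mIndex L a.pair.1 a.pair.2 - 1).toNat, by
      have h1 := mIndex_pair_pos a
      have h2 := mIndex_pair_le a
      omega⟩)
    (by
      rw [Fintype.bijective_iff_injective_and_card]
      refine ⟨?_, by rw [card_label, Fintype.card_fin]⟩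
      intro a b hab
      have h1 := mIndex_pair_pos a
      have h2 := mIndex_pair_pos b
      have h3 := congrArg Fin.val hab
      simp only at h3
      exact mIndex_pair_injective (by simp only; omega))

/-- As a row, the equation `(i, j)` has the number `m_{i,j}`. -/
theorem labelEquiv_row {L : ℕ} (a : Label L) :
    ((labelEquiv L a : ℕ) : ℤ) + 1 = mIndex L a.pair.1 a.pair.2 := by
  have h1 := mIndex_pair_pos a
  simp only [labelEquiv, Equiv.ofBijective_apply]
  omega

/-- The first column of `Ω_k` is the single column of the block `P̂_k`. -/
theorem labelEquiv_col_P {L : ℕ} : ((labelEquiv L (.inl ()) : ℕ) : ℤ) + 1 = 1 := by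
  rw [labelEquiv_row]
  simp [mIndex, Label.pair]

/-- The next `L` columns are those of the block `Q̂`, in their order. -/
theorem labelEquiv_col_Q {L : ℕ} (k : Fin L) :
    ((labelEquiv L (.inr (.inl k)) : ℕ) : ℤ) + 1 = 1 + (((k : ℕ) : ℤ) + 1) := by
  rw [labelEquiv_row]
  simp only [mIndex, Label.pair]
  norm_num
  ring

/-- The last `L (L - 1) / 2` columns are those of the block `R̂`, numbered by `n_{k,l}`. -/
theorem labelEquiv_col_R {L : ℕ} (q : {q : Fin L × Fin L // q.1 < q.2}) :
    ((labelEquiv L (.inr (.inr q)) : ℕ) : ℤ) + 1 =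
      1 + L + nIndex L (((q.1.1 : ℕ) : ℤ) + 1) (((q.1.2 : ℕ) : ℤ) + 1) := by
  rw [labelEquiv_row]
  obtain ⟨⟨l, m⟩, h⟩ := q
  simp only [mIndex, nIndex, Label.pair]
  ring

/-- The first column `P̂_k` of `Ω_k`: the coefficients of `Z_τ(X)` for `k = 0`, and those of
`Z_τ(X_k^0)` for `1 ≤ k ≤ L`. -/
noncomputable def firstCol {L : ℕ} (P : Params L) (T : EqType) (k : Fin (L + 1)) (r : Label L) :
    (Fin (L + 2) → ℂ) → ℂ :=
  Fin.cases (coeffP P T r) (fun k' : Fin L => coeffQ P T r k') k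

/-- The square matrix `Ω_k = (P̂_k  Q̂  R̂)` of size `(L (L + 1) + 2) / 2`. -/
noncomputable def Omega {L : ℕ} (P : Params L) (T : EqType) (k : Fin (L + 1))
    (x : Fin (L + 2) → ℂ) :
    Matrix (Fin ((L * (L + 1) + 2) / 2)) (Fin ((L * (L + 1) + 2) / 2)) ℂ :=
  Matrix.reindex (labelEquiv L) (labelEquiv L) (Matrix.of fun r c => match c with
    | .inl _ => firstCol P T k r x
    | .inr (.inl j) => coeffQbar P T r j x
    | .inr (.inr q) => coeffR P T r q.1.1 q.1.2 x)

/-- The coefficient `H_k = det Ω_k`. -/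
noncomputable def H {L : ℕ} (P : Params L) (T : EqType) (k : Fin (L + 1))
    (x : Fin (L + 2) → ℂ) : ℂ :=
  (Omega P T k x).det

/-- No denominator occurring in the coefficients of the equations of type `T` vanishes at `x`,
apart from those that depend on `τ` and `γ` only. -/
def IsRegular {L : ℕ} (P : Params L) (T : EqType) (x : Fin (L + 2) → ℂ) : Prop :=
  (∀ a b : Fin (L + 2), a ≠ b → theta P.p (x a - x b) ≠ 0) ∧
  match T with
  | .A => ∀ (a : Fin (L + 2)) (j : Fin L), theta P.p (x a - P.μ j) ≠ 0
  | .D => ∀ (a : Fin (L + 2)) (j : Fin L), theta P.p (x a - P.μ j + P.γ) ≠ 0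

end EightVSOS

/-! The analytic input is Weierstrass's identity `theta_three_term`. A product [x+y][x−y] is, up to
a factor, a 2×2 determinant f(x)g(y) − g(x)f(y) (`theta_mul_theta`), so the three-term identity is
the Plücker relation for four vectors in the plane. It implies the Yang–Baxter equation for the
plaquette weights (`yang_baxter`).

The lattice is read as a product of column-to-column operators `latOp` between a left and a right
column of heights. By Yang–Baxter, one additional plaquette can be pulled through all columns, and
this exchanges the spectral parameters of two neighbouring rows (`swapOp_latOp`). On the left, where
the heights descend, the plaquette is the scalar [u+γ]. On the right it is the same scalar if the
heights are monotone there, which gives the symmetry of Z; at a local extremum of the right column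
it mixes two columns, which gives the exchange relations `amp_exchange_succ` and
`amp_exchange_castSucc`.

The linear equations come from a lattice with L+1 rows and L columns whose right column ascends
except for one descent (`kinkCol`). With the descent in the bottom or the top row, that row is
frozen: it contributes an explicit product and leaves a lattice with L rows (`latOp_bottom`,
`latOp_top`). The exchange relations carry the descent from one end to the other, as in the
algebraic Bethe ansatz, and express the lattice with the descent at one end as a sum over the row
that is removed at the other end (`bethe_expansion`). One end yields values of Z in L of the L+1
variables; the other yields a product in the extra variable y times a function of X alone. After
division by this product, a combination of values of Z does not depend on y (`exists_const_A`,
`exists_const_D`; the two types are the two directions of transport). Subtracting its values at y =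
x_0 and at the barred variable gives the modified equation.

The modified equation holds at every regular point, so the variables may be permuted in it. By
symmetry each resulting value of Z is again one of Z(X), Z(X_i^0), Z(X_i^{0bar}),
Z(X_{i,j}^{0,0bar}); this is the orbit (`orbit_equation`). Cramer's rule eliminates the last two
families (`sum_det_updateCol_eq_zero`).

These lattice arguments divide by [τ+nγ] for n outside 1, …, L+1 as well. They are therefore carried
out for generic τ, a dense set by Baire's theorem, and the results extend by continuity in τ,
because Z involves only heights between 1 and L+1 (`eq_of_generic`, `continuousAt_Z_τ`). -/

namespace EightVSOS

/-! ### The theta function -/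

/-- The general term of the theta series, with the power of the nome written as an exponential. -/
noncomputable def thetaTerm (p : ℝ) (z : ℂ) (n : ℤ) : ℂ :=
  (-Complex.I * (-1 : ℂ) ^ n) *
    Complex.exp (((n : ℂ) + 1 / 2) ^ 2 * (Real.log p : ℝ) - (2 * (n : ℂ) + 1) * z)

theorem theta_eq_tsum {p : ℝ} (hp : 0 < p) (z : ℂ) :
    theta p z = (1 / 2) * ∑' n : ℤ, thetaTerm p z n := by
  unfold theta thetaTerm
  congr 1
  refine tsum_congr fun n => ?_
  rw [Real.rpow_def_of_pos hp, mul_assoc]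
  congr 1
  push_cast
  rw [← Complex.exp_add]
  congr 1
  ring

/-- The modular parameter and the argument for which the theta function becomes Mathlib's. -/
theorem thetaTerm_eq_jacobi (p : ℝ) (z : ℂ) (n : ℤ) :
    thetaTerm p z n = -Complex.I * Complex.exp ((Real.log p : ℝ) / 4 - z) *
      jacobiTheta₂_term n (1 / 2 + ((Real.log p : ℝ) - 2 * z) / (2 * Real.pi * Complex.I))
        ((Real.log p : ℝ) / (Real.pi * Complex.I)) := by
  have h1 : (-1 : ℂ) ^ n = Complex.exp (n * (Real.pi * Complex.I)) := by
    rw [Complex.exp_int_mul, Complex.exp_pi_mul_I]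
  have hpi : (Real.pi : ℂ) ≠ 0 := by exact_mod_cast Real.pi_ne_zero
  have hI := Complex.I_ne_zero
  unfold thetaTerm jacobiTheta₂_term
  rw [h1, mul_assoc, mul_assoc, ← Complex.exp_add, ← Complex.exp_add]
  congr 2
  field_simp
  ring

theorem im_modulus_pos {p : ℝ} (hp0 : 0 < p) (hp1 : p < 1) :
    0 < ((Real.log p : ℝ) / (Real.pi * Complex.I) : ℂ).im := by
  have h : ((Real.log p : ℝ) / (Real.pi * Complex.I) : ℂ)
      = ((-Real.log p / Real.pi : ℝ) : ℂ) * Complex.I := by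
    have hpi : (Real.pi : ℂ) ≠ 0 := by exact_mod_cast Real.pi_ne_zero
    have hI := Complex.I_ne_zero
    have hII : Complex.I ^ 2 = -1 := Complex.I_sq
    push_cast
    field_simp
    rw [hII]
    ring
  rw [h, Complex.re_ofReal_mul |> fun _ => Complex.im_ofReal_mul]
  simp only [Complex.I_im, mul_one]
  exact div_pos (neg_pos.mpr (Real.log_neg hp0 hp1)) Real.pi_pos

theorem summable_thetaTerm {p : ℝ} (hp0 : 0 < p) (hp1 : p < 1) (z : ℂ) :
    Summable (thetaTerm p z) := by
  have h := ((summable_jacobiTheta₂_term_iff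
    (1 / 2 + ((Real.log p : ℝ) - 2 * z) / (2 * Real.pi * Complex.I)) _).mpr
      (im_modulus_pos hp0 hp1)).mul_left
        (-Complex.I * Complex.exp ((Real.log p : ℝ) / 4 - z))
  exact h.congr fun n => (thetaTerm_eq_jacobi p z n).symm

/-- Completing the half-integer squares makes the function an exponential times `jacobiTheta₂` at an
affine argument, and analyticity is inherited from there. -/
theorem differentiable_theta {p : ℝ} (hp0 : 0 < p) (hp1 : p < 1) :
    Differentiable ℂ (theta p) := by
  have h : theta p = fun z => (1 / 2) * (-Complex.I * Complex.exp ((Real.log p : ℝ) / 4 - z) *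
      jacobiTheta₂ (1 / 2 + ((Real.log p : ℝ) - 2 * z) / (2 * Real.pi * Complex.I))
        ((Real.log p : ℝ) / (Real.pi * Complex.I))) := by
    funext z
    rw [theta_eq_tsum hp0, jacobiTheta₂]
    simp_rw [thetaTerm_eq_jacobi]
    rw [tsum_mul_left]
  rw [h]
  intro z
  have hj := differentiableAt_jacobiTheta₂_fst
    (1 / 2 + ((Real.log p : ℝ) - 2 * z) / (2 * Real.pi * Complex.I)) (im_modulus_pos hp0 hp1)
  have hc : DifferentiableAt ℂ (fun z : ℂ => jacobiTheta₂
      (1 / 2 + ((Real.log p : ℝ) - 2 * z) / (2 * Real.pi * Complex.I))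
        ((Real.log p : ℝ) / (Real.pi * Complex.I))) z :=
    DifferentiableAt.comp (f := fun z : ℂ =>
      1 / 2 + ((Real.log p : ℝ) - 2 * z) / (2 * Real.pi * Complex.I)) z hj (by fun_prop)
  fun_prop

theorem continuous_theta {p : ℝ} (hp0 : 0 < p) (hp1 : p < 1) : Continuous (theta p) :=
  (differentiable_theta hp0 hp1).continuous

/-- The reindexing n ↦ −1−n negates n + 1/2 and changes the parity of n. -/
theorem theta_neg {p : ℝ} (hp : 0 < p) (z : ℂ) : theta p (-z) = -theta p z := by
  rw [theta_eq_tsum hp, theta_eq_tsum hp, ← mul_neg, ← tsum_neg,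
    ← (Equiv.subLeft (-1 : ℤ)).tsum_eq (fun n => -thetaTerm p z n)]
  congr 1
  refine tsum_congr fun n => ?_
  have h1 : (-1 : ℂ) ^ (-1 - n) = -(-1 : ℂ) ^ n := by
    rw [zpow_sub₀ (by norm_num)]
    rcases Int.even_or_odd n with h | h <;> simp [h.neg_one_zpow]
  simp only [thetaTerm, Equiv.subLeft_apply]
  rw [h1]
  push_cast
  rw [show ((-1 : ℂ) - n + 1 / 2) ^ 2 * (Real.log p : ℝ) - (2 * (-1 - (n : ℂ)) + 1) * z
    = ((n : ℂ) + 1 / 2) ^ 2 * (Real.log p : ℝ) - (2 * (n : ℂ) + 1) * -z by ring]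
  ring

/-! ### Product formula and the Weierstrass identity. -/

/-- Splitting `(m, n) ∈ ℤ × ℤ` according to the parity of `m - n`. -/
noncomputable def paritySplit : (ℤ × ℤ) ⊕ (ℤ × ℤ) ≃ ℤ × ℤ :=
  Equiv.ofBijective
    (Sum.elim (fun q => (q.1 + q.2, q.1 - q.2 - 1)) (fun q => (q.1 + q.2, q.1 - q.2))) (by
      constructor
      · rintro (⟨a, b⟩ | ⟨a, b⟩) (⟨c, d⟩ | ⟨c, d⟩) h <;>
          simp only [Sum.elim_inl, Sum.elim_inr, Prod.mk.injEq] at h <;>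
          first
            | omega
            | (congr 2 <;> omega)
      · rintro ⟨m, n⟩
        rcases Int.even_or_odd' (m - n) with ⟨k, hk | hk⟩
        · exact ⟨.inr (m - k, k), by simp; omega⟩
        · exact ⟨.inl (m - k, k), by simp; omega⟩)

theorem paritySplit_inl (a b : ℤ) : paritySplit (.inl (a, b)) = (a + b, a - b - 1) := rfl

theorem paritySplit_inr (a b : ℤ) : paritySplit (.inr (a, b)) = (a + b, a - b) := rfl

theorem tsum_paritySplit {F : ℤ × ℤ → ℂ} (hF : Summable F) :
    Summable (fun q => F (paritySplit (.inl q))) ∧ Summable (fun q => F (paritySplit (.inr q))) ∧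
    ∑' q, F q = (∑' q, F (paritySplit (.inl q))) + ∑' q, F (paritySplit (.inr q)) := by
  have hsE : Summable (fun q => F (paritySplit q)) := paritySplit.summable_iff.mpr hF
  have hsl := hsE.comp_injective (i := Sum.inl) Sum.inl_injective
  have hsr := hsE.comp_injective (i := Sum.inr) Sum.inr_injective
  refine ⟨hsl, hsr, ?_⟩
  rw [← paritySplit.tsum_eq F]
  exact (HasSum.sum hsl.hasSum hsr.hasSum).tsum_eq

/-- `thetaEven` and `thetaOdd` are theta series of nome p², summed over the integers and the
half-integers respectively. -/
noncomputable def thetaEven (p : ℝ) (x : ℂ) : ℂ :=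
  ∑' a : ℤ, Complex.exp (2 * (a : ℂ) ^ 2 * (Real.log p : ℝ) - 4 * a * x)

noncomputable def thetaOdd (p : ℝ) (x : ℂ) : ℂ :=
  ∑' b : ℤ, Complex.exp ((2 * (b : ℂ) + 1) ^ 2 / 2 * (Real.log p : ℝ) - 2 * (2 * b + 1) * x)

/-- In the double series over (m, n), x is multiplied by m+n+1 and y by m−n, and the quadratic form
(m+1/2)² + (n+1/2)² is diagonal in the same combinations. These two integers have opposite parity,
so the sum splits into two products, with opposite signs coming from (−1)^(m+n). -/
theorem theta_mul_theta {p : ℝ} (hp0 : 0 < p) (hp1 : p < 1) (x y : ℂ) :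
    4 * (theta p (x + y) * theta p (x - y)) =
      thetaEven p x * thetaOdd p y - thetaOdd p x * thetaEven p y := by
  have hs1 := (summable_thetaTerm hp0 hp1 (x + y)).norm
  have hs2 := (summable_thetaTerm hp0 hp1 (x - y)).norm
  have hsum := summable_mul_of_summable_norm hs1 hs2
  have hprod := tsum_mul_tsum_of_summable_norm hs1 hs2
  obtain ⟨F, hF⟩ : ∃ F : ℤ × ℤ → ℂ,
      F = fun q => thetaTerm p (x + y) q.1 * thetaTerm p (x - y) q.2 := ⟨_, rfl⟩
  rw [← hF] at hsum hprod
  have h1 : ∀ q : ℤ × ℤ, F (paritySplit (.inl q)) =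
      Complex.exp (2 * (q.1 : ℂ) ^ 2 * (Real.log p : ℝ) - 4 * q.1 * x) *
      Complex.exp ((2 * (q.2 : ℂ) + 1) ^ 2 / 2 * (Real.log p : ℝ) - 2 * (2 * q.2 + 1) * y) := by
    rintro ⟨a, b⟩
    have hm : (-1 : ℂ) ^ (a + b) * (-1 : ℂ) ^ (a - b - 1) = -1 := by
      rw [← zpow_add₀ (by norm_num), show a + b + (a - b - 1) = 2 * (a - 1) + 1 by ring]
      exact Odd.neg_one_zpow ⟨a - 1, rfl⟩
    simp only [hF, paritySplit_inl, thetaTerm]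
    rw [mul_mul_mul_comm, ← Complex.exp_add, ← Complex.exp_add, mul_mul_mul_comm, hm]
    push_cast
    rw [show -Complex.I * -Complex.I * -1 = 1 by rw [neg_mul_neg, Complex.I_mul_I]; ring, one_mul]
    congr 1
    ring
  have h2 : ∀ q : ℤ × ℤ, F (paritySplit (.inr q)) =
      -(Complex.exp ((2 * (q.1 : ℂ) + 1) ^ 2 / 2 * (Real.log p : ℝ) - 2 * (2 * q.1 + 1) * x) *
      Complex.exp (2 * (q.2 : ℂ) ^ 2 * (Real.log p : ℝ) - 4 * q.2 * y)) := by
    rintro ⟨a, b⟩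
    have hm : (-1 : ℂ) ^ (a + b) * (-1 : ℂ) ^ (a - b) = 1 := by
      rw [← zpow_add₀ (by norm_num), show a + b + (a - b) = a + a by ring]
      exact Even.neg_one_zpow ⟨a, rfl⟩
    simp only [hF, paritySplit_inr, thetaTerm]
    rw [mul_mul_mul_comm, ← Complex.exp_add, ← Complex.exp_add, mul_mul_mul_comm, hm]
    push_cast
    rw [show -Complex.I * -Complex.I * 1 = -1 by rw [neg_mul_neg, Complex.I_mul_I]; ring,
      neg_one_mul]
    congr 2
    ring
  obtain ⟨hsl, hsr, htot⟩ := tsum_paritySplit hsum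
  have hdouble : ∀ u w : ℤ → ℂ, Summable (fun q : ℤ × ℤ => u q.1 * w q.2) →
      ∑' q : ℤ × ℤ, u q.1 * w q.2 = (∑' a, u a) * ∑' b, w b := by
    intro u w h
    rw [h.tsum_prod, ← tsum_mul_right]
    refine tsum_congr fun a => ?_
    dsimp only
    rw [tsum_mul_left]
  simp_rw [h1] at htot hsl
  simp_rw [h2] at htot hsr
  rw [tsum_neg, hdouble (fun a : ℤ => Complex.exp (2 * (a : ℂ) ^ 2 * (Real.log p : ℝ) - 4 * a * x))
      (fun b : ℤ => Complex.exp
        ((2 * (b : ℂ) + 1) ^ 2 / 2 * (Real.log p : ℝ) - 2 * (2 * b + 1) * y)) hsl,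
    hdouble (fun a : ℤ => Complex.exp
        ((2 * (a : ℂ) + 1) ^ 2 / 2 * (Real.log p : ℝ) - 2 * (2 * a + 1) * x))
      (fun b : ℤ => Complex.exp (2 * (b : ℂ) ^ 2 * (Real.log p : ℝ) - 4 * b * y))
      (by simpa using hsr.neg)] at htot
  rw [theta_eq_tsum hp0, theta_eq_tsum hp0]
  rw [htot] at hprod
  unfold thetaEven thetaOdd
  linear_combination hprod

/-- The three-term identity of Weierstrass. -/
theorem theta_three_term {p : ℝ} (hp0 : 0 < p) (hp1 : p < 1) (a b c d : ℂ) :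
    theta p (a + b) * theta p (a - b) * (theta p (c + d) * theta p (c - d)) +
    theta p (b + c) * theta p (b - c) * (theta p (a + d) * theta p (a - d)) +
    theta p (c + a) * theta p (c - a) * (theta p (b + d) * theta p (b - d)) = 0 := by
  have h : ∀ x y, theta p (x + y) * theta p (x - y) =
      (thetaEven p x * thetaOdd p y - thetaOdd p x * thetaEven p y) / 4 := fun x y => by
    rw [← theta_mul_theta hp0 hp1]; ring
  simp only [h]
  ring

/-! ### Density of generic parameters. -/

theorem dense_theta_ne {p : ℝ} (hp0 : 0 < p) (hp1 : p < 1) {w : ℂ} (hw : theta p w ≠ 0) (c : ℂ) :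
    Dense {z : ℂ | theta p (z + c) ≠ 0} := by
  have han : AnalyticOnNhd ℂ (theta p) Set.univ :=
    (differentiable_theta hp0 hp1).differentiableOn.analyticOnNhd isOpen_univ
  rw [← Set.compl_ofPred, ← interior_eq_empty_iff_dense_compl, Set.eq_empty_iff_forall_notMem]
  intro z hz
  have h0 : ∀ᶠ y in nhds z, theta p (y + c) = 0 := mem_interior_iff_mem_nhds.mp hz
  have h1 : ∀ᶠ y in nhds (z + c), theta p y = 0 := by
    have ht : Filter.Tendsto (fun y : ℂ => y - c) (nhds (z + c)) (nhds z) := by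
      have : Continuous fun y : ℂ => y - c := by fun_prop
      simpa using this.tendsto (z + c)
    simpa using ht.eventually h0
  -- Identity theorem: an entire function that vanishes on an open set is zero, contrary to `hw`.
  have h2 : theta p = 0 :=
    han.eq_of_eventuallyEq (g := 0) (fun _ _ => analyticAt_const) h1
  exact hw (congrFun h2 w)

/-- For generic `τ` no height weight `[τ + n γ]` vanishes. -/
theorem dense_generic {p : ℝ} (hp0 : 0 < p) (hp1 : p < 1) {w : ℂ} (hw : theta p w ≠ 0) (γ : ℂ) :
    Dense {z : ℂ | ∀ n : ℤ, theta p (z + n * γ) ≠ 0} := by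
  rw [Set.ofPred_forall]
  -- Baire: one open dense condition for each of countably many n.
  refine dense_iInter_of_isOpen (fun n => ?_) fun n => dense_theta_ne hp0 hp1 hw _
  have : Continuous fun z : ℂ => theta p (z + n * γ) :=
    (continuous_theta hp0 hp1).comp (by fun_prop)
  exact isOpen_ne_fun this continuous_const

/-! ### Consequences of the three-term identity -/

/-- The `theta_star` identities, together with `theta_cube`, are the relations needed for the
boundary heights of the Yang–Baxter equation. In each, the four arguments of the three-term identity
are half-sums and half-differences of the wanted theta arguments. -/
theorem theta_star_one {p : ℝ} (hp0 : 0 < p) (hp1 : p < 1) (t v₀ v₁ γ : ℂ) :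
    theta p (v₀ - v₁ + γ) * theta p (t + γ + v₁) * theta p v₀ * theta p t -
      theta p (t + γ + v₀) * theta p v₁ * theta p (t - (v₀ - v₁)) * theta p γ -
      theta p (v₀ + γ) * theta p (t + v₁) * theta p (t + γ) * theta p (v₀ - v₁) = 0 := by
  have h := theta_three_term hp0 hp1 (1 / 2 * t + 1 / 2 * v₀ + γ) (-1 / 2 * t + 1 / 2 * v₀ - v₁)
    (1 / 2 * t + 1 / 2 * v₀) (-1 / 2 * t + 1 / 2 * v₀)
  rw [show (1 / 2 * t + 1 / 2 * v₀ + γ) + (-1 / 2 * t + 1 / 2 * v₀ - v₁) = v₀ - v₁ + γ by ring,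
    show (1 / 2 * t + 1 / 2 * v₀ + γ) - (-1 / 2 * t + 1 / 2 * v₀ - v₁) = t + γ + v₁ by ring,
    show (1 / 2 * t + 1 / 2 * v₀) + (-1 / 2 * t + 1 / 2 * v₀) = v₀ by ring,
    show (1 / 2 * t + 1 / 2 * v₀) - (-1 / 2 * t + 1 / 2 * v₀) = t by ring,
    show (-1 / 2 * t + 1 / 2 * v₀ - v₁) + (1 / 2 * t + 1 / 2 * v₀) = v₀ - v₁ by ring,
    show (-1 / 2 * t + 1 / 2 * v₀ - v₁) - (1 / 2 * t + 1 / 2 * v₀) = -(t + v₁) by ring,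
    show (1 / 2 * t + 1 / 2 * v₀ + γ) + (-1 / 2 * t + 1 / 2 * v₀) = v₀ + γ by ring,
    show (1 / 2 * t + 1 / 2 * v₀ + γ) - (-1 / 2 * t + 1 / 2 * v₀) = t + γ by ring,
    show (1 / 2 * t + 1 / 2 * v₀) + (1 / 2 * t + 1 / 2 * v₀ + γ) = t + γ + v₀ by ring,
    show (1 / 2 * t + 1 / 2 * v₀) - (1 / 2 * t + 1 / 2 * v₀ + γ) = -γ by ring,
    show (-1 / 2 * t + 1 / 2 * v₀ - v₁) + (-1 / 2 * t + 1 / 2 * v₀) = -(t - (v₀ - v₁)) by ring,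
    show (-1 / 2 * t + 1 / 2 * v₀ - v₁) - (-1 / 2 * t + 1 / 2 * v₀) = -v₁ by ring] at h
  simp only [theta_neg hp0] at h
  linear_combination h

theorem theta_star_two {p : ℝ} (hp0 : 0 < p) (hp1 : p < 1) (t v₀ v₁ γ : ℂ) :
    theta p (v₀ - v₁ + γ) * theta p (v₁ + γ) * theta p (t + v₀) * theta p t -
      theta p (t + γ + v₀) * theta p v₁ * theta p (t - γ) * theta p (v₀ - v₁) -
      theta p (v₀ + γ) * theta p (t + v₁) * theta p (t + (v₀ - v₁)) * theta p γ = 0 := by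
  have h := theta_three_term hp0 hp1 (1 / 2 * v₀ + γ) (1 / 2 * v₀ - v₁)
    (t + 1 / 2 * v₀) (1 / 2 * v₀)
  rw [show (1 / 2 * v₀ + γ) + (1 / 2 * v₀ - v₁) = v₀ - v₁ + γ by ring,
    show (1 / 2 * v₀ + γ) - (1 / 2 * v₀ - v₁) = v₁ + γ by ring,
    show (t + 1 / 2 * v₀) + (1 / 2 * v₀) = t + v₀ by ring,
    show (t + 1 / 2 * v₀) - (1 / 2 * v₀) = t by ring,
    show (1 / 2 * v₀ - v₁) + (t + 1 / 2 * v₀) = t + (v₀ - v₁) by ring,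
    show (1 / 2 * v₀ - v₁) - (t + 1 / 2 * v₀) = -(t + v₁) by ring,
    show (1 / 2 * v₀ + γ) + (1 / 2 * v₀) = v₀ + γ by ring,
    show (1 / 2 * v₀ + γ) - (1 / 2 * v₀) = γ by ring,
    show (t + 1 / 2 * v₀) + (1 / 2 * v₀ + γ) = t + γ + v₀ by ring,
    show (t + 1 / 2 * v₀) - (1 / 2 * v₀ + γ) = t - γ by ring,
    show (1 / 2 * v₀ - v₁) + (1 / 2 * v₀) = v₀ - v₁ by ring,
    show (1 / 2 * v₀ - v₁) - (1 / 2 * v₀) = -v₁ by ring] at h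
  simp only [theta_neg hp0] at h
  linear_combination h

theorem theta_star_three {p : ℝ} (hp0 : 0 < p) (hp1 : p < 1) (t v₀ v₁ γ : ℂ) :
    theta p (t - (v₀ - v₁)) * theta p (v₁ + γ) * theta p v₀ * theta p (t + γ) -
      theta p (v₀ + γ) * theta p v₁ * theta p (t + γ - (v₀ - v₁)) * theta p t -
      theta p (t - v₀) * theta p (t + γ + v₁) * theta p γ * theta p (v₀ - v₁) = 0 := by
  have h := theta_three_term hp0 hp1 (1 / 2 * t - 1 / 2 * v₀ + v₁ + 1 / 2 * γ) (1 / 2 * t - 1 / 2 * v₀ - 1 / 2 * γ)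
    (1 / 2 * t + 1 / 2 * v₀ + 1 / 2 * γ) (-1 / 2 * t + 1 / 2 * v₀ - 1 / 2 * γ)
  rw [show (1 / 2 * t - 1 / 2 * v₀ + v₁ + 1 / 2 * γ) + (1 / 2 * t - 1 / 2 * v₀ - 1 / 2 * γ) = t - (v₀ - v₁) by ring,
    show (1 / 2 * t - 1 / 2 * v₀ + v₁ + 1 / 2 * γ) - (1 / 2 * t - 1 / 2 * v₀ - 1 / 2 * γ) = v₁ + γ by ring,
    show (1 / 2 * t + 1 / 2 * v₀ + 1 / 2 * γ) + (-1 / 2 * t + 1 / 2 * v₀ - 1 / 2 * γ) = v₀ by ring,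
    show (1 / 2 * t + 1 / 2 * v₀ + 1 / 2 * γ) - (-1 / 2 * t + 1 / 2 * v₀ - 1 / 2 * γ) = t + γ by ring,
    show (1 / 2 * t - 1 / 2 * v₀ - 1 / 2 * γ) + (1 / 2 * t + 1 / 2 * v₀ + 1 / 2 * γ) = t by ring,
    show (1 / 2 * t - 1 / 2 * v₀ - 1 / 2 * γ) - (1 / 2 * t + 1 / 2 * v₀ + 1 / 2 * γ) = -(v₀ + γ) by ring,
    show (1 / 2 * t - 1 / 2 * v₀ + v₁ + 1 / 2 * γ) + (-1 / 2 * t + 1 / 2 * v₀ - 1 / 2 * γ) = v₁ by ring,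
    show (1 / 2 * t - 1 / 2 * v₀ + v₁ + 1 / 2 * γ) - (-1 / 2 * t + 1 / 2 * v₀ - 1 / 2 * γ) = t + γ - (v₀ - v₁) by ring,
    show (1 / 2 * t + 1 / 2 * v₀ + 1 / 2 * γ) + (1 / 2 * t - 1 / 2 * v₀ + v₁ + 1 / 2 * γ) = t + γ + v₁ by ring,
    show (1 / 2 * t + 1 / 2 * v₀ + 1 / 2 * γ) - (1 / 2 * t - 1 / 2 * v₀ + v₁ + 1 / 2 * γ) = v₀ - v₁ by ring,
    show (1 / 2 * t - 1 / 2 * v₀ - 1 / 2 * γ) + (-1 / 2 * t + 1 / 2 * v₀ - 1 / 2 * γ) = -γ by ring,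
    show (1 / 2 * t - 1 / 2 * v₀ - 1 / 2 * γ) - (-1 / 2 * t + 1 / 2 * v₀ - 1 / 2 * γ) = t - v₀ by ring] at h
  simp only [theta_neg hp0] at h
  linear_combination h

/-- Case d = 0 of the three-term identity. It shares the factor [2t+γ] with `theta_star_four`; that
factor is absent from the weights and is eliminated between the two. -/
theorem theta_cube {p : ℝ} (hp0 : 0 < p) (hp1 : p < 1) (t γ : ℂ) :
    theta p (t - γ) * theta p (t + γ) * theta p (t + γ) * theta p (t + γ) -
      theta p (t + 2 * γ) * theta p t * theta p t * theta p t +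
      theta p γ * theta p γ * theta p γ * theta p (2 * t + γ) = 0 := by
  have h := theta_three_term hp0 hp1 (t) (-γ)
    (t + γ) (0)
  rw [show (t) + (-γ) = t - γ by ring,
    show (t) - (-γ) = t + γ by ring,
    show (t + γ) + (0) = t + γ by ring,
    show (t + γ) - (0) = t + γ by ring,
    show (-γ) + (t + γ) = t by ring,
    show (-γ) - (t + γ) = -(t + 2 * γ) by ring,
    show (t) + (0) = t by ring,
    show (t) - (0) = t by ring,
    show (t + γ) + (t) = 2 * t + γ by ring,
    show (t + γ) - (t) = γ by ring,
    show (-γ) + (0) = -γ by ring,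
    show (-γ) - (0) = -γ by ring] at h
  simp only [theta_neg hp0] at h
  linear_combination h

theorem theta_star_four {p : ℝ} (hp0 : 0 < p) (hp1 : p < 1) (t v₀ v₁ γ : ℂ) :
    theta p (t - v₀) * theta p (t + γ + v₁) * theta p (t + γ + (v₀ - v₁)) * theta p t -
      theta p (t - (v₀ - v₁)) * theta p (t - v₁) * theta p (t + γ + v₀) * theta p (t + γ) +
      theta p (2 * t + γ) * theta p (v₀ + γ) * theta p v₁ * theta p (v₀ - v₁) = 0 := by
  have h := theta_three_term hp0 hp1 (t - 1 / 2 * v₀ + 1 / 2 * v₁ + 1 / 2 * γ) (-1 / 2 * v₀ - 1 / 2 * v₁ - 1 / 2 * γ)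
    (t + 1 / 2 * v₀ - 1 / 2 * v₁ + 1 / 2 * γ) (1 / 2 * v₀ - 1 / 2 * v₁ + 1 / 2 * γ)
  rw [show (t - 1 / 2 * v₀ + 1 / 2 * v₁ + 1 / 2 * γ) + (-1 / 2 * v₀ - 1 / 2 * v₁ - 1 / 2 * γ) = t - v₀ by ring,
    show (t - 1 / 2 * v₀ + 1 / 2 * v₁ + 1 / 2 * γ) - (-1 / 2 * v₀ - 1 / 2 * v₁ - 1 / 2 * γ) = t + γ + v₁ by ring,
    show (t + 1 / 2 * v₀ - 1 / 2 * v₁ + 1 / 2 * γ) + (1 / 2 * v₀ - 1 / 2 * v₁ + 1 / 2 * γ) = t + γ + (v₀ - v₁) by ring,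
    show (t + 1 / 2 * v₀ - 1 / 2 * v₁ + 1 / 2 * γ) - (1 / 2 * v₀ - 1 / 2 * v₁ + 1 / 2 * γ) = t by ring,
    show (-1 / 2 * v₀ - 1 / 2 * v₁ - 1 / 2 * γ) + (t + 1 / 2 * v₀ - 1 / 2 * v₁ + 1 / 2 * γ) = t - v₁ by ring,
    show (-1 / 2 * v₀ - 1 / 2 * v₁ - 1 / 2 * γ) - (t + 1 / 2 * v₀ - 1 / 2 * v₁ + 1 / 2 * γ) = -(t + γ + v₀) by ring,
    show (t - 1 / 2 * v₀ + 1 / 2 * v₁ + 1 / 2 * γ) + (1 / 2 * v₀ - 1 / 2 * v₁ + 1 / 2 * γ) = t + γ by ring,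
    show (t - 1 / 2 * v₀ + 1 / 2 * v₁ + 1 / 2 * γ) - (1 / 2 * v₀ - 1 / 2 * v₁ + 1 / 2 * γ) = t - (v₀ - v₁) by ring,
    show (t + 1 / 2 * v₀ - 1 / 2 * v₁ + 1 / 2 * γ) + (t - 1 / 2 * v₀ + 1 / 2 * v₁ + 1 / 2 * γ) = 2 * t + γ by ring,
    show (t + 1 / 2 * v₀ - 1 / 2 * v₁ + 1 / 2 * γ) - (t - 1 / 2 * v₀ + 1 / 2 * v₁ + 1 / 2 * γ) = v₀ - v₁ by ring,
    show (-1 / 2 * v₀ - 1 / 2 * v₁ - 1 / 2 * γ) + (1 / 2 * v₀ - 1 / 2 * v₁ + 1 / 2 * γ) = -v₁ by ring,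
    show (-1 / 2 * v₀ - 1 / 2 * v₁ - 1 / 2 * γ) - (1 / 2 * v₀ - 1 / 2 * v₁ + 1 / 2 * γ) = -(v₀ + γ) by ring] at h
  simp only [theta_neg hp0] at h
  linear_combination h

/-- The identity behind the recursion of the Bethe coefficients: x and y belong to the neighbouring
rows being exchanged, z to a row above them. -/
theorem theta_exchange {p : ℝ} (hp0 : 0 < p) (hp1 : p < 1) (t x y γ z : ℂ) :
    theta p (t + x - z) * theta p (y - z + γ) * theta p (t + γ) * theta p (y - x) -
      theta p (y - x + γ) * theta p (t + γ + x - z) * theta p t * theta p (y - z) +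
      theta p γ * theta p (t + x - y) * theta p (t + γ + y - z) * theta p (x - z) = 0 := by
  have h := theta_three_term hp0 hp1 (1 / 2 * t + 1 / 2 * x + 1 / 2 * y + 1 / 2 * γ - z) (1 / 2 * t + 1 / 2 * x - 1 / 2 * y - 1 / 2 * γ)
    (1 / 2 * t - 1 / 2 * x + 1 / 2 * y + 1 / 2 * γ) (1 / 2 * t + 1 / 2 * x - 1 / 2 * y + 1 / 2 * γ)
  rw [show (1 / 2 * t + 1 / 2 * x + 1 / 2 * y + 1 / 2 * γ - z) + (1 / 2 * t + 1 / 2 * x - 1 / 2 * y - 1 / 2 * γ) = t + x - z by ring,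
    show (1 / 2 * t + 1 / 2 * x + 1 / 2 * y + 1 / 2 * γ - z) - (1 / 2 * t + 1 / 2 * x - 1 / 2 * y - 1 / 2 * γ) = y - z + γ by ring,
    show (1 / 2 * t - 1 / 2 * x + 1 / 2 * y + 1 / 2 * γ) + (1 / 2 * t + 1 / 2 * x - 1 / 2 * y + 1 / 2 * γ) = t + γ by ring,
    show (1 / 2 * t - 1 / 2 * x + 1 / 2 * y + 1 / 2 * γ) - (1 / 2 * t + 1 / 2 * x - 1 / 2 * y + 1 / 2 * γ) = y - x by ring,
    show (1 / 2 * t + 1 / 2 * x - 1 / 2 * y - 1 / 2 * γ) + (1 / 2 * t - 1 / 2 * x + 1 / 2 * y + 1 / 2 * γ) = t by ring,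
    show (1 / 2 * t + 1 / 2 * x - 1 / 2 * y - 1 / 2 * γ) - (1 / 2 * t - 1 / 2 * x + 1 / 2 * y + 1 / 2 * γ) = -(y - x + γ) by ring,
    show (1 / 2 * t + 1 / 2 * x + 1 / 2 * y + 1 / 2 * γ - z) + (1 / 2 * t + 1 / 2 * x - 1 / 2 * y + 1 / 2 * γ) = t + γ + x - z by ring,
    show (1 / 2 * t + 1 / 2 * x + 1 / 2 * y + 1 / 2 * γ - z) - (1 / 2 * t + 1 / 2 * x - 1 / 2 * y + 1 / 2 * γ) = y - z by ring,
    show (1 / 2 * t - 1 / 2 * x + 1 / 2 * y + 1 / 2 * γ) + (1 / 2 * t + 1 / 2 * x + 1 / 2 * y + 1 / 2 * γ - z) = t + γ + y - z by ring,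
    show (1 / 2 * t - 1 / 2 * x + 1 / 2 * y + 1 / 2 * γ) - (1 / 2 * t + 1 / 2 * x + 1 / 2 * y + 1 / 2 * γ - z) = -(x - z) by ring,
    show (1 / 2 * t + 1 / 2 * x - 1 / 2 * y - 1 / 2 * γ) + (1 / 2 * t + 1 / 2 * x - 1 / 2 * y + 1 / 2 * γ) = t + x - y by ring,
    show (1 / 2 * t + 1 / 2 * x - 1 / 2 * y - 1 / 2 * γ) - (1 / 2 * t + 1 / 2 * x - 1 / 2 * y + 1 / 2 * γ) = -γ by ring] at h
  simp only [theta_neg hp0] at h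
  linear_combination h

/-! ### The Yang–Baxter equation for the plaquette weights -/

/-- Reversing all heights is a symmetry because theta is odd: the signs cancel in each quotient. It
halves the case analysis for Yang–Baxter. -/
theorem weight_neg {L : ℕ} (P : Params L) (hp : 0 < P.p) (u : ℂ) (a b c d : ℤ) :
    weight { P with τ := -P.τ } u a b c d = weight P u (-a) (-b) (-c) (-d) := by
  have h : ∀ z w : ℂ, z = -w → theta P.p z = -theta P.p w := by
    rintro z w rfl
    exact theta_neg hp w
  have h0 := h (-P.τ + a * P.γ) (P.τ + ((-a : ℤ) : ℂ) * P.γ) (by push_cast; ring)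
  have h1 := h (-P.τ + a * P.γ + P.γ) (P.τ + ((-a : ℤ) : ℂ) * P.γ - P.γ) (by push_cast; ring)
  have h2 := h (-P.τ + a * P.γ - P.γ) (P.τ + ((-a : ℤ) : ℂ) * P.γ + P.γ) (by push_cast; ring)
  have h3 := h (-P.τ + a * P.γ + u) (P.τ + ((-a : ℤ) : ℂ) * P.γ - u) (by push_cast; ring)
  have h4 := h (-P.τ + a * P.γ - u) (P.τ + ((-a : ℤ) : ℂ) * P.γ + u) (by push_cast; ring)
  have c1 : (-b = -c ∧ ((-a = -b + 1 ∧ -d = -b - 1) ∨ (-a = -b - 1 ∧ -d = -b + 1))) ↔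
      (b = c ∧ ((a = b + 1 ∧ d = b - 1) ∨ (a = b - 1 ∧ d = b + 1))) := by omega
  have c2 : (-a = -d ∧ -b = -a + 1 ∧ -c = -a - 1) ↔ (a = d ∧ b = a - 1 ∧ c = a + 1) := by omega
  have c3 : (-a = -d ∧ -b = -a - 1 ∧ -c = -a + 1) ↔ (a = d ∧ b = a + 1 ∧ c = a - 1) := by omega
  have c4 : (-a = -d ∧ -b = -a - 1 ∧ -c = -a - 1) ↔ (a = d ∧ b = a + 1 ∧ c = a + 1) := by omega
  have c5 : (-a = -d ∧ -b = -a + 1 ∧ -c = -a + 1) ↔ (a = d ∧ b = a - 1 ∧ c = a - 1) := by omega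
  have c23 : (a = d ∧ b = a + 1 ∧ c = a - 1) → ¬(a = d ∧ b = a - 1 ∧ c = a + 1) := by omega
  have c45 : (a = d ∧ b = a - 1 ∧ c = a - 1) → ¬(a = d ∧ b = a + 1 ∧ c = a + 1) := by omega
  unfold weight
  dsimp only
  rw [h0, h1, h2, h3, h4]
  simp only [c1, c2, c3, c4, c5, neg_mul, neg_div_neg_eq]
  by_cases k2 : a = d ∧ b = a + 1 ∧ c = a - 1
  · simp only [if_pos k2, if_neg (c23 k2)]
  · simp only [if_neg k2]
    by_cases k4 : a = d ∧ b = a - 1 ∧ c = a - 1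
    · simp only [if_pos k4, if_neg (c45 k4)]
    · simp only [if_neg k4]

/-- The height `± 1` encoded by a boolean. -/
def sgn (b : Bool) : ℤ := bif b then 1 else -1

-- Yang–Baxter with the lower left height normalised to 0 and the middle one to 1. The test function
-- `φ` of the new middle height combines the equations for all its values. The remaining outer
-- heights leave eight cases.
set_option maxHeartbeats 1000000 in
theorem yang_baxter_pos {L : ℕ} (P : Params L) (hp0 : 0 < P.p) (hp1 : P.p < 1)
    (hg : ∀ n : ℤ, theta P.p (P.τ + n * P.γ) ≠ 0)
    (v₀ v₁ : ℂ) (hi lo' hi' : ℤ) (φ : ℤ → ℂ) (h2 : hi = 1 + 1 ∨ hi = 1 + -1)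
    (h3 : lo' = 1 ∨ lo' = -1) (h4 : hi' = hi + 1 ∨ hi' = hi + -1) :
    ∑ b : Bool, ∑ e : Bool, weight P (v₀ - v₁) hi (sgn b) 1 0 *
      (weight P v₁ hi hi' (sgn b) (sgn b + sgn e) *
        weight P v₀ (sgn b) (sgn b + sgn e) 0 lo' * φ (sgn b + sgn e)) =
    ∑ b : Bool, ∑ e : Bool, weight P v₀ hi hi' 1 (1 + sgn b) *
      weight P v₁ 1 (1 + sgn b) 0 lo' *
        (weight P (v₀ - v₁) hi' (lo' + sgn e) (1 + sgn b) lo' * φ (lo' + sgn e)) := by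
  have g0 : theta P.p P.τ ≠ 0 := by simpa using hg 0
  have g1 : theta P.p (P.τ + P.γ) ≠ 0 := by simpa using hg 1
  have g2 : theta P.p (P.τ + 2 * P.γ) ≠ 0 := by simpa using hg 2
  have g3 : theta P.p (P.τ - P.γ) ≠ 0 := by simpa [sub_eq_add_neg] using hg (-1)
  obtain ⟨t₂, r0⟩ : ∃ t₂, P.τ + 2 * P.γ = t₂ := ⟨_, rfl⟩
  rw [r0] at g2
  have r1 : P.τ + P.γ + P.γ = t₂ := by rw [← r0]; ring
  have r2 : P.τ - P.γ + P.γ = P.τ := by ring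
  have r3 : P.τ + P.γ - P.γ = P.τ := by ring
  have r4 : P.τ + -1 * P.γ = P.τ - P.γ := by ring
  rcases h2 with rfl | rfl <;> rcases h3 with rfl | rfl <;> rcases h4 with rfl | rfl
  all_goals
    simp only [Fintype.sum_bool, sgn, cond_true, cond_false, Int.reduceAdd, Int.reduceNeg]
  all_goals
    simp only [weight, Int.reduceAdd, Int.reduceSub, Int.reduceEq, and_true, and_false,
      or_true, or_false, if_true, if_false, and_self, or_self,
      Int.reduceNeg]
  all_goals
    simp only [zero_mul, mul_zero, add_zero, zero_add, Int.cast_zero, Int.cast_one, Int.cast_neg,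
      Int.cast_ofNat, one_mul, r0, r1, r3, r4]
  · ring
  -- Here the new middle height can be 2 or 0, and each value requires its own theta identity.
  · have e1 := theta_star_one hp0 hp1 (P.τ + P.γ) v₀ v₁ P.γ
    have e2 := theta_star_two hp0 hp1 (P.τ + P.γ) v₀ v₁ P.γ
    simp only [r1, r3] at e1 e2
    field_simp
    linear_combination theta P.p P.γ * (φ 2 * e1 + φ 0 * e2)
  · ring
  -- For the value 0 of the new middle height the outer heights alternate 0, 1 around the hexagon,
  -- and both sides have two terms. No single three-term identity suffices; `theta_cube` and
  -- `theta_star_four` are combined so that the factor [2τ+γ] drops out.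
  · have e1 := theta_star_three hp0 hp1 P.τ v₀ v₁ P.γ
    have e2 := theta_cube hp0 hp1 P.τ P.γ
    have e3 := theta_star_four hp0 hp1 P.τ v₀ v₁ P.γ
    rw [r0] at e2
    generalize 2 * P.τ + P.γ = w at e2 e3
    field_simp
    linear_combination φ 2 * theta P.p P.γ * theta P.p P.τ * theta P.p t₂ * e1 +
      φ 0 * theta P.p (v₀ + P.γ) * theta P.p v₁ * theta P.p (v₀ - v₁) * e2 -
      φ 0 * theta P.p P.γ ^ 3 * e3
  · have e1 := theta_star_one hp0 hp1 P.τ v₀ v₁ P.γ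
    field_simp
    linear_combination -φ 0 * theta P.p P.γ * e1
  · have e2 := theta_star_two hp0 hp1 (-P.τ) v₀ v₁ P.γ
    rw [show -P.τ + v₀ = -(P.τ - v₀) by ring, show -P.τ + P.γ + v₀ = -(P.τ - P.γ - v₀) by ring,
      show -P.τ - P.γ = -(P.τ + P.γ) by ring, show -P.τ + v₁ = -(P.τ - v₁) by ring,
      show -P.τ + (v₀ - v₁) = -(P.τ - (v₀ - v₁)) by ring] at e2
    simp only [theta_neg hp0] at e2
    field_simp
    linear_combination -φ 0 * theta P.p P.γ * e2
  · have e1 := theta_star_three hp0 hp1 (P.τ - P.γ) v₀ v₁ P.γ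
    simp only [r2] at e1
    field_simp
    linear_combination -φ 0 * theta P.p P.γ * e1

theorem yang_baxter_neg {L : ℕ} (P : Params L) (hp0 : 0 < P.p) (hp1 : P.p < 1)
    (hg : ∀ n : ℤ, theta P.p (P.τ + n * P.γ) ≠ 0)
    (v₀ v₁ : ℂ) (hi lo' hi' : ℤ) (φ : ℤ → ℂ) (h2 : hi = -1 + 1 ∨ hi = -1 + -1)
    (h3 : lo' = 1 ∨ lo' = -1) (h4 : hi' = hi + 1 ∨ hi' = hi + -1) :
    ∑ b : Bool, ∑ e : Bool, weight P (v₀ - v₁) hi (sgn b) (-1) 0 *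
      (weight P v₁ hi hi' (sgn b) (sgn b + sgn e) *
        weight P v₀ (sgn b) (sgn b + sgn e) 0 lo' * φ (sgn b + sgn e)) =
    ∑ b : Bool, ∑ e : Bool, weight P v₀ hi hi' (-1) (-1 + sgn b) *
      weight P v₁ (-1) (-1 + sgn b) 0 lo' *
        (weight P (v₀ - v₁) hi' (lo' + sgn e) (-1 + sgn b) lo' * φ (lo' + sgn e)) := by
  have hg' : ∀ n : ℤ, theta P.p (-P.τ + n * P.γ) ≠ 0 := fun n => by
    rw [show -P.τ + n * P.γ = -(P.τ + ((-n : ℤ) : ℂ) * P.γ) by push_cast; ring, theta_neg hp0]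
    exact neg_ne_zero.mpr (hg (-n))
  have h := yang_baxter_pos { P with τ := -P.τ } hp0 hp1 hg' v₀ v₁ (-hi) (-lo') (-hi')
    (fun z => φ (-z)) (by omega) (by omega) (by omega)
  simp only [Fintype.sum_bool, weight_neg P hp0, neg_add, neg_neg, sgn, cond_true, cond_false,
    neg_zero] at h ⊢
  linear_combination h

/-- Only the actual heights matter, so a common integer shift can be absorbed into τ. This permits
normalising one height to 0. -/
theorem weight_shift {L : ℕ} (P : Params L) (m : ℤ) (u : ℂ) (a b c d : ℤ) :
    weight { P with τ := P.τ + m * P.γ } u a b c d =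
      weight P u (m + a) (m + b) (m + c) (m + d) := by
  have h : P.τ + m * P.γ + a * P.γ = P.τ + ((m + a : ℤ) : ℂ) * P.γ := by push_cast; ring
  unfold weight
  dsimp only
  rw [h]
  simp only [add_assoc, add_sub_assoc, add_right_inj]

/-- A plaquette is forbidden unless its left heights differ by one. -/
theorem weight_eq_zero_of_left {L : ℕ} (P : Params L) (u : ℂ) {a b c d : ℤ}
    (h : ¬(a = c + 1 ∨ a = c + -1)) : weight P u a b c d = 0 := by
  unfold weight
  split_ifs <;> first
    | with_reducible rfl
    | (exfalso; omega)

/-- A plaquette is forbidden unless its lower heights differ by one. -/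
theorem weight_eq_zero_of_bottom {L : ℕ} (P : Params L) (u : ℂ) {a b c d : ℤ}
    (h : ¬(c = d + 1 ∨ c = d + -1)) : weight P u a b c d = 0 := by
  unfold weight
  split_ifs <;> first
    | with_reducible rfl
    | (exfalso; omega)

/-- No assumption on the left heights is needed: if two neighbours do not differ by one, every term
on either side contains a forbidden plaquette. -/
theorem yang_baxter {L : ℕ} (P : Params L) (hp0 : 0 < P.p) (hp1 : P.p < 1)
    (hg : ∀ n : ℤ, theta P.p (P.τ + n * P.γ) ≠ 0)
    (v₀ v₁ : ℂ) (lo mid hi lo' hi' : ℤ) (φ : ℤ → ℂ)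
    (h3 : lo' = lo + 1 ∨ lo' = lo + -1) (h4 : hi' = hi + 1 ∨ hi' = hi + -1) :
    ∑ b : Bool, ∑ e : Bool, weight P (v₀ - v₁) hi (lo + sgn b) mid lo *
      (weight P v₁ hi hi' (lo + sgn b) (lo + sgn b + sgn e) *
        weight P v₀ (lo + sgn b) (lo + sgn b + sgn e) lo lo' * φ (lo + sgn b + sgn e)) =
    ∑ b : Bool, ∑ e : Bool, weight P v₀ hi hi' mid (mid + sgn b) *
      weight P v₁ mid (mid + sgn b) lo lo' *
        (weight P (v₀ - v₁) hi' (lo' + sgn e) (mid + sgn b) lo' * φ (lo' + sgn e)) := by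
  by_cases h1 : mid = lo + 1 ∨ mid = lo + -1
  swap
  · simp only [weight_eq_zero_of_left P v₁ h1, weight_eq_zero_of_bottom P (v₀ - v₁) h1, zero_mul,
      mul_zero, Finset.sum_const_zero]
  by_cases h2 : hi = mid + 1 ∨ hi = mid + -1
  swap
  · simp only [weight_eq_zero_of_left P (v₀ - v₁) h2, weight_eq_zero_of_left P v₀ h2, zero_mul,
      Finset.sum_const_zero]
  have hg' : ∀ n : ℤ, theta P.p (P.τ + lo * P.γ + n * P.γ) ≠ 0 := fun n => by
    rw [show P.τ + lo * P.γ + n * P.γ = P.τ + ((lo + n : ℤ) : ℂ) * P.γ by push_cast; ring]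
    exact hg (lo + n)
  rcases h1 with rfl | rfl
  · have h := yang_baxter_pos { P with τ := P.τ + lo * P.γ } hp0 hp1 hg' v₀ v₁ (hi - lo)
      (lo' - lo) (hi' - lo) (fun z => φ (lo + z)) (by omega) (by omega) (by omega)
    simp only [weight_shift] at h
    simpa only [add_sub_cancel, ← add_assoc, add_zero] using h
  · have h := yang_baxter_neg { P with τ := P.τ + lo * P.γ } hp0 hp1 hg' v₀ v₁ (hi - lo)
      (lo' - lo) (hi' - lo) (fun z => φ (lo + z)) (by omega) (by omega) (by omega)
    simp only [weight_shift] at h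
    simpa only [add_sub_cancel, ← add_assoc, add_zero] using h

/-! ### Column-to-column transfer operators -/

section Operators

variable {L N M : ℕ}

/-- The column obtained from `c` by moving every height up or down by one. -/
def colStep (c : Fin (N + 1) → ℤ) (ε : Fin (N + 1) → Bool) : Fin (N + 1) → ℤ :=
  fun i => c i + sgn (ε i)

/-- The weight of a column of plaquettes with left heights `c` and right heights `c'`. -/
noncomputable def colWeight (P : Params L) (v : Fin N → ℂ) (μ : ℂ) (c c' : Fin (N + 1) → ℤ) : ℂ :=
  ∏ i : Fin N, weight P (v i - μ) (c i.succ) (c' i.succ) (c i.castSucc) (c' i.castSucc)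

/-- The column-to-column transfer operator. -/
noncomputable def colOp (P : Params L) (v : Fin N → ℂ) (μ : ℂ) (f : (Fin (N + 1) → ℤ) → ℂ)
    (c : Fin (N + 1) → ℤ) : ℂ :=
  ∑ ε : Fin (N + 1) → Bool, colWeight P v μ c (colStep c ε) * f (colStep c ε)

/-- The product of the transfer operators of `M` consecutive columns. -/
noncomputable def latOp (P : Params L) (v : Fin N → ℂ) :
    (M : ℕ) → (Fin M → ℂ) → ((Fin (N + 1) → ℤ) → ℂ) → (Fin (N + 1) → ℤ) → ℂ
  | 0, _, f => f
  | M + 1, μ, f => colOp P v (μ 0) (latOp P v M (fun j => μ j.succ) f)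

/-- The operator of a single plaquette that exchanges the rows `k` and `k + 1`. -/
noncomputable def swapOp (P : Params L) (k : Fin N) (u : ℂ) (f : (Fin (N + 2) → ℤ) → ℂ)
    (c : Fin (N + 2) → ℤ) : ℂ :=
  ∑ b : Bool, weight P u (c k.succ.succ) (c k.castSucc.castSucc + sgn b) (c k.succ.castSucc)
      (c k.castSucc.castSucc) *
    f (Function.update c k.succ.castSucc (c k.castSucc.castSucc + sgn b))

/-- Each assignment arises from exactly two choices of the overwritten value. This isolates the
summation over one coordinate without splitting the index type, at the cost of a factor 2. -/
theorem sum_sum_update {ι : Type*} [Fintype ι] [DecidableEq ι] (m : ι) (F : (ι → Bool) → ℂ) :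
    ∑ ε : ι → Bool, ∑ e : Bool, F (Function.update ε m e) = 2 * ∑ ε : ι → Bool, F ε := by
  have h1 : ∀ ε : ι → Bool, ∑ e : Bool, F (Function.update ε m e) =
      F ε + F (Function.update ε m (!ε m)) := by
    intro ε
    have h := Function.update_eq_self m ε
    rw [Fintype.sum_bool]
    cases hb : ε m
    · rw [hb] at h
      rw [h, Bool.not_false, add_comm]
    · rw [hb] at h
      rw [h, Bool.not_true]
  have hinv : Function.Involutive fun ε : ι → Bool => Function.update ε m (!ε m) := by
    intro ε
    simp
  rw [Finset.sum_congr rfl fun ε _ => h1 ε, Finset.sum_add_distrib, two_mul]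
  congr 1
  exact Equiv.sum_comp hinv.toPerm F

/-- Splitting off the two rows adjacent to an updated height. -/
theorem colWeight_update (P : Params L) (k : Fin N) (v : Fin (N + 1) → ℂ) (μ : ℂ)
    (c c' : Fin (N + 2) → ℤ) (h g : ℤ) :
    colWeight P v μ (Function.update c k.succ.castSucc h) (Function.update c' k.succ.castSucc g) =
      (∏ i ∈ (Finset.univ.erase k.castSucc).erase k.succ,
        weight P (v i - μ) (c i.succ) (c' i.succ) (c i.castSucc) (c' i.castSucc)) *
      (weight P (v k.succ - μ) (c k.succ.succ) (c' k.succ.succ) h g *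
        weight P (v k.castSucc - μ) h g (c k.castSucc.castSucc) (c' k.castSucc.castSucc)) := by
  have hne : k.succ ≠ k.castSucc := (Fin.castSucc_lt_succ).ne'
  unfold colWeight
  rw [← Finset.prod_erase_mul _ _ (Finset.mem_univ k.castSucc),
    ← Finset.prod_erase_mul _ _ (Finset.mem_erase.mpr ⟨hne, Finset.mem_univ k.succ⟩), mul_assoc]
  have hm : k.castSucc.succ = k.succ.castSucc := Fin.succ_castSucc k
  have h1 : k.succ.succ ≠ k.succ.castSucc := (Fin.castSucc_lt_succ).ne'
  have h2 : k.castSucc.castSucc ≠ k.succ.castSucc := by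
    rw [← hm]; exact (Fin.castSucc_lt_succ).ne
  congr 1
  · refine Finset.prod_congr rfl fun i hi => ?_
    rw [Finset.mem_erase, Finset.mem_erase] at hi
    have h3 : i.castSucc ≠ k.succ.castSucc := fun h => hi.1 (Fin.castSucc_injective _ h)
    have h4 : i.succ ≠ k.succ.castSucc := fun h => hi.2.1 (Fin.succ_injective _ (h.trans hm.symm))
    simp only [Function.update_of_ne h3, Function.update_of_ne h4]
  · rw [hm]
    simp only [Function.update_self, Function.update_of_ne h1, Function.update_of_ne h2]

theorem sgn_cases (b : Bool) : sgn b = 1 ∨ sgn b = -1 := by cases b <;> simp [sgn]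

/-- The plaquette operator intertwines the transfer operators with exchanged rows. -/
theorem swapOp_colOp (P : Params L) (hp0 : 0 < P.p) (hp1 : P.p < 1)
    (hg : ∀ n : ℤ, theta P.p (P.τ + n * P.γ) ≠ 0) (k : Fin N) (v : Fin (N + 1) → ℂ) (μ : ℂ)
    (f : (Fin (N + 2) → ℤ) → ℂ) :
    swapOp P k (v k.castSucc - v k.succ) (colOp P v μ f) =
      colOp P (v ∘ Equiv.swap k.castSucc k.succ) μ (swapOp P k (v k.castSucc - v k.succ) f) := by
  funext c
  have hm : k.castSucc.succ = k.succ.castSucc := Fin.succ_castSucc k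
  have h1 : k.succ.succ ≠ k.succ.castSucc := (Fin.castSucc_lt_succ).ne'
  have h2 : k.castSucc.castSucc ≠ k.succ.castSucc := by
    rw [← hm]; exact (Fin.castSucc_lt_succ).ne
  -- The factor 2 is the redundancy of `sum_sum_update`, which singles out the step of the height
  -- between the two rows.
  apply mul_left_cancel₀ (two_ne_zero (α := ℂ))
  have hstep : ∀ (ε : Fin (N + 2) → Bool) (e : Bool) (h : ℤ),
      colStep (Function.update c k.succ.castSucc h) (Function.update ε k.succ.castSucc e) =
        Function.update (colStep c ε) k.succ.castSucc (h + sgn e) := by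
    intro ε e h
    funext i
    by_cases hi : i = k.succ.castSucc
    · subst hi; simp [colStep]
    · simp only [colStep, Function.update_of_ne hi]
  have hstep' : ∀ (ε : Fin (N + 2) → Bool) (e : Bool),
      colStep c (Function.update ε k.succ.castSucc e) =
        Function.update (colStep c ε) k.succ.castSucc (c k.succ.castSucc + sgn e) := by
    intro ε e
    rw [← hstep, Function.update_eq_self]
  have hL : 2 * swapOp P k (v k.castSucc - v k.succ) (colOp P v μ f) c =
      ∑ ε : Fin (N + 2) → Bool, ∑ b : Bool, ∑ e : Bool,
        weight P (v k.castSucc - v k.succ) (c k.succ.succ) (c k.castSucc.castSucc + sgn b)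
          (c k.succ.castSucc) (c k.castSucc.castSucc) *
        (colWeight P v μ (Function.update c k.succ.castSucc (c k.castSucc.castSucc + sgn b))
          (Function.update (colStep c ε) k.succ.castSucc (c k.castSucc.castSucc + sgn b + sgn e)) *
        f (Function.update (colStep c ε) k.succ.castSucc
          (c k.castSucc.castSucc + sgn b + sgn e))) := by
    unfold swapOp
    rw [Finset.mul_sum, Finset.sum_comm]
    refine Finset.sum_congr rfl fun b _ => ?_
    rw [mul_left_comm, colOp, ← sum_sum_update k.succ.castSucc, Finset.mul_sum]
    refine Finset.sum_congr rfl fun ε _ => ?_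
    rw [Finset.mul_sum]
    refine Finset.sum_congr rfl fun e _ => ?_
    rw [hstep]
  have hR : 2 * colOp P (v ∘ Equiv.swap k.castSucc k.succ) μ
        (swapOp P k (v k.castSucc - v k.succ) f) c =
      ∑ ε : Fin (N + 2) → Bool, ∑ b : Bool, ∑ e : Bool,
        colWeight P (v ∘ Equiv.swap k.castSucc k.succ) μ
          (Function.update c k.succ.castSucc (c k.succ.castSucc))
          (Function.update (colStep c ε) k.succ.castSucc (c k.succ.castSucc + sgn b)) *
        (weight P (v k.castSucc - v k.succ) (colStep c ε k.succ.succ)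
          (colStep c ε k.castSucc.castSucc + sgn e) (c k.succ.castSucc + sgn b)
          (colStep c ε k.castSucc.castSucc) *
        f (Function.update (colStep c ε) k.succ.castSucc
          (colStep c ε k.castSucc.castSucc + sgn e))) := by
    rw [colOp, ← sum_sum_update k.succ.castSucc]
    refine Finset.sum_congr rfl fun ε _ => Finset.sum_congr rfl fun b _ => ?_
    rw [hstep', swapOp, Finset.mul_sum, Function.update_eq_self]
    refine Finset.sum_congr rfl fun e _ => ?_
    simp only [Function.update_self, Function.update_of_ne h1, Function.update_of_ne h2,
      Function.update_idem]
  rw [hL, hR]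
  refine Finset.sum_congr rfl fun ε _ => ?_
  simp only [colWeight_update]
  have hrest : (∏ i ∈ (Finset.univ.erase k.castSucc).erase k.succ,
        weight P ((v ∘ Equiv.swap k.castSucc k.succ) i - μ) (c i.succ) (colStep c ε i.succ)
          (c i.castSucc) (colStep c ε i.castSucc)) =
      ∏ i ∈ (Finset.univ.erase k.castSucc).erase k.succ,
        weight P (v i - μ) (c i.succ) (colStep c ε i.succ)
          (c i.castSucc) (colStep c ε i.castSucc) := by
    refine Finset.prod_congr rfl fun i hi => ?_
    rw [Finset.mem_erase, Finset.mem_erase] at hi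
    rw [Function.comp_apply, Equiv.swap_apply_of_ne_of_ne hi.2.1 hi.1]
  rw [hrest]
  simp only [Function.comp_apply, Equiv.swap_apply_left, Equiv.swap_apply_right]
  -- All heights except the updated one are now fixed, and only the two rows `k` and `k + 1` differ
  -- between the sides.
  have hyb := yang_baxter P hp0 hp1 hg (v k.castSucc - μ) (v k.succ - μ) (c k.castSucc.castSucc)
    (c k.succ.castSucc) (c k.succ.succ) (colStep c ε k.castSucc.castSucc)
    (colStep c ε k.succ.succ)
    (fun g => f (Function.update (colStep c ε) k.succ.castSucc g))
    ((sgn_cases _).imp (congrArg _) (congrArg _)) ((sgn_cases _).imp (congrArg _) (congrArg _))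
  rw [sub_sub_sub_cancel_right] at hyb
  set rest := ∏ i ∈ (Finset.univ.erase k.castSucc).erase k.succ,
        weight P (v i - μ) (c i.succ) (colStep c ε i.succ)
          (c i.castSucc) (colStep c ε i.castSucc)
  have hyb' := congrArg (fun z => rest * z) hyb
  simp only [Finset.mul_sum] at hyb'
  calc _ = _ := Finset.sum_congr rfl fun b _ => Finset.sum_congr rfl fun e _ => by ring
    _ = _ := hyb'
    _ = _ := Finset.sum_congr rfl fun b _ => Finset.sum_congr rfl fun e _ => by ring

/-- The plaquette is pulled through the lattice one column at a time. -/
theorem swapOp_latOp (P : Params L) (hp0 : 0 < P.p) (hp1 : P.p < 1)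
    (hg : ∀ n : ℤ, theta P.p (P.τ + n * P.γ) ≠ 0) (k : Fin N) (v : Fin (N + 1) → ℂ)
    (μ : Fin M → ℂ) (f : (Fin (N + 2) → ℤ) → ℂ) :
    swapOp P k (v k.castSucc - v k.succ) (latOp P v M μ f) =
      latOp P (v ∘ Equiv.swap k.castSucc k.succ) M μ
        (swapOp P k (v k.castSucc - v k.succ) f) := by
  induction M with
  | zero => rfl
  | succ M ih => rw [latOp, swapOp_colOp P hp0 hp1 hg, ih, latOp]

theorem latOp_linear (P : Params L) (v : Fin N → ℂ) (μ : Fin M → ℂ) (a b : ℂ)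
    (f g : (Fin (N + 1) → ℤ) → ℂ) (c : Fin (N + 1) → ℤ) :
    latOp P v M μ (fun c => a * f c + b * g c) c =
      a * latOp P v M μ f c + b * latOp P v M μ g c := by
  induction M generalizing c with
  | zero => rfl
  | succ M ih =>
    simp only [latOp, colOp, ih, Finset.mul_sum, ← Finset.sum_add_distrib]
    exact Finset.sum_congr rfl fun ε _ => by ring

/-- The indicator function of a column. -/
def delta (r : Fin (N + 1) → ℤ) (c : Fin (N + 1) → ℤ) : ℂ := if c = r then 1 else 0

/-- A height cannot travel further than the number of columns. -/
theorem latOp_delta_eq_zero (P : Params L) (v : Fin N → ℂ) (μ : Fin M → ℂ)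
    (r c : Fin (N + 1) → ℤ) (i : Fin (N + 1)) (h : (M : ℤ) < c i - r i ∨ (M : ℤ) < r i - c i) :
    latOp P v M μ (delta r) c = 0 := by
  induction M generalizing c with
  | zero =>
    rw [latOp, delta, if_neg]
    rintro rfl
    simp at h
  | succ M ih =>
    rw [latOp, colOp]
    refine Finset.sum_eq_zero fun ε _ => ?_
    rw [ih, mul_zero]
    have := sgn_cases (ε i)
    simp only [colStep]
    push_cast at h
    omega

end Operators

section Decoupling

variable {L N M : ℕ}

/-! ### Freezing of the outermost rows -/

/-- The two lowest heights must drop by M in M columns, so they drop in every column. Each plaquette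
of the lowest row then has weight [t−γ][u]/[t], and the height factors telescope to the ratio of the
first and the last one. -/
theorem latOp_bottom (P : Params L) (hg : ∀ n : ℤ, theta P.p (P.τ + n * P.γ) ≠ 0)
    (v : Fin (N + 1) → ℂ) (μ : Fin M → ℂ) (r c : Fin (N + 2) → ℤ)
    (hr : r (Fin.succ 0) = r 0 - 1) (h0 : c 0 = r 0 + M)
    (h1 : c (Fin.succ 0) = r (Fin.succ 0) + M) :
    theta P.p (P.τ + (r (Fin.succ 0) + M : ℤ) * P.γ) * latOp P v M μ (delta r) c =
      theta P.p (P.τ + (r (Fin.succ 0) : ℤ) * P.γ) * (∏ j, theta P.p (v 0 - μ j)) *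
        latOp P (fun i => v i.succ) M μ (delta fun i => r i.succ) (fun i => c i.succ) := by
  induction M generalizing c with
  | zero =>
    have hd : delta r c = delta (fun i => r i.succ) (fun i => c i.succ) := by
      unfold delta
      congr 1
      simp only [eq_iff_iff, funext_iff]
      constructor
      · intro h i
        exact h i.succ
      · intro h i
        refine Fin.cases ?_ h i
        simpa using h0
    simp [latOp, hd]
  | succ M ih =>
    simp only [latOp, colOp]
    rw [← Equiv.sum_comp (Fin.consEquiv fun _ : Fin (N + 2) => Bool), Fintype.sum_prod_type,
      Fintype.sum_bool, Finset.sum_eq_zero (s := Finset.univ) (f := fun ε' : Fin (N + 1) → Bool =>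
        colWeight P v (μ 0) c (colStep c ((Fin.consEquiv fun _ : Fin (N + 2) => Bool) (true, ε'))) *
          latOp P v M (fun j => μ j.succ) (delta r)
            (colStep c ((Fin.consEquiv fun _ : Fin (N + 2) => Bool) (true, ε')))), zero_add,
      Finset.mul_sum, Finset.mul_sum]
    swap
    -- An upward step leaves a distance M + 2 for the M remaining columns.
    · intro ε' _
      rw [latOp_delta_eq_zero P v _ r _ 0, mul_zero]
      left
      simp [colStep, sgn, h0, Fin.consEquiv]
      omega
    refine Finset.sum_congr rfl fun ε' _ => ?_
    have htail : (fun i : Fin (N + 1) => colStep c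
        ((Fin.consEquiv fun _ : Fin (N + 2) => Bool) (false, ε')) i.succ) =
          colStep (fun i => c i.succ) ε' := by
      funext i
      simp [colStep, Fin.consEquiv]
    have hz : colStep c ((Fin.consEquiv fun _ : Fin (N + 2) => Bool) (false, ε')) 0 = c 0 - 1 := by
      simp [colStep, sgn, Fin.consEquiv, sub_eq_add_neg]
    set c' := colStep c ((Fin.consEquiv fun _ : Fin (N + 2) => Bool) (false, ε')) with hc'
    have hs : ∀ i : Fin (N + 1), c' i.succ = c i.succ + sgn (ε' i) := fun i => congrFun htail i
    rw [← htail]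
    cases hε : ε' 0
    · have e1 : c' (Fin.succ 0) = c (Fin.succ 0) - 1 := by rw [hs, hε]; rfl
      have ih' := ih (fun j => μ j.succ) c' (by rw [hz, h0]; push_cast; ring)
        (by rw [e1, h1]; push_cast; ring)
      have hw : colWeight P v (μ 0) c c' =
          (theta P.p (P.τ + (r (Fin.succ 0) + M : ℤ) * P.γ) * theta P.p (v 0 - μ 0) /
            theta P.p (P.τ + (r (Fin.succ 0) + (M + 1 : ℕ) : ℤ) * P.γ)) *
          colWeight P (fun i => v i.succ) (μ 0) (fun i => c i.succ) (fun i => c' i.succ) := by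
        unfold colWeight
        rw [Fin.prod_univ_succ]
        congr 1
        have e2 : c (Fin.castSucc 0) = c (Fin.succ 0) + 1 := by
          rw [h1, hr, Fin.castSucc_zero, h0]; push_cast; ring
        have e3 : c' (Fin.castSucc 0) = c (Fin.succ 0) := by
          rw [Fin.castSucc_zero, hz, h0, h1, hr]; push_cast; ring
        rw [e1, e2, e3, ← h1]
        have e4 : P.τ + (r (Fin.succ 0) + M : ℤ) * P.γ =
            P.τ + (c (Fin.succ 0) : ℤ) * P.γ - P.γ := by
          rw [h1]; push_cast; ring
        rw [e4]
        generalize c (Fin.succ 0) = a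
        unfold weight
        rw [if_neg (by omega), if_neg (by omega), if_pos (by omega)]
      rw [hw, Fin.prod_univ_succ]
      have hne := hg (r (Fin.succ 0) + (M + 1 : ℕ))
      generalize theta P.p (P.τ + (r (Fin.succ 0) + (M + 1 : ℕ) : ℤ) * P.γ) = A at hne ⊢
      generalize theta P.p (P.τ + (r (Fin.succ 0) + M : ℤ) * P.γ) = B at ih' ⊢
      generalize theta P.p (P.τ + (r (Fin.succ 0) : ℤ) * P.γ) = C at ih' ⊢
      field_simp
      linear_combination theta P.p (v 0 - μ 0) * colWeight P (fun i => v i.succ) (μ 0)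
        (fun i => c i.succ) (fun i => c' i.succ) * ih'
    -- The second height moves away from its target, so both sides vanish.
    · have e1 : c' (Fin.succ 0) = c (Fin.succ 0) + 1 := by rw [hs, hε]; rfl
      rw [latOp_delta_eq_zero P v _ r _ (Fin.succ 0), latOp_delta_eq_zero P _ _ _ _ 0]
      · ring
      · left
        rw [e1, h1]; push_cast; omega
      · left
        rw [e1, h1]; push_cast; omega

/-- The two highest heights must rise in every column. Every plaquette of the top row is then of
type [u+γ], whose weight does not depend on the height. -/
theorem latOp_top (P : Params L)
    (v : Fin (N + 1) → ℂ) (μ : Fin M → ℂ) (r c : Fin (N + 2) → ℤ)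
    (hr : r (Fin.last N).castSucc = r (Fin.last N).succ + 1)
    (h0 : c (Fin.last N).succ = r (Fin.last N).succ - M)
    (h1 : c (Fin.last N).castSucc = r (Fin.last N).castSucc - M) :
    latOp P v M μ (delta r) c = (∏ j, theta P.p (v (Fin.last N) - μ j + P.γ)) *
        latOp P (fun i => v i.castSucc) M μ (delta fun i => r i.castSucc)
          (fun i => c i.castSucc) := by
  induction M generalizing c with
  | zero =>
    have hd : delta r c = delta (fun i => r i.castSucc) (fun i => c i.castSucc) := by
      unfold delta
      congr 1
      simp only [eq_iff_iff, funext_iff]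
      constructor
      · intro h i
        exact h i.castSucc
      · intro h i
        refine Fin.lastCases ?_ h i
        simpa using h0
    simp [latOp, hd]
  | succ M ih =>
    simp only [latOp, colOp]
    rw [← Equiv.sum_comp (Fin.snocEquiv fun _ : Fin (N + 2) => Bool), Fintype.sum_prod_type,
      Fintype.sum_bool, Finset.sum_eq_zero (s := Finset.univ) (f := fun ε' : Fin (N + 1) → Bool =>
        colWeight P v (μ 0) c (colStep c ((Fin.snocEquiv fun _ : Fin (N + 2) => Bool) (false, ε'))) *
          latOp P v M (fun j => μ j.succ) (delta r)
            (colStep c ((Fin.snocEquiv fun _ : Fin (N + 2) => Bool) (false, ε')))), add_zero,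
      Finset.mul_sum]
    swap
    · intro ε' _
      rw [latOp_delta_eq_zero P v _ r _ (Fin.last N).succ, mul_zero]
      right
      rw [Fin.succ_last] at h0 ⊢
      simp only [colStep, Fin.snocEquiv, Equiv.coe_fn_mk, Fin.snoc_last, sgn, cond_false]
      push_cast at h0
      omega
    refine Finset.sum_congr rfl fun ε' _ => ?_
    have htail : (fun i : Fin (N + 1) => colStep c
        ((Fin.snocEquiv fun _ : Fin (N + 2) => Bool) (true, ε')) i.castSucc) =
          colStep (fun i => c i.castSucc) ε' := by
      funext i
      simp [colStep, Fin.snocEquiv]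
    have hz : colStep c ((Fin.snocEquiv fun _ : Fin (N + 2) => Bool) (true, ε'))
        (Fin.last N).succ = c (Fin.last N).succ + 1 := by
      simp [colStep, sgn, Fin.snocEquiv]
    set c' := colStep c ((Fin.snocEquiv fun _ : Fin (N + 2) => Bool) (true, ε')) with hc'
    have hs : ∀ i : Fin (N + 1), c' i.castSucc = c i.castSucc + sgn (ε' i) :=
      fun i => congrFun htail i
    rw [← htail]
    cases hε : ε' (Fin.last N)
    · have e1 : c' (Fin.last N).castSucc = c (Fin.last N).castSucc - 1 := by rw [hs, hε]; rfl
      rw [latOp_delta_eq_zero P v _ r _ (Fin.last N).castSucc,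
        latOp_delta_eq_zero P _ _ _ _ (Fin.last N)]
      · ring
      · right
        rw [e1, h1]; push_cast; omega
      · right
        rw [e1, h1]; push_cast; omega
    · have e1 : c' (Fin.last N).castSucc = c (Fin.last N).castSucc + 1 := by rw [hs, hε]; rfl
      have ih' := ih (fun j => μ j.succ) c' (by rw [hz, h0]; push_cast; ring)
        (by rw [e1, h1]; push_cast; ring)
      have hw : colWeight P v (μ 0) c c' =
          colWeight P (fun i => v i.castSucc) (μ 0) (fun i => c i.castSucc)
            (fun i => c' i.castSucc) * theta P.p (v (Fin.last N) - μ 0 + P.γ) := by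
        unfold colWeight
        rw [Fin.prod_univ_castSucc]
        congr 1
        have e2 : c (Fin.last N).succ = c (Fin.last N).castSucc - 1 := by
          rw [h1, hr, h0]; push_cast; ring
        rw [e1, hz, e2]
        generalize c (Fin.last N).castSucc = a
        unfold weight
        rw [if_pos (by omega)]
      rw [hw, ih', Fin.prod_univ_succ]
      ring

end Decoupling

section Lattice

variable {L N M : ℕ}

/-! ### The partition function as a matrix element -/

/-- The heights in the columns of a lattice with leftmost column `c` and prescribed steps. -/
def trail : (M : ℕ) → (Fin (N + 1) → ℤ) → (Fin M → Fin (N + 1) → Bool) →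
    Fin (M + 1) → Fin (N + 1) → ℤ
  | 0, c, _ => fun _ => c
  | M + 1, c, E => Fin.cons c (trail M (colStep c (E 0)) fun j => E j.succ)

theorem trail_zero (c : Fin (N + 1) → ℤ) (E : Fin M → Fin (N + 1) → Bool) :
    trail M c E 0 = c := by
  cases M <;> rfl

theorem trail_succ (c : Fin (N + 1) → ℤ) (E : Fin M → Fin (N + 1) → Bool) (j : Fin M) :
    trail M c E j.succ = colStep (trail M c E j.castSucc) (E j) := by
  induction M generalizing c with
  | zero => exact j.elim0
  | succ M ih =>
    rw [trail, Fin.cons_succ]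
    refine Fin.cases ?_ (fun j => ?_) j
    · rw [trail_zero, Fin.castSucc_zero, Fin.cons_zero]
    · rw [ih, Fin.castSucc_succ, Fin.cons_succ]

theorem latOp_eq_sum_trail (P : Params L) (v : Fin N → ℂ) (μ : Fin M → ℂ)
    (f : (Fin (N + 1) → ℤ) → ℂ) (c : Fin (N + 1) → ℤ) :
    latOp P v M μ f c = ∑ E : Fin M → Fin (N + 1) → Bool,
      (∏ j : Fin M, colWeight P v (μ j) (trail M c E j.castSucc) (trail M c E j.succ)) *
        f (trail M c E (Fin.last M)) := by
  induction M generalizing c with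
  | zero => simp [latOp, trail]
  | succ M ih =>
    rw [latOp, colOp, ← Equiv.sum_comp (Fin.consEquiv fun _ : Fin (M + 1) => Fin (N + 1) → Bool),
      Fintype.sum_prod_type]
    refine Finset.sum_congr rfl fun ε _ => ?_
    rw [ih, Finset.mul_sum]
    refine Finset.sum_congr rfl fun E _ => ?_
    have h : trail (M + 1) c ((Fin.consEquiv fun _ : Fin (M + 1) => Fin (N + 1) → Bool) (ε, E)) =
        Fin.cons c (trail M (colStep c ε) E) := rfl
    rw [h, Fin.prod_univ_succ, Fin.castSucc_zero, Fin.cons_zero, ← mul_assoc]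
    simp only [Fin.castSucc_succ, Fin.cons_succ, ← Fin.succ_last, trail_zero]

/-- The column of heights `b + N, …, b`, from bottom to top. -/
def downCol (b : ℤ) (N : ℕ) : Fin (N + 1) → ℤ := fun i => b + N - (i : ℕ)

/-- The column of heights `b, …, b + N`, from bottom to top. -/
def upCol (b : ℤ) (N : ℕ) : Fin (N + 1) → ℤ := fun i => b + (i : ℕ)

theorem mem_heightConfigs {n : Fin (L + 1) → Fin (L + 1) → ℤ} :
    n ∈ heightConfigs L ↔ IsHeightConfig L n := by
  simp [heightConfigs]

/-- A walk with steps `± 1` between heights at maximal distance is monotonous. -/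
theorem forced_descent (a : Fin (M + 1) → ℤ)
    (h : ∀ j : Fin M, a j.succ = a j.castSucc + 1 ∨ a j.succ = a j.castSucc - 1)
    (hM : a (Fin.last M) = a 0 - M) (j : Fin (M + 1)) : a j = a 0 - (j : ℕ) := by
  have h1 : ∀ j : Fin (M + 1), a 0 - (j : ℕ) ≤ a j := by
    intro j
    induction j using Fin.induction with
    | zero => simp
    | succ j ih =>
      have := h j
      rw [Fin.val_castSucc] at ih
      rw [Fin.val_succ]
      push_cast
      omega
  have h2 : ∀ j : Fin (M + 1), a j ≤ a (Fin.last M) + (M - (j : ℕ)) := by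
    intro j
    induction j using Fin.reverseInduction with
    | last => simp
    | cast j ih =>
      have := h j
      rw [Fin.val_succ] at ih
      rw [Fin.val_castSucc]
      push_cast at ih
      omega
  have := h1 j
  have := h2 j
  omega

theorem forced_ascent (a : Fin (M + 1) → ℤ)
    (h : ∀ j : Fin M, a j.succ = a j.castSucc + 1 ∨ a j.succ = a j.castSucc - 1)
    (hM : a (Fin.last M) = a 0 + M) (j : Fin (M + 1)) : a j = a 0 + (j : ℕ) := by
  have := forced_descent (fun j => -a j) (fun j => by have := h j; omega) (by omega) j
  omega

theorem abs_sub_eq_one_iff (a b : ℤ) : |a - b| = 1 ↔ a = b + 1 ∨ a = b - 1 := by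
  rw [abs_eq zero_le_one]
  omega

/-- The operator product prescribes only the left and right columns. The bottom and top rows are
forced, since their end heights have maximal distance, and vertical neighbours that do not differ by
one have weight zero. -/
theorem Z_eq_latOp (P : Params L) (y : Fin L → ℂ) :
    Z P y = latOp P y L P.μ (delta (upCol 1 L)) (downCol 1 L) := by
  rw [latOp_eq_sum_trail, Z]
  have hstep : ∀ (n : Fin (L + 1) → Fin (L + 1) → ℤ), IsHeightConfig L n →
      trail L (downCol 1 L) (fun j i => decide (n i j.succ = n i j.castSucc + 1)) =
        fun j i => n i j := by
    intro n hn
    funext j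
    induction j using Fin.induction with
    | zero =>
      rw [trail_zero]
      funext i
      rw [(hn.1 i).2.1, downCol]
      ring
    | succ j ih =>
      rw [trail_succ, ih]
      funext i
      have := (abs_sub_eq_one_iff _ _).mp (hn.2.1 i j)
      simp only [colStep, sgn]
      rcases this with h | h
      · simp [h]
      · rw [h]
        simp [sub_eq_add_neg]
  -- A configuration is encoded by its horizontal steps; step patterns that come from no admissible
  -- configuration must be shown to contribute zero.
  refine Finset.sum_of_injOn
    (fun n j i => decide (n i j.succ = n i j.castSucc + 1)) ?_
    (fun _ _ => Finset.mem_coe.mpr (Finset.mem_univ _)) ?_ ?_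
  · intro n hn n' hn' h
    have e1 := hstep n (mem_heightConfigs.mp hn)
    have e2 := hstep n' (mem_heightConfigs.mp hn')
    simp only at h
    rw [h, e2] at e1
    funext i j
    exact (congrFun (congrFun e1 j) i).symm
  · intro E _ hE
    by_contra hne
    apply hE
    have hlast : trail L (downCol 1 L) E (Fin.last L) = upCol 1 L := by
      by_contra h
      exact hne (by rw [delta, if_neg h, mul_zero])
    have hw : ∀ j i : Fin L, weight P (y i - P.μ j)
        (trail L (downCol 1 L) E j.castSucc i.succ) (trail L (downCol 1 L) E j.succ i.succ)
        (trail L (downCol 1 L) E j.castSucc i.castSucc)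
        (trail L (downCol 1 L) E j.succ i.castSucc) ≠ 0 := by
      intro j i
      have h1 := left_ne_zero_of_mul hne
      have h2 := Finset.prod_ne_zero_iff.mp h1 j (Finset.mem_univ j)
      exact Finset.prod_ne_zero_iff.mp h2 i (Finset.mem_univ i)
    have hhor : ∀ (i : Fin (L + 1)) (j : Fin L),
        trail L (downCol 1 L) E j.succ i = trail L (downCol 1 L) E j.castSucc i + 1 ∨
        trail L (downCol 1 L) E j.succ i = trail L (downCol 1 L) E j.castSucc i - 1 := by
      intro i j
      rw [trail_succ]
      have := sgn_cases (E j i)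
      simp only [colStep]
      omega
    have hver : ∀ (i : Fin L) (j : Fin (L + 1)),
        trail L (downCol 1 L) E j i.succ = trail L (downCol 1 L) E j i.castSucc + 1 ∨
        trail L (downCol 1 L) E j i.succ = trail L (downCol 1 L) E j i.castSucc - 1 := by
      intro i j
      refine Fin.lastCases ?_ (fun j => ?_) j
      · rw [hlast]
        left
        simp [upCol]
        ring
      · by_contra h
        exact hw j i (weight_eq_zero_of_left P _ (by omega))
    have hb := forced_descent (fun j => trail L (downCol 1 L) E j 0) (fun j => hhor 0 j)
      (by rw [hlast, trail_zero]; simp [upCol, downCol])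
    have ht := forced_ascent (fun j => trail L (downCol 1 L) E j (Fin.last L))
      (fun j => hhor (Fin.last L) j) (by rw [hlast, trail_zero]; simp [upCol, downCol])
    refine ⟨fun i j => trail L (downCol 1 L) E j i, ?_, ?_⟩
    · rw [Finset.mem_coe, mem_heightConfigs]
      refine ⟨fun j => ⟨?_, ?_, ?_, ?_⟩, fun i j => ?_, fun i j => ?_⟩
      · have := hb j
        simp only [trail_zero] at this ⊢
        rw [this, downCol]
        simp
        ring
      · simp only [trail_zero, downCol]; ring
      · have := ht j
        simp only [trail_zero] at this ⊢
        rw [this, downCol]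
        simp
        ring
      · simp only [hlast, upCol]; ring
      · exact (abs_sub_eq_one_iff _ _).mpr (hhor i j)
      · exact (abs_sub_eq_one_iff _ _).mpr (hver i j)
    · funext j i
      simp only [trail_succ, colStep, sgn]
      cases E j i <;> simp
  · intro n hn
    have hn' := mem_heightConfigs.mp hn
    rw [hstep n hn', delta, if_pos, mul_one, Finset.prod_comm]
    · rfl
    · funext i
      simp only [(hn'.1 i).2.2.2, upCol]
      ring

end Lattice

section Exchange

variable {L N M : ℕ}

/-! ### Exchange relations -/

theorem weight_flat (P : Params L) (u : ℂ) {a b c d : ℤ} (hb : b = c)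
    (h : (a = b + 1 ∧ d = b - 1) ∨ (a = b - 1 ∧ d = b + 1)) :
    weight P u a b c d = theta P.p (u + P.γ) := by
  unfold weight
  rw [if_pos ⟨hb, h⟩]

theorem weight_up (P : Params L) (u : ℂ) (a : ℤ) :
    weight P u a (a + 1) (a - 1) a = theta P.p (P.τ + a * P.γ + P.γ) * theta P.p u /
      theta P.p (P.τ + a * P.γ) := by
  unfold weight
  rw [if_neg (by omega), if_pos (by omega)]

theorem weight_down (P : Params L) (u : ℂ) (a : ℤ) :
    weight P u a (a - 1) (a + 1) a = theta P.p (P.τ + a * P.γ - P.γ) * theta P.p u /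
      theta P.p (P.τ + a * P.γ) := by
  unfold weight
  rw [if_neg (by omega), if_neg (by omega), if_pos (by omega)]

theorem weight_low (P : Params L) (u : ℂ) (a : ℤ) :
    weight P u a (a - 1) (a - 1) a = theta P.p (P.τ + a * P.γ + u) * theta P.p P.γ /
      theta P.p (P.τ + a * P.γ) := by
  unfold weight
  rw [if_neg (by omega), if_neg (by omega), if_neg (by omega), if_pos (by omega)]

theorem weight_high (P : Params L) (u : ℂ) (a : ℤ) :
    weight P u a (a + 1) (a + 1) a = theta P.p (P.τ + a * P.γ - u) * theta P.p P.γ /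
      theta P.p (P.τ + a * P.γ) := by
  unfold weight
  rw [if_neg (by omega), if_neg (by omega), if_neg (by omega), if_neg (by omega),
    if_pos (by omega)]

/-- A plaquette is forbidden when its central heights differ but the outer ones do too. -/
theorem weight_eq_zero_of_ne (P : Params L) (u : ℂ) {a b c d : ℤ} (h1 : a ≠ d) (h2 : b ≠ c) :
    weight P u a b c d = 0 := by
  unfold weight
  rw [if_neg (by omega), if_neg (by omega), if_neg (by omega), if_neg (by omega),
    if_neg (by omega)]

/-- If the heights are monotone through the three sites, the outer ones differ by two and the middle
one is determined, so the plaquette changes nothing. -/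
theorem swapOp_of_straight (P : Params L) (k : Fin N) (u : ℂ) (f : (Fin (N + 2) → ℤ) → ℂ)
    (c : Fin (N + 2) → ℤ)
    (h : (c k.succ.succ = c k.succ.castSucc + 1 ∧
        c k.castSucc.castSucc = c k.succ.castSucc - 1) ∨
      (c k.succ.succ = c k.succ.castSucc - 1 ∧
        c k.castSucc.castSucc = c k.succ.castSucc + 1)) :
    swapOp P k u f c = theta P.p (u + P.γ) * f c := by
  have hu := Function.update_eq_self k.succ.castSucc c
  unfold swapOp
  rw [Fintype.sum_bool]
  rcases h with h | h
  · rw [weight_eq_zero_of_ne P u (b := c k.castSucc.castSucc + sgn false) (by omega)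
      (by simp only [sgn, cond_false]; omega), zero_mul, add_zero,
      show c k.castSucc.castSucc + sgn true = c k.succ.castSucc by simp only [sgn, cond_true]; omega,
      hu, weight_flat P u rfl (by omega)]
  · rw [weight_eq_zero_of_ne P u (b := c k.castSucc.castSucc + sgn true) (by omega)
      (by simp only [sgn, cond_true]; omega), zero_mul, zero_add,
      show c k.castSucc.castSucc + sgn false = c k.succ.castSucc by
        simp only [sgn, cond_false]; omega,
      hu, weight_flat P u rfl (by omega)]

theorem delta_update (r c : Fin (N + 2) → ℤ) (m : Fin (N + 2)) (h : ℤ) :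
    delta r (Function.update c m h) =
      if h = r m ∧ ∀ i, i ≠ m → c i = r i then 1 else 0 := by
  unfold delta
  congr 1
  rw [eq_iff_iff, Function.update_eq_iff]

/-- The dual of `swapOp_of_straight`, for the right end of the lattice. The void second summand
gives the shape that `latOp_linear` expects. -/
theorem swapOp_delta_straight (P : Params L) (k : Fin N) (u : ℂ) (r : Fin (N + 2) → ℤ)
    (h1 : r k.succ.succ = r k.succ.castSucc + 1)
    (h2 : r k.castSucc.castSucc = r k.succ.castSucc - 1) :
    swapOp P k u (delta r) = fun c => theta P.p (u + P.γ) * delta r c + 0 * delta r c := by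
  have hm : k.castSucc.succ = k.succ.castSucc := Fin.succ_castSucc k
  have hne1 : k.succ.succ ≠ k.succ.castSucc := (Fin.castSucc_lt_succ).ne'
  have hne2 : k.castSucc.castSucc ≠ k.succ.castSucc := by
    rw [← hm]; exact (Fin.castSucc_lt_succ).ne
  funext c
  by_cases hc : ∀ i, i ≠ k.succ.castSucc → c i = r i
  · have hlo := hc _ hne2
    have hhi := hc _ hne1
    by_cases hmid : c k.succ.castSucc = r k.succ.castSucc
    · rw [swapOp_of_straight P k u _ c (by omega)]
      ring
    · have hd : delta r c = 0 := if_neg fun h => hmid (congrFun h _)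
      rw [hd, swapOp]
      rw [Finset.sum_eq_zero]
      · ring
      intro b _
      rw [delta_update]
      split_ifs with h
      · rw [weight_eq_zero_of_ne P u (by omega) (by omega), zero_mul]
      · rw [mul_zero]
  · have hd : delta r c = 0 := if_neg fun h => hc fun i _ => congrFun h i
    rw [hd, swapOp, Finset.sum_eq_zero]
    · ring
    intro b _
    rw [delta_update, if_neg (fun h => hc h.2), mul_zero]

/-- At a local extremum the outer heights agree and the middle height may flip to the other side,
which produces two columns. -/
theorem swapOp_delta_peak (P : Params L) (k : Fin N) (u : ℂ) (r : Fin (N + 2) → ℤ) (x : ℤ)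
    (h1 : r k.succ.succ = x) (h2 : r k.castSucc.castSucc = x)
    (h3 : r k.succ.castSucc = x + 1 ∨ r k.succ.castSucc = x - 1) :
    swapOp P k u (delta r) = fun c =>
      weight P u x (r k.succ.castSucc) (x + 1) x *
        delta (Function.update r k.succ.castSucc (x + 1)) c +
      weight P u x (r k.succ.castSucc) (x - 1) x *
        delta (Function.update r k.succ.castSucc (x - 1)) c := by
  have hm : k.castSucc.succ = k.succ.castSucc := Fin.succ_castSucc k
  have hne1 : k.succ.succ ≠ k.succ.castSucc := (Fin.castSucc_lt_succ).ne'
  have hne2 : k.castSucc.castSucc ≠ k.succ.castSucc := by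
    rw [← hm]; exact (Fin.castSucc_lt_succ).ne
  funext c
  have hd : ∀ h : ℤ, delta (Function.update r k.succ.castSucc h) c =
      if c k.succ.castSucc = h ∧ ∀ i, i ≠ k.succ.castSucc → c i = r i then 1 else 0 := by
    intro h
    unfold delta
    congr 1
    rw [eq_iff_iff, Function.eq_update_iff]
  by_cases hc : ∀ i, i ≠ k.succ.castSucc → c i = r i
  · have hlo := (hc _ hne2).trans h2
    have hhi := (hc _ hne1).trans h1
    have hL : swapOp P k u (delta r) c =
        weight P u x (r k.succ.castSucc) (c k.succ.castSucc) x := by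
      unfold swapOp
      rw [Fintype.sum_bool, hlo, hhi, show sgn true = 1 from rfl, show sgn false = -1 from rfl,
        delta_update, delta_update]
      rcases h3 with h3 | h3
      · rw [if_pos ⟨h3.symm, hc⟩, if_neg (by omega), h3]
        ring
      · rw [if_neg (by omega), if_pos ⟨by omega, hc⟩, h3]
        ring_nf
    rw [hL, hd, hd]
    by_cases e1 : c k.succ.castSucc = x + 1
    · rw [if_pos ⟨e1, hc⟩, if_neg (by omega), e1]
      ring
    · by_cases e2 : c k.succ.castSucc = x - 1
      · rw [if_neg (by omega), if_pos ⟨e2, hc⟩, e2]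
        ring
      · rw [if_neg (by omega), if_neg (by omega), weight_eq_zero_of_bottom P u (by omega)]
        ring
  · rw [hd, hd, if_neg (fun h => hc h.2), if_neg (fun h => hc h.2), swapOp, Finset.sum_eq_zero]
    · ring
    intro b _
    rw [delta_update, if_neg (fun h => hc h.2), mul_zero]

/-- The matrix element of the lattice between the descending column and a given right column. -/
noncomputable def amp (P : Params L) (b : ℤ) (v : Fin N → ℂ) (r : Fin (N + 1) → ℤ) : ℂ :=
  latOp P v L P.μ (delta r) (downCol b N)

/-- Attached to the descending left column the plaquette is the scalar [u+γ]; pulled to the right,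
it acts on the right column. -/
theorem theta_mul_amp (P : Params L) (hp0 : 0 < P.p) (hp1 : P.p < 1)
    (hg : ∀ n : ℤ, theta P.p (P.τ + n * P.γ) ≠ 0) (b : ℤ) (k : Fin N) (v : Fin (N + 1) → ℂ)
    (r : Fin (N + 2) → ℤ) :
    theta P.p (v k.castSucc - v k.succ + P.γ) * amp P b v r =
      latOp P (v ∘ Equiv.swap k.castSucc k.succ) L P.μ
        (swapOp P k (v k.castSucc - v k.succ) (delta r)) (downCol b (N + 1)) := by
  rw [amp, ← swapOp_latOp P hp0 hp1 hg, swapOp_of_straight]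
  right
  simp only [downCol, Fin.val_succ, Fin.val_castSucc]
  push_cast
  omega

theorem amp_swap_straight (P : Params L) (hp0 : 0 < P.p) (hp1 : P.p < 1)
    (hg : ∀ n : ℤ, theta P.p (P.τ + n * P.γ) ≠ 0) (b : ℤ) (k : Fin N) (v : Fin (N + 1) → ℂ)
    (r : Fin (N + 2) → ℤ)
    (h1 : r k.succ.succ = r k.succ.castSucc + 1)
    (h2 : r k.castSucc.castSucc = r k.succ.castSucc - 1) :
    theta P.p (v k.castSucc - v k.succ + P.γ) * amp P b v r =
      theta P.p (v k.castSucc - v k.succ + P.γ) *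
        amp P b (v ∘ Equiv.swap k.castSucc k.succ) r := by
  rw [theta_mul_amp P hp0 hp1 hg, swapOp_delta_straight P k _ r h1 h2, latOp_linear, zero_mul,
    add_zero, amp]

/-! ### Right columns with one descent, and their exchange relations. -/

/-- The column that ascends from `b + 1` in all rows except for row `k`. -/
def kinkCol (b : ℤ) (k : Fin (N + 1)) : Fin (N + 2) → ℤ :=
  fun i => b + 1 + (i : ℕ) - if (i : ℕ) ≤ k then 0 else 2

/-- Flipping the height between rows `k` and `k + 1` moves the descent by one row, so a plaquette at
a kink mixes exactly two neighbouring kink columns. -/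
theorem kinkCol_update_up (b : ℤ) (k : Fin N) :
    Function.update (kinkCol b k.castSucc) k.succ.castSucc (b + 1 + (k : ℕ) + 1) =
      kinkCol b k.succ := by
  rw [Function.update_eq_iff]
  simp only [kinkCol, Fin.val_castSucc, Fin.val_succ]
  refine ⟨by rw [if_pos le_rfl]; push_cast; ring, fun i hi => ?_⟩
  have : (i : ℕ) ≠ k + 1 := fun h => hi (Fin.ext h)
  by_cases h : (i : ℕ) ≤ k
  · rw [if_pos h, if_pos (by omega)]
  · rw [if_neg h, if_neg (by omega)]

theorem kinkCol_update_down (b : ℤ) (k : Fin N) :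
    Function.update (kinkCol b k.succ) k.succ.castSucc (b + 1 + (k : ℕ) - 1) =
      kinkCol b k.castSucc := by
  rw [← kinkCol_update_up, Function.update_idem, Function.update_eq_self_iff]
  simp only [kinkCol, Fin.val_castSucc, Fin.val_succ]
  rw [if_neg (by omega)]
  push_cast
  ring

theorem kinkCol_lo (b : ℤ) (k : Fin N) (k' : Fin (N + 1))
    (h : k' = k.castSucc ∨ k' = k.succ) :
    kinkCol b k' k.castSucc.castSucc = b + 1 + (k : ℕ) := by
  rcases h with rfl | rfl <;> simp [kinkCol]

theorem kinkCol_hi (b : ℤ) (k : Fin N) (k' : Fin (N + 1))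
    (h : k' = k.castSucc ∨ k' = k.succ) :
    kinkCol b k' k.succ.succ = b + 1 + (k : ℕ) := by
  rcases h with rfl | rfl
  · simp only [kinkCol, Fin.val_castSucc, Fin.val_succ]
    rw [if_neg (by omega)]
    push_cast; ring
  · simp only [kinkCol, Fin.val_succ]
    rw [if_neg (by omega)]
    push_cast; ring

theorem kinkCol_mid_castSucc (b : ℤ) (k : Fin N) :
    kinkCol b k.castSucc k.succ.castSucc = b + 1 + (k : ℕ) - 1 := by
  simp only [kinkCol, Fin.val_castSucc, Fin.val_succ]
  rw [if_neg (by omega)]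
  push_cast; ring

theorem kinkCol_mid_succ (b : ℤ) (k : Fin N) :
    kinkCol b k.succ k.succ.castSucc = b + 1 + (k : ℕ) + 1 := by
  simp only [kinkCol, Fin.val_castSucc, Fin.val_succ]
  rw [if_pos le_rfl]
  push_cast; ring

/-- The height between the two rows is a local maximum here; t is the common height of its two
neighbours. -/
theorem amp_exchange_succ (P : Params L) (hp0 : 0 < P.p) (hp1 : P.p < 1)
    (hg : ∀ n : ℤ, theta P.p (P.τ + n * P.γ) ≠ 0) (b : ℤ) (k : Fin N) (v : Fin (N + 1) → ℂ)
    (t u : ℂ) (ht : t = P.τ + ((b + 1 + (k : ℕ) : ℤ) : ℂ) * P.γ)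
    (hu : u = v k.castSucc - v k.succ) :
    theta P.p (u + P.γ) * amp P b v (kinkCol b k.succ) =
      theta P.p (t - u) * theta P.p P.γ / theta P.p t *
        amp P b (v ∘ Equiv.swap k.castSucc k.succ) (kinkCol b k.succ) +
      theta P.p (t + P.γ) * theta P.p u / theta P.p t *
        amp P b (v ∘ Equiv.swap k.castSucc k.succ) (kinkCol b k.castSucc) := by
  subst ht hu
  rw [theta_mul_amp P hp0 hp1 hg, swapOp_delta_peak P k _ _ (b + 1 + (k : ℕ))
    (kinkCol_hi b k _ (.inr rfl)) (kinkCol_lo b k _ (.inr rfl)) (.inl (kinkCol_mid_succ b k)),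
    latOp_linear, kinkCol_update_down, kinkCol_mid_succ, weight_high, weight_up,
    ← kinkCol_mid_succ, Function.update_eq_self, amp, amp]

/-- The companion relation at a local minimum, used when the descent is transported in the opposite
direction. -/
theorem amp_exchange_castSucc (P : Params L) (hp0 : 0 < P.p) (hp1 : P.p < 1)
    (hg : ∀ n : ℤ, theta P.p (P.τ + n * P.γ) ≠ 0) (b : ℤ) (k : Fin N) (v : Fin (N + 1) → ℂ)
    (t u : ℂ) (ht : t = P.τ + ((b + 1 + (k : ℕ) : ℤ) : ℂ) * P.γ)
    (hu : u = v k.castSucc - v k.succ) :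
    theta P.p (u + P.γ) * amp P b v (kinkCol b k.castSucc) =
      theta P.p (t - P.γ) * theta P.p u / theta P.p t *
        amp P b (v ∘ Equiv.swap k.castSucc k.succ) (kinkCol b k.succ) +
      theta P.p (t + u) * theta P.p P.γ / theta P.p t *
        amp P b (v ∘ Equiv.swap k.castSucc k.succ) (kinkCol b k.castSucc) := by
  subst ht hu
  rw [theta_mul_amp P hp0 hp1 hg, swapOp_delta_peak P k _ _ (b + 1 + (k : ℕ))
    (kinkCol_hi b k _ (.inl rfl)) (kinkCol_lo b k _ (.inl rfl))
    (.inr (kinkCol_mid_castSucc b k)),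
    latOp_linear, kinkCol_update_up, kinkCol_mid_castSucc, weight_low, weight_down,
    ← kinkCol_mid_castSucc, Function.update_eq_self, amp, amp]

end Exchange

section Symmetry

variable {L : ℕ}

/-! ### Continuity and genericity -/

theorem continuous_weight (P : Params L) (hp0 : 0 < P.p) (hp1 : P.p < 1) (a b c d : ℤ) :
    Continuous fun u => weight P u a b c d := by
  have h := continuous_theta hp0 hp1
  unfold weight
  split_ifs <;> fun_prop

theorem continuous_Z (P : Params L) (hp0 : 0 < P.p) (hp1 : P.p < 1) : Continuous (Z P) := by
  unfold Z
  refine continuous_finsetSum _ fun n _ => continuous_finsetProd _ fun i _ =>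
    continuous_finsetProd _ fun j _ => ?_
  exact (continuous_weight P hp0 hp1 _ _ _ _).comp (by fun_prop)

theorem continuousAt_weight_τ (P : Params L) (hp0 : 0 < P.p) (hp1 : P.p < 1) (u : ℂ)
    (a b c d : ℤ) (ha : theta P.p (P.τ + a * P.γ) ≠ 0) :
    ContinuousAt (fun z : ℂ => weight { P with τ := z } u a b c d) P.τ := by
  have h := continuous_theta hp0 hp1
  unfold weight
  dsimp only
  split_ifs
  · exact continuousAt_const
  · exact ContinuousAt.div (by fun_prop) (by fun_prop) ha
  · exact ContinuousAt.div (by fun_prop) (by fun_prop) ha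
  · exact ContinuousAt.div (by fun_prop) (by fun_prop) ha
  · exact ContinuousAt.div (by fun_prop) (by fun_prop) ha
  · exact continuousAt_const

/-- The heights of the model lie between `1` and `L + 1`. -/
theorem heightConfig_bounds {n : Fin (L + 1) → Fin (L + 1) → ℤ} (hn : IsHeightConfig L n)
    (i j : Fin (L + 1)) : 1 ≤ n i j ∧ n i j ≤ L + 1 := by
  have hstep : ∀ (i : Fin (L + 1)) (j : Fin L),
      n i j.succ = n i j.castSucc + 1 ∨ n i j.succ = n i j.castSucc - 1 :=
    fun i j => (abs_sub_eq_one_iff _ _).mp (hn.2.1 i j)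
  have h1 : ∀ j : Fin (L + 1), n i 0 - (j : ℕ) ≤ n i j ∧ n i j ≤ n i 0 + (j : ℕ) := by
    intro j
    induction j using Fin.induction with
    | zero => simp
    | succ j ih =>
      have := hstep i j
      rw [Fin.val_castSucc] at ih
      rw [Fin.val_succ]
      push_cast
      omega
  have h2 : ∀ j : Fin (L + 1), n i (Fin.last L) - (L - (j : ℕ)) ≤ n i j ∧
      n i j ≤ n i (Fin.last L) + (L - (j : ℕ)) := by
    intro j
    induction j using Fin.reverseInduction with
    | last => simp
    | cast j ih =>
      have := hstep i j
      rw [Fin.val_succ] at ih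
      rw [Fin.val_castSucc]
      push_cast at ih
      omega
  have h3 := h1 j
  have h4 := h2 j
  have h5 := (hn.1 i).2.1
  have h6 := (hn.1 i).2.2.2
  have := i.is_lt
  have := j.is_lt
  omega

/-- Only the denominators [τ+nγ] with 1 ≤ n ≤ L+1 occur, by `heightConfig_bounds`. -/
theorem continuousAt_Z_τ (P : Params L) (hp0 : 0 < P.p) (hp1 : P.p < 1)
    (hτ : ∀ n : ℕ, 1 ≤ n → n ≤ L + 1 → theta P.p (P.τ + n * P.γ) ≠ 0) (y : Fin L → ℂ) :
    ContinuousAt (fun z : ℂ => Z { P with τ := z } y) P.τ := by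
  have key : ∀ n ∈ heightConfigs L, ∀ i j : Fin L, ContinuousAt (fun z : ℂ =>
      weight { P with τ := z } (y i - P.μ j) (n i.succ j.castSucc) (n i.succ j.succ)
        (n i.castSucc j.castSucc) (n i.castSucc j.succ)) P.τ := fun n hn i j => by
    refine continuousAt_weight_τ P hp0 hp1 _ _ _ _ _ ?_
    have hb := heightConfig_bounds (mem_heightConfigs.mp hn) i.succ j.castSucc
    obtain ⟨m, hm⟩ := Int.eq_ofNat_of_zero_le (by omega : 0 ≤ n i.succ j.castSucc)
    rw [hm] at hb ⊢
    exact_mod_cast hτ m (by omega) (by omega)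
  exact tendsto_finsetSum _ fun n hn => tendsto_finsetProd _ fun i _ =>
    tendsto_finsetProd _ fun j _ => key n hn i j

/-- An identity that holds for generic `τ` holds wherever both sides are continuous. -/
theorem eq_of_generic {p : ℝ} (hp0 : 0 < p) (hp1 : p < 1) {w : ℂ} (hw : theta p w ≠ 0) (γ τ : ℂ)
    {F G : ℂ → ℂ} (hF : ContinuousAt F τ) (hG : ContinuousAt G τ)
    (h : ∀ z : ℂ, (∀ n : ℤ, theta p (z + n * γ) ≠ 0) → F z = G z) : F τ = G τ := by
  have hD := dense_generic hp0 hp1 hw γ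
  have hne : (nhdsWithin τ {z : ℂ | ∀ n : ℤ, theta p (z + n * γ) ≠ 0}).NeBot :=
    mem_closure_iff_nhdsWithin_neBot.mp (hD τ)
  have hF' : Filter.Tendsto F (nhdsWithin τ {z : ℂ | ∀ n : ℤ, theta p (z + n * γ) ≠ 0})
    (nhds (F τ)) := hF.mono_left nhdsWithin_le_nhds
  exact tendsto_nhds_unique_of_eventuallyEq hF' (hG.mono_left nhdsWithin_le_nhds)
    (Filter.eventually_of_mem self_mem_nhdsWithin fun z hz => h z hz)

/-! ### Symmetry of the partition function -/

/-- The right column of Z is monotone, so the plaquette is the same scalar [u+γ] on both ends. This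
scalar may vanish; one variable is translated by z, the scalar is cancelled for a dense set of z,
and z = 0 follows by continuity. -/
theorem Z_swap_of_generic {N : ℕ} (P : Params (N + 1)) (hp0 : 0 < P.p) (hp1 : P.p < 1)
    (hg : ∀ n : ℤ, theta P.p (P.τ + n * P.γ) ≠ 0) (k : Fin N) (y : Fin (N + 1) → ℂ) :
    Z P (y ∘ Equiv.swap k.castSucc k.succ) = Z P y := by
  have hne : k.castSucc ≠ k.succ := (Fin.castSucc_lt_succ).ne
  let Y : ℂ → Fin (N + 1) → ℂ := fun z => Function.update y k.castSucc (z + y k.castSucc)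
  have hY : Continuous Y := by
    refine continuous_pi fun i => ?_
    by_cases hi : i = k.castSucc
    · subst hi
      simp only [Y, Function.update_self]
      fun_prop
    · simp only [Y, Function.update_of_ne hi]
      fun_prop
  have hZ := continuous_Z P hp0 hp1
  have hF : Continuous fun z => Z P (Y z ∘ Equiv.swap k.castSucc k.succ) :=
    hZ.comp (continuous_pi fun i => (continuous_apply _).comp hY)
  have hG : Continuous fun z => Z P (Y z) := hZ.comp hY
  have hD := dense_theta_ne hp0 hp1 (hg 0) (y k.castSucc - y k.succ + P.γ)
  have heq := hF.ext_on hD hG fun z hz => by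
    have h := amp_swap_straight P hp0 hp1 hg 1 k (Y z) (upCol 1 (N + 1))
      (by simp only [upCol, Fin.val_castSucc, Fin.val_succ]; push_cast; ring)
      (by simp only [upCol, Fin.val_castSucc, Fin.val_succ]; push_cast; ring)
    have h0 : theta P.p (Y z k.castSucc - Y z k.succ + P.γ) ≠ 0 := by
      simp only [Y, Function.update_self, Function.update_of_ne hne.symm]
      have hz' : theta P.p (z + (y k.castSucc - y k.succ + P.γ)) ≠ 0 := hz
      rwa [show z + y k.castSucc - y k.succ + P.γ = z + (y k.castSucc - y k.succ + P.γ) by ring]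
    have h1 := mul_left_cancel₀ h0 h
    simp only [amp, ← Z_eq_latOp] at h1
    exact h1.symm
  have h0 : Y 0 = y := by simp [Y]
  have := congrFun heq 0
  simpa only [h0] using this

theorem Z_perm_of_generic (P : Params L) (hp0 : 0 < P.p) (hp1 : P.p < 1)
    (hg : ∀ n : ℤ, theta P.p (P.τ + n * P.γ) ≠ 0) (σ : Equiv.Perm (Fin L)) (y : Fin L → ℂ) :
    Z P (y ∘ σ) = Z P y := by
  cases L with
  | zero => rw [Subsingleton.elim (y ∘ σ) y]
  | succ N =>
    have hmem : σ ∈ Submonoid.closure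
        (Set.range fun i : Fin N => Equiv.swap i.castSucc i.succ) := by
      rw [Equiv.Perm.mclosure_swap_castSucc_succ]
      trivial
    induction hmem using Submonoid.closure_induction generalizing y with
    | mem x hx =>
      obtain ⟨k, rfl⟩ := hx
      exact Z_swap_of_generic P hp0 hp1 hg k y
    | one => rfl
    | mul a b _ _ iha ihb =>
      rw [Equiv.Perm.coe_mul, ← Function.comp_assoc, ihb, iha]

theorem Z_perm (P : Params L) (hp0 : 0 < P.p) (hp1 : P.p < 1)
    (hτ : ∀ n : ℕ, 1 ≤ n → n ≤ L + 1 → theta P.p (P.τ + n * P.γ) ≠ 0)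
    (σ : Equiv.Perm (Fin L)) (y : Fin L → ℂ) : Z P (y ∘ σ) = Z P y :=
  -- The value at τ + γ serves as a witness that theta is not identically zero.
  eq_of_generic hp0 hp1 (hτ 1 le_rfl (by omega)) P.γ P.τ
    (continuousAt_Z_τ P hp0 hp1 hτ _) (continuousAt_Z_τ P hp0 hp1 hτ _)
    fun z hz => Z_perm_of_generic { P with τ := z } hp0 hp1 hz σ y

/-- A symmetric function of a selection of variables depends on the selected set only. -/
theorem symm_comp_eq {ι : Type*} {F : (Fin L → ℂ) → ℂ}
    (hF : ∀ (σ : Equiv.Perm (Fin L)) (y : Fin L → ℂ), F (y ∘ σ) = F y)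
    (x : ι → ℂ) (f g : Fin L → ι) (hf : Function.Injective f) (h : ∀ i, ∃ j, g j = f i) :
    F (x ∘ f) = F (x ∘ g) := by
  choose s hs using h
  have hinj : Function.Injective s := fun a b hab => hf (by rw [← hs, ← hs, hab])
  have hbij := Finite.injective_iff_bijective.mp hinj
  rw [← hF (Equiv.ofBijective s hbij) (x ∘ g)]
  congr 1
  funext i
  simp [hs]

end Symmetry

section Bethe

variable {n : ℕ}

/-! ### Moving a row through the lattice -/

/-- The coefficients that arise when a row is moved through all rows above it. -/
noncomputable def betheCoeff (p : ℝ) (γ : ℂ) (t v : Fin (n + 1) → ℂ) (k i : Fin (n + 1)) : ℂ :=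
  if i < k then 0
  else if i = k then ∏ m ∈ Finset.Ioi k, theta p (v m - v k + γ) / theta p (v m - v k)
  else theta p γ * theta p (t k + v k - v i) / (theta p (t k) * theta p (v k - v i)) *
    ∏ m ∈ (Finset.Ioi k).erase i, theta p (v m - v i + γ) / theta p (v m - v i)

theorem Ioi_castSucc (k : Fin n) :
    Finset.Ioi k.castSucc = insert k.succ (Finset.Ioi k.succ) := by
  ext m
  rw [Finset.mem_insert, Finset.mem_Ioi, Finset.mem_Ioi, Fin.castSucc_lt_iff_succ_le,
    le_iff_eq_or_lt, eq_comm]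

/-- One exchange relation at the level of coefficients. For i up to `k + 1` at most one term on the
right survives; for i above, both contribute and `theta_exchange` merges them into a single product.
-/
theorem betheCoeff_castSucc {p : ℝ} (hp0 : 0 < p) (hp1 : p < 1) (γ : ℂ) (t v : Fin (n + 1) → ℂ)
    (ht : ∀ k, theta p (t k) ≠ 0) (hts : ∀ k : Fin n, t k.succ = t k.castSucc + γ)
    (hv : ∀ a b, a ≠ b → theta p (v a - v b) ≠ 0) (k : Fin n) (i : Fin (n + 1)) :
    betheCoeff p γ t v k.castSucc i =
      theta p (v k.succ - v k.castSucc + γ) / theta p (v k.succ - v k.castSucc) *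
        betheCoeff p γ t (v ∘ Equiv.swap k.castSucc k.succ) k.succ
          (Equiv.swap k.castSucc k.succ i) +
      theta p γ * theta p (t k.castSucc + v k.castSucc - v k.succ) /
          (theta p (t k.castSucc) * theta p (v k.castSucc - v k.succ)) *
        betheCoeff p γ t v k.succ i := by
  have hlt : k.castSucc < k.succ := Fin.castSucc_lt_succ
  have hsw : ∀ m, k.succ < m → Equiv.swap k.castSucc k.succ m = m := fun m hm =>
    Equiv.swap_apply_of_ne_of_ne (hlt.trans hm).ne' hm.ne'
  rcases lt_trichotomy i k.castSucc with h | rfl | h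
  · have h' := h.trans hlt
    rw [Equiv.swap_apply_of_ne_of_ne h.ne h'.ne]
    simp only [betheCoeff, if_pos h, if_pos h']
    ring
  · rw [Equiv.swap_apply_left]
    simp only [betheCoeff, lt_irrefl, if_false, if_true, hlt, Function.comp_apply,
      Equiv.swap_apply_right]
    rw [Ioi_castSucc, Finset.prod_insert (by simp), mul_zero, add_zero]
    congr 1
    refine Finset.prod_congr rfl fun m hm => ?_
    rw [hsw m (Finset.mem_Ioi.mp hm)]
  · rcases eq_or_lt_of_le (Fin.castSucc_lt_iff_succ_le.mp h) with rfl | h'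
    · rw [Equiv.swap_apply_right]
      simp only [betheCoeff, lt_irrefl, if_false, if_true, hlt, hlt.not_gt, hlt.ne']
      rw [Ioi_castSucc, Finset.erase_insert (by simp), mul_zero, zero_add]
    · rw [hsw i h']
      simp only [betheCoeff, h.not_gt, h.ne', h'.not_gt, h'.ne', if_false, Function.comp_apply,
        Equiv.swap_apply_right, hsw i h']
      have hprod : ∏ m ∈ (Finset.Ioi k.succ).erase i,
          theta p (v (Equiv.swap k.castSucc k.succ m) - v i + γ) /
            theta p (v (Equiv.swap k.castSucc k.succ m) - v i) =
          ∏ m ∈ (Finset.Ioi k.succ).erase i, theta p (v m - v i + γ) / theta p (v m - v i) := by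
        refine Finset.prod_congr rfl fun m hm => ?_
        rw [hsw m (Finset.mem_Ioi.mp (Finset.mem_of_mem_erase hm))]
      rw [hprod, Ioi_castSucc, Finset.erase_insert_of_ne h'.ne, Finset.prod_insert (by simp), hts]
      have hE := theta_exchange hp0 hp1 (t k.castSucc) (v k.castSucc) (v k.succ) γ (v i)
      have h1 := ht k.castSucc
      have h2 := ht k.succ
      rw [hts] at h2
      have h3 := hv _ _ h.ne
      have h4 := hv _ _ h'.ne
      have h5 := hv _ _ hlt.ne'
      have h6 : theta p (v k.castSucc - v k.succ) = -theta p (v k.succ - v k.castSucc) := by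
        rw [← theta_neg hp0, neg_sub]
      rw [h6]
      generalize ∏ m ∈ (Finset.Ioi k.succ).erase i,
        theta p (v m - v i + γ) / theta p (v m - v i) = w
      field_simp
      linear_combination theta p γ * w * hE

/-- If a family `g` of functions satisfies the exchange relations and its last member is the last
member of an equivariant family `S`, then every `g k` is a combination of the `S i`. -/
theorem bethe_expansion {p : ℝ} (hp0 : 0 < p) (hp1 : p < 1) (γ : ℂ) (t : Fin (n + 1) → ℂ)
    (ht : ∀ k, theta p (t k) ≠ 0) (hts : ∀ k : Fin n, t k.succ = t k.castSucc + γ)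
    (g S : Fin (n + 1) → (Fin (n + 1) → ℂ) → ℂ)
    (hS : ∀ (k : Fin n) v i,
      S i (v ∘ Equiv.swap k.castSucc k.succ) = S (Equiv.swap k.castSucc k.succ i) v)
    (hlast : ∀ v, g (Fin.last n) v = S (Fin.last n) v)
    (hex : ∀ (k : Fin n) v, (∀ a b, a ≠ b → theta p (v a - v b) ≠ 0) →
      g k.castSucc v =
        theta p (v k.succ - v k.castSucc + γ) / theta p (v k.succ - v k.castSucc) *
          g k.succ (v ∘ Equiv.swap k.castSucc k.succ) +
        theta p γ * theta p (t k.castSucc + v k.castSucc - v k.succ) /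
          (theta p (t k.castSucc) * theta p (v k.castSucc - v k.succ)) * g k.succ v)
    (k : Fin (n + 1)) (v : Fin (n + 1) → ℂ) (hv : ∀ a b, a ≠ b → theta p (v a - v b) ≠ 0) :
    g k v = ∑ i, betheCoeff p γ t v k i * S i v := by
  induction k using Fin.reverseInduction generalizing v with
  | last =>
    rw [hlast, Finset.sum_eq_single (Fin.last n)]
    · have hIoi : Finset.Ioi (Fin.last n) = ∅ :=
        Finset.eq_empty_of_forall_notMem fun m hm =>
          (Fin.le_last m).not_gt (Finset.mem_Ioi.mp hm)
      rw [betheCoeff, if_neg (lt_irrefl _), if_pos rfl, hIoi, Finset.prod_empty, one_mul]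
    · intro i _ hi
      rw [betheCoeff, if_pos (Fin.lt_last_iff_ne_last.mpr hi), zero_mul]
    · simp
  | cast k ih =>
    -- The expansion at the exchanged variables is reindexed by the transposition, so that both
    -- expansions involve the same values `S i v`.
    rw [hex k v hv, ih v hv, ih (v ∘ Equiv.swap k.castSucc k.succ) fun a b hab =>
      hv _ _ fun h => hab (Equiv.injective _ h),
      ← Equiv.sum_comp (Equiv.swap k.castSucc k.succ)]
    simp only [hS, Equiv.swap_apply_self]
    rw [Finset.mul_sum, Finset.mul_sum, ← Finset.sum_add_distrib]
    refine Finset.sum_congr rfl fun i _ => ?_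
    rw [betheCoeff_castSucc hp0 hp1 γ t v ht hts hv k i]
    ring

theorem bethe_expansion_zero {p : ℝ} (hp0 : 0 < p) (hp1 : p < 1) (γ : ℂ) (t : Fin (n + 1) → ℂ)
    (ht : ∀ k, theta p (t k) ≠ 0) (hts : ∀ k : Fin n, t k.succ = t k.castSucc + γ)
    (g S : Fin (n + 1) → (Fin (n + 1) → ℂ) → ℂ)
    (hS : ∀ (k : Fin n) v i,
      S i (v ∘ Equiv.swap k.castSucc k.succ) = S (Equiv.swap k.castSucc k.succ i) v)
    (hlast : ∀ v, g (Fin.last n) v = S (Fin.last n) v)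
    (hex : ∀ (k : Fin n) v, (∀ a b, a ≠ b → theta p (v a - v b) ≠ 0) →
      g k.castSucc v =
        theta p (v k.succ - v k.castSucc + γ) / theta p (v k.succ - v k.castSucc) *
          g k.succ (v ∘ Equiv.swap k.castSucc k.succ) +
        theta p γ * theta p (t k.castSucc + v k.castSucc - v k.succ) /
          (theta p (t k.castSucc) * theta p (v k.castSucc - v k.succ)) * g k.succ v)
    (v : Fin (n + 1) → ℂ) (hv : ∀ a b, a ≠ b → theta p (v a - v b) ≠ 0) :
    g 0 v = (∏ j : Fin n, theta p (v j.succ - v 0 + γ) / theta p (v j.succ - v 0)) * S 0 v +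
      ∑ i : Fin n, theta p γ * theta p (t 0 + v 0 - v i.succ) /
          (theta p (t 0) * theta p (v 0 - v i.succ)) *
        (∏ j ∈ Finset.univ.erase i,
          theta p (v j.succ - v i.succ + γ) / theta p (v j.succ - v i.succ)) * S i.succ v := by
  have hIoi : Finset.Ioi (0 : Fin (n + 1)) =
      Finset.univ.map ⟨Fin.succ, Fin.succ_injective n⟩ := by
    ext m
    simp only [Finset.mem_Ioi, Finset.mem_map, Finset.mem_univ, true_and,
      Function.Embedding.coeFn_mk]
    rw [Fin.pos_iff_ne_zero, ← Fin.exists_succ_eq]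
  have herase : ∀ i : Fin n, (Finset.Ioi (0 : Fin (n + 1))).erase i.succ =
      (Finset.univ.erase i).map ⟨Fin.succ, Fin.succ_injective n⟩ := fun i => by
    rw [hIoi, Finset.map_erase]
    rfl
  rw [bethe_expansion hp0 hp1 γ t ht hts g S hS hlast hex 0 v hv, Fin.sum_univ_succ]
  congr 1
  · rw [betheCoeff, if_neg (lt_irrefl _), if_pos rfl, hIoi, Finset.prod_map]
    rfl
  · refine Finset.sum_congr rfl fun i _ => ?_
    rw [betheCoeff, if_neg (by simp), if_neg (Fin.succ_ne_zero i), herase, Finset.prod_map]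
    rfl

end Bethe

/-! ### The modified equation -/

section MovedRow

variable {L : ℕ}

/-- The expansion for a family of functions whose last member is given by a symmetric function. -/
theorem bethe_expansion_symm {p : ℝ} (hp0 : 0 < p) (hp1 : p < 1) (γ : ℂ) (t : Fin (L + 1) → ℂ)
    (ht : ∀ k, theta p (t k) ≠ 0) (hts : ∀ k : Fin L, t k.succ = t k.castSucc + γ)
    (F : (Fin L → ℂ) → ℂ) (hF : ∀ (σ : Equiv.Perm (Fin L)) (y : Fin L → ℂ), F (y ∘ σ) = F y)
    (φ : ℂ → ℂ) (g : Fin (L + 1) → (Fin (L + 1) → ℂ) → ℂ)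
    (hlast : ∀ v, g (Fin.last L) v = φ (v (Fin.last L)) * F (fun i => v i.castSucc))
    (hex : ∀ (k : Fin L) v, (∀ a b, a ≠ b → theta p (v a - v b) ≠ 0) →
      g k.castSucc v =
        theta p (v k.succ - v k.castSucc + γ) / theta p (v k.succ - v k.castSucc) *
          g k.succ (v ∘ Equiv.swap k.castSucc k.succ) +
        theta p γ * theta p (t k.castSucc + v k.castSucc - v k.succ) /
          (theta p (t k.castSucc) * theta p (v k.castSucc - v k.succ)) * g k.succ v)
    (v : Fin (L + 1) → ℂ) (hv : ∀ a b, a ≠ b → theta p (v a - v b) ≠ 0) :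
    g 0 v = (∏ j : Fin L, theta p (v j.succ - v 0 + γ) / theta p (v j.succ - v 0)) *
        (φ (v 0) * F (Fin.tail v)) +
      ∑ i : Fin L, theta p γ * theta p (t 0 + v 0 - v i.succ) /
          (theta p (t 0) * theta p (v 0 - v i.succ)) *
        (∏ j ∈ Finset.univ.erase i,
          theta p (v j.succ - v i.succ + γ) / theta p (v j.succ - v i.succ)) *
        (φ (v i.succ) * F (Function.update (Fin.tail v) i (v 0))) := by
  have hmem : ∀ (i : Fin (L + 1)) m, m ≠ i → ∃ j, i.succAbove j = m := fun i m hm =>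
    Fin.exists_succAbove_eq hm
  -- The equivariant family omits the variable `v i` from F; exchanging two rows merely permutes the
  -- remaining variables, which F does not see.
  rw [bethe_expansion_zero hp0 hp1 γ t ht hts g (fun i v => φ (v i) * F (v ∘ i.succAbove))
    (fun k v i => ?_) (fun u => ?_) hex v hv]
  · rw [show v ∘ (0 : Fin (L + 1)).succAbove = Fin.tail v by
      funext j; rw [Function.comp_apply, Fin.succAbove_zero]; rfl]
    congr 1
    refine Finset.sum_congr rfl fun i _ => ?_
    congr 2
    -- Omitting `v i.succ` and replacing it by `v 0` in the tail select the same variables in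
    -- different orders.
    have hu : Function.update (Fin.tail v) i (v 0) = v ∘ Function.update Fin.succ i 0 := by
      funext j
      by_cases h : j = i
      · subst h; simp
      · simp [Function.update_of_ne h, Fin.tail]
    rw [hu]
    refine (symm_comp_eq hF v _ _ ?_ fun j => hmem _ _ ?_).symm
    · intro a b hab
      by_cases ha : a = i <;> by_cases hb : b = i
      · rw [ha, hb]
      · subst ha
        rw [Function.update_self, Function.update_of_ne hb] at hab
        exact absurd hab.symm (Fin.succ_ne_zero b)
      · subst hb
        rw [Function.update_self, Function.update_of_ne ha] at hab
        exact absurd hab (Fin.succ_ne_zero a)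
      · rw [Function.update_of_ne ha, Function.update_of_ne hb] at hab
        exact Fin.succ_injective _ hab
    · by_cases h : j = i
      · subst h
        rw [Function.update_self]
        exact (Fin.succ_ne_zero j).symm
      · rw [Function.update_of_ne h]
        exact fun h' => h (Fin.succ_injective _ h')
  · simp only [Function.comp_apply]
    congr 1
    rw [Function.comp_assoc]
    refine symm_comp_eq hF v _ _ ((Equiv.injective _).comp Fin.succAbove_right_injective)
      fun j => hmem _ _ fun h => ?_
    exact Fin.succAbove_ne i j (Equiv.injective _ h)
  · rw [hlast]
    simp only [Fin.succAbove_last]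
    rfl

/-- The first equation for a moved row: removing the row at the bottom and at the top. -/
theorem exists_moved_row_A (P : Params L) (hp0 : 0 < P.p) (hp1 : P.p < 1)
    (hg : ∀ n : ℤ, theta P.p (P.τ + n * P.γ) ≠ 0) :
    ∃ Φ : (Fin L → ℂ) → ℂ, ∀ v : Fin (L + 1) → ℂ,
      (∀ a b, a ≠ b → theta P.p (v a - v b) ≠ 0) →
      (∏ j, theta P.p (v 0 - P.μ j)) * Φ (Fin.tail v) =
        (∏ j : Fin L, theta P.p (v j.succ - v 0 + P.γ) / theta P.p (v j.succ - v 0)) *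
          ((∏ j, theta P.p (v 0 - P.μ j + P.γ)) * Z P (Fin.tail v)) +
        ∑ i : Fin L, theta P.p P.γ * theta P.p (P.τ + P.γ + v 0 - v i.succ) /
            (theta P.p (P.τ + P.γ) * theta P.p (v 0 - v i.succ)) *
          (∏ j ∈ Finset.univ.erase i,
            theta P.p (v j.succ - v i.succ + P.γ) / theta P.p (v j.succ - v i.succ)) *
          ((∏ j, theta P.p (v i.succ - P.μ j + P.γ)) *
            Z P (Function.update (Fin.tail v) i (v 0))) := by
  have ht : ∀ k : ℕ, theta P.p (P.τ + ((k : ℂ) + 1) * P.γ) ≠ 0 := fun k => by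
    have := hg (k + 1)
    push_cast at this
    exact this
  -- The witness is the lattice with L rows left after freezing the bottom row. Its prefactor
  -- collects the telescoped heights from `latOp_bottom` and the normalisation of the family below.
  refine ⟨fun y => theta P.p P.τ / theta P.p (P.τ + L * P.γ) *
    (theta P.p (P.τ + (L + 1) * P.γ) / theta P.p (P.τ + P.γ)) *
    latOp P y L P.μ (delta fun i => kinkCol 0 (0 : Fin (L + 1)) i.succ)
      (fun i => downCol 0 (L + 1) i.succ), fun v hv => ?_⟩
  -- The base height b = 0 makes the lattice below a frozen top row exactly Z. Division by
  -- [τ+(k+1)γ] absorbs the ratio [t+γ]/[t] in the exchange relation, and the constant [τ+(L+1)γ]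
  -- normalises the last member.
  have h := bethe_expansion_symm hp0 hp1 P.γ (fun k => P.τ + (((k : ℕ) : ℂ) + 1) * P.γ)
    (fun k => ht k) (fun k => by simp only [Fin.val_succ, Fin.val_castSucc]; push_cast; ring)
    (Z P) (Z_perm_of_generic P hp0 hp1 hg) (fun z => ∏ j, theta P.p (z - P.μ j + P.γ))
    (fun k v => theta P.p (P.τ + (L + 1) * P.γ) *
      (amp P 0 v (kinkCol 0 k) / theta P.p (P.τ + (((k : ℕ) : ℂ) + 1) * P.γ))) ?_ ?_ v hv
  · simp only [Fin.val_zero, Nat.cast_zero, zero_add, one_mul] at h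
    rw [← h]
    have hb := latOp_bottom P hg v P.μ (kinkCol 0 (0 : Fin (L + 1))) (downCol 0 (L + 1))
      (by simp [kinkCol]) (by simp [kinkCol, downCol]; ring) (by simp [kinkCol, downCol])
    have hr : kinkCol 0 (0 : Fin (L + 1)) (Fin.succ 0) = 0 := by simp [kinkCol]
    rw [hr] at hb
    push_cast at hb
    simp only [zero_add, zero_mul, add_zero] at hb
    have h1 := hg L
    push_cast at h1
    have h2 := ht 0
    simp only [Nat.cast_zero, zero_add, one_mul] at h2
    rw [amp]
    simp only [Fin.tail_def]
    generalize theta P.p (P.τ + (L + 1) * P.γ) = C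
    generalize theta P.p (P.τ + L * P.γ) = D at hb h1 ⊢
    generalize theta P.p (P.τ + P.γ) = E at h2 ⊢
    field_simp
    linear_combination (-C) * hb
  · intro v
    have hb := latOp_top P v P.μ (kinkCol 0 (Fin.last L)) (downCol 0 (L + 1))
      (by simp [kinkCol]; ring) (by simp [kinkCol, downCol]; ring) (by simp [kinkCol, downCol])
    rw [amp, hb, Fin.val_last, Z_eq_latOp]
    have h1 : (fun i : Fin (L + 1) => kinkCol 0 (Fin.last L) i.castSucc) = upCol 1 L := by
      funext i
      have := i.is_lt
      simp only [kinkCol, upCol, Fin.val_castSucc, Fin.val_last]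
      rw [if_pos (by omega)]
      ring
    have h2 : (fun i : Fin (L + 1) => downCol 0 (L + 1) i.castSucc) = downCol 1 L := by
      funext i
      simp only [downCol, Fin.val_castSucc]
      push_cast
      ring
    rw [h1, h2]
    exact mul_div_cancel₀ _ (ht L)
  · intro k v hv
    have hne : k.castSucc ≠ k.succ := (Fin.castSucc_lt_succ).ne
    -- The relation is used at exchanged variables and then solved for the column with the lower
    -- descent.
    have h := amp_exchange_succ P hp0 hp1 hg 0 k (v ∘ Equiv.swap k.castSucc k.succ)
      (P.τ + (((k : ℕ) : ℂ) + 1) * P.γ) (v k.succ - v k.castSucc)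
      (by push_cast; ring) (by simp)
    rw [Function.comp_assoc, show (Equiv.swap k.castSucc k.succ : Fin (L + 1) → Fin (L + 1)) ∘
      Equiv.swap k.castSucc k.succ = id by funext i; simp, Function.comp_id,
      show P.τ + (((k : ℕ) : ℂ) + 1) * P.γ + P.γ =
        P.τ + ((((k : ℕ) : ℂ) + 1) + 1) * P.γ by ring,
      show P.τ + (((k : ℕ) : ℂ) + 1) * P.γ - (v k.succ - v k.castSucc) =
        P.τ + (((k : ℕ) : ℂ) + 1) * P.γ + v k.castSucc - v k.succ by ring] at h
    simp only [Fin.val_castSucc, Fin.val_succ, Nat.cast_add, Nat.cast_one]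
    have h1 := ht k
    have h2 := ht (k + 1)
    push_cast at h2
    have h3 := hv _ _ hne.symm
    rw [show theta P.p (v k.castSucc - v k.succ) = -theta P.p (v k.succ - v k.castSucc) by
      rw [← theta_neg hp0, neg_sub]]
    generalize theta P.p (P.τ + (((k : ℕ) : ℂ) + 1) * P.γ + v k.castSucc - v k.succ) = A at h ⊢
    generalize theta P.p (P.τ + (L + 1) * P.γ) = C
    generalize theta P.p (P.τ + (((k : ℕ) : ℂ) + 1) * P.γ) = D at h h1 ⊢
    generalize theta P.p (P.τ + (((k : ℕ) : ℂ) + 1 + 1) * P.γ) = E at h h2 ⊢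
    field_simp at h ⊢
    linear_combination (-C) * h

/-- The second equation for a moved row: removing the row at the top and at the bottom. -/
theorem exists_moved_row_D (P : Params L) (hp0 : 0 < P.p) (hp1 : P.p < 1)
    (hg : ∀ n : ℤ, theta P.p (P.τ + n * P.γ) ≠ 0) :
    ∃ Φ : (Fin L → ℂ) → ℂ, ∀ v : Fin (L + 1) → ℂ,
      (∀ a b, a ≠ b → theta P.p (v a - v b) ≠ 0) →
      (∏ j, theta P.p (v 0 - P.μ j + P.γ)) * Φ (Fin.tail v) =
        (∏ j : Fin L, theta P.p (v j.succ - v 0 + -P.γ) / theta P.p (v j.succ - v 0)) *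
          ((∏ j, theta P.p (v 0 - P.μ j)) * Z P (Fin.tail v)) +
        ∑ i : Fin L, theta P.p (-P.γ) * theta P.p (P.τ + (L + 1) * P.γ + v 0 - v i.succ) /
            (theta P.p (P.τ + (L + 1) * P.γ) * theta P.p (v 0 - v i.succ)) *
          (∏ j ∈ Finset.univ.erase i,
            theta P.p (v j.succ - v i.succ + -P.γ) / theta P.p (v j.succ - v i.succ)) *
          ((∏ j, theta P.p (v i.succ - P.μ j)) *
            Z P (Function.update (Fin.tail v) i (v 0))) := by
  have ht : ∀ k : ℕ, theta P.p (P.τ + ((k : ℂ) + 1) * P.γ) ≠ 0 := fun k => by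
    have := hg (k + 1)
    push_cast at this
    exact this
  have hrev : ∀ k : Fin (L + 1), ((k.rev : ℕ) : ℂ) = L - (k : ℕ) := fun k => by
    rw [Fin.val_rev, Nat.cast_sub (by have := k.is_lt; omega)]
    push_cast
    ring
  refine ⟨fun y => latOp P (y ∘ Fin.rev) L P.μ
      (delta fun i => kinkCol 1 (Fin.last L) i.castSucc)
      (fun i => downCol 1 (L + 1) i.castSucc), fun v hv => ?_⟩
  -- Transport in the opposite direction is the same expansion with the rows reversed: the heights t
  -- then decrease, so γ is replaced by −γ. The base height b = 1 makes the lattice above a frozen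
  -- bottom row exactly Z.
  have h := bethe_expansion_symm hp0 hp1 (-P.γ)
    (fun k : Fin (L + 1) => P.τ + (((k.rev : ℕ) : ℂ) + 1) * P.γ)
    (fun k => ht k.rev) (fun k => by
      simp only [hrev, Fin.val_succ, Fin.val_castSucc]; push_cast; ring)
    (Z P) (Z_perm_of_generic P hp0 hp1 hg) (fun z => ∏ j, theta P.p (z - P.μ j))
    (fun k v => theta P.p (P.τ + (L + 1) * P.γ) * (amp P 1 (v ∘ Fin.rev) (kinkCol 1 k.rev) /
      theta P.p (P.τ + (((k.rev : ℕ) : ℂ) + 1) * P.γ))) ?_ ?_ v hv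
  · simp only [Fin.rev_zero, Fin.val_last] at h
    rw [← h]
    have hb := latOp_top P (v ∘ Fin.rev) P.μ (kinkCol 1 (Fin.last L)) (downCol 1 (L + 1))
      (by simp [kinkCol]; ring) (by simp [kinkCol, downCol]; try ring)
      (by simp [kinkCol, downCol]; try ring)
    rw [amp, hb, mul_div_cancel₀ _ (ht L)]
    simp only [Function.comp_apply, Fin.rev_last, Fin.rev_castSucc]
    rfl
  · intro v
    have hb := latOp_bottom P hg (v ∘ Fin.rev) P.μ (kinkCol 1 (0 : Fin (L + 1)))
      (downCol 1 (L + 1))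
      (by simp [kinkCol]) (by simp [kinkCol, downCol]; try ring)
      (by simp [kinkCol, downCol]; try ring)
    have hr : kinkCol 1 (0 : Fin (L + 1)) (Fin.succ 0) = 1 := by simp [kinkCol]
    have h1 : (fun i : Fin (L + 1) => kinkCol 1 (0 : Fin (L + 1)) i.succ) = upCol 1 L := by
      funext i
      rw [kinkCol, if_neg (by simp), upCol, Fin.val_succ]
      push_cast
      ring
    have h2 : (fun i : Fin (L + 1) => downCol 1 (L + 1) i.succ) = downCol 1 L := by
      funext i
      simp only [downCol, Fin.val_succ]
      push_cast
      ring
    have hZ : Z P (fun i => v i.castSucc) = Z P (fun i => (v ∘ Fin.rev) i.succ) := by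
      rw [← Z_perm_of_generic P hp0 hp1 hg Fin.revPerm]
      congr 1
      funext i
      simp [Fin.rev_succ]
    rw [hr, h1, h2, ← Z_eq_latOp, ← hZ] at hb
    push_cast at hb
    rw [add_comm (1 : ℂ)] at hb
    have h3 := ht 0
    simp only [Fin.rev_last, Fin.val_zero, Nat.cast_zero, zero_add, one_mul,
      Function.comp_apply, Fin.rev_zero] at hb h3 ⊢
    rw [amp, ← mul_div_assoc, hb]
    field_simp
  · intro k v hv
    have hne : k.castSucc ≠ k.succ := (Fin.castSucc_lt_succ).ne
    have hs : (v ∘ Fin.rev) ∘ Equiv.swap k.rev.castSucc k.rev.succ =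
        (v ∘ Equiv.swap k.castSucc k.succ) ∘ Fin.rev := by
      rw [Function.comp_assoc, Function.comp_assoc]
      congr 1
      funext i
      have h := Equiv.swap_apply_apply Fin.revPerm k.castSucc k.succ
      rw [Fin.revPerm_apply, Fin.revPerm_apply, Fin.rev_castSucc, Fin.rev_succ,
        Equiv.swap_comm] at h
      rw [Function.comp_apply, h]
      simp
    have h := amp_exchange_castSucc P hp0 hp1 hg 1 k.rev
      ((v ∘ Equiv.swap k.castSucc k.succ) ∘ Fin.rev)
      (P.τ + (((k.rev : ℕ) : ℂ) + 2) * P.γ) (v k.castSucc - v k.succ)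
      (by push_cast; ring) (by simp [Fin.rev_castSucc, Fin.rev_succ])
    have hs' : ((v ∘ Equiv.swap k.castSucc k.succ) ∘ Fin.rev) ∘
        Equiv.swap k.rev.castSucc k.rev.succ = v ∘ Fin.rev := by
      rw [← hs]
      funext i
      simp
    rw [hs',
      show P.τ + (((k.rev : ℕ) : ℂ) + 2) * P.γ - P.γ =
        P.τ + (((k.rev : ℕ) : ℂ) + 1) * P.γ by ring] at h
    have e1 := theta_neg hp0 (v k.castSucc - v k.succ)
    have e2 := theta_neg hp0 (v k.castSucc - v k.succ + P.γ)
    rw [neg_sub] at e1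
    rw [neg_add, neg_sub] at e2
    have h1 := ht k.rev
    have h2 := ht (k.rev + 1)
    push_cast at h2
    rw [add_assoc, one_add_one_eq_two] at h2
    have h3 := hv _ _ hne
    simp only [Fin.rev_castSucc, Fin.rev_succ, Fin.val_succ, Fin.val_castSucc]
    push_cast
    rw [e1, e2, theta_neg hp0, add_assoc _ (1 : ℂ) 1, one_add_one_eq_two]
    rw [show P.τ + (((k.rev : ℕ) : ℂ) + 2) * P.γ + (v k.castSucc - v k.succ) =
      P.τ + (((k.rev : ℕ) : ℂ) + 2) * P.γ + v k.castSucc - v k.succ by ring] at h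
    generalize theta P.p (P.τ + (((k.rev : ℕ) : ℂ) + 2) * P.γ + v k.castSucc - v k.succ) = A
      at h ⊢
    generalize theta P.p (P.τ + (L + 1) * P.γ) = C
    generalize theta P.p (P.τ + (((k.rev : ℕ) : ℂ) + 1) * P.γ) = D at h h1 ⊢
    generalize theta P.p (P.τ + (((k.rev : ℕ) : ℂ) + 2) * P.γ) = E at h h2 ⊢
    field_simp at h ⊢
    linear_combination (-C) * h

end MovedRow

/-! ### Combinations independent of the extra variable, and the modified equation. -/

section ModifiedEquation

variable {L : ℕ}

theorem cons_pairwise_ne {p : ℝ} (hp0 : 0 < p) (y : ℂ) (X : Fin L → ℂ)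
    (hX : ∀ i j, i ≠ j → theta p (X i - X j) ≠ 0) (hy : ∀ i, theta p (X i - y) ≠ 0)
    (a b : Fin (L + 1)) (hab : a ≠ b) :
    theta p ((Fin.cons y X : Fin (L + 1) → ℂ) a - (Fin.cons y X : Fin (L + 1) → ℂ) b) ≠ 0 := by
  induction a using Fin.cases with
  | zero =>
    induction b using Fin.cases with
    | zero => exact absurd rfl hab
    | succ b =>
      rw [Fin.cons_zero, Fin.cons_succ, ← neg_sub, theta_neg hp0, neg_ne_zero]
      exact hy b
  | succ a =>
    induction b using Fin.cases with
    | zero =>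
      rw [Fin.cons_zero, Fin.cons_succ]
      exact hy a
    | succ b =>
      rw [Fin.cons_succ, Fin.cons_succ]
      exact hX a b fun h => hab (congrArg Fin.succ h)

/-- A combination of values of the partition function that does not depend on `y`. -/
theorem exists_const_A (P : Params L) (hp0 : 0 < P.p) (hp1 : P.p < 1)
    (hg : ∀ n : ℤ, theta P.p (P.τ + n * P.γ) ≠ 0) (X : Fin L → ℂ)
    (hX : ∀ i j, i ≠ j → theta P.p (X i - X j) ≠ 0) :
    ∃ c : ℂ, ∀ y : ℂ, (∀ i, theta P.p (X i - y) ≠ 0) → (∀ j, theta P.p (y - P.μ j) ≠ 0) →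
      (∏ j, (theta P.p (y - P.μ j + P.γ) * theta P.p (X j - y + P.γ)) /
        (theta P.p (y - P.μ j) * theta P.p (X j - y))) * Z P X +
      ∑ i, (theta P.p P.γ * theta P.p (P.τ + P.γ + y - X i)) /
          (theta P.p (P.τ + P.γ) * theta P.p (y - X i)) *
        (∏ j, theta P.p (X i - P.μ j + P.γ) / theta P.p (y - P.μ j)) *
        (∏ j ∈ Finset.univ.erase i, theta P.p (X j - X i + P.γ) / theta P.p (X j - X i)) *
        Z P (Function.update X i y) = c := by
  obtain ⟨Φ, hΦ⟩ := exists_moved_row_A P hp0 hp1 hg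
  refine ⟨Φ X, fun y hy hyμ => ?_⟩
  have h := hΦ (Fin.cons y X) (cons_pairwise_ne hp0 y X hX hy)
  simp only [Fin.tail_cons, Fin.cons_zero, Fin.cons_succ] at h
  have hne : ∏ j, theta P.p (y - P.μ j) ≠ 0 := Finset.prod_ne_zero_iff.mpr fun j _ => hyμ j
  refine mul_left_cancel₀ hne (Eq.trans ?_ h.symm)
  rw [mul_add, Finset.mul_sum]
  congr 1
  · simp only [Finset.prod_div_distrib, Finset.prod_mul_distrib]
    field_simp
  · refine Finset.sum_congr rfl fun i _ => ?_
    rw [Finset.prod_div_distrib (f := fun j => theta P.p (X i - P.μ j + P.γ))]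
    field_simp

/-- A second combination of values of the partition function that does not depend on `y`. -/
theorem exists_const_D (P : Params L) (hp0 : 0 < P.p) (hp1 : P.p < 1)
    (hg : ∀ n : ℤ, theta P.p (P.τ + n * P.γ) ≠ 0) (X : Fin L → ℂ)
    (hX : ∀ i j, i ≠ j → theta P.p (X i - X j) ≠ 0) :
    ∃ c : ℂ, ∀ y : ℂ, (∀ i, theta P.p (X i - y) ≠ 0) →
      (∀ j, theta P.p (y - P.μ j + P.γ) ≠ 0) →
      (∏ j, (theta P.p (y - P.μ j) * theta P.p (y - X j + P.γ)) /
        (theta P.p (y - P.μ j + P.γ) * theta P.p (y - X j))) * Z P X +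
      ∑ i, (theta P.p P.γ * theta P.p (P.τ + (L + 1) * P.γ + y - X i)) /
          (theta P.p (P.τ + (L + 1) * P.γ) * theta P.p (X i - y)) *
        (∏ j, theta P.p (X i - P.μ j) / theta P.p (y - P.μ j + P.γ)) *
        (∏ j ∈ Finset.univ.erase i, theta P.p (X i - X j + P.γ) / theta P.p (X i - X j)) *
        Z P (Function.update X i y) = c := by
  obtain ⟨Φ, hΦ⟩ := exists_moved_row_D P hp0 hp1 hg
  refine ⟨Φ X, fun y hy hyμ => ?_⟩
  have h := hΦ (Fin.cons y X) (cons_pairwise_ne hp0 y X hX hy)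
  simp only [Fin.tail_cons, Fin.cons_zero, Fin.cons_succ] at h
  have hne : ∏ j, theta P.p (y - P.μ j + P.γ) ≠ 0 := Finset.prod_ne_zero_iff.mpr fun j _ => hyμ j
  have hflip : ∀ a b : ℂ, theta P.p (a - b + -P.γ) / theta P.p (a - b) =
      theta P.p (b - a + P.γ) / theta P.p (b - a) := fun a b => by
    rw [show a - b + -P.γ = -(b - a + P.γ) by ring, ← neg_sub b a, theta_neg hp0, theta_neg hp0,
      neg_div_neg_eq]
  simp only [hflip] at h
  refine mul_left_cancel₀ hne (Eq.trans ?_ h.symm)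
  rw [mul_add, Finset.mul_sum]
  congr 1
  · simp only [Finset.prod_div_distrib, Finset.prod_mul_distrib]
    field_simp
  · refine Finset.sum_congr rfl fun i _ => ?_
    rw [Finset.prod_div_distrib (f := fun j => theta P.p (X i - P.μ j)), theta_neg hp0,
      ← neg_sub (X i) y, theta_neg hp0]
    field_simp

theorem update_X_zero (x : Fin (L + 2) → ℂ) (i : Fin L) :
    Function.update (X x) i (x 0) = X0 x i.succ := by
  funext k
  simp only [Function.update_apply, X0, X, Fin.succ_inj]

theorem update_X_bar (x : Fin (L + 2) → ℂ) (i : Fin L) :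
    Function.update (X x) i (x (bar L)) = Xbar x i := by
  funext k
  simp only [Function.update_apply, Xbar, X]

theorem pos_ne_zero (k : Fin L) : pos k ≠ 0 := by
  rw [pos, Ne, Fin.castSucc_eq_zero_iff]
  exact Fin.succ_ne_zero k

theorem pos_ne_bar (k : Fin L) : pos k ≠ bar L := (Fin.castSucc_lt_last _).ne

theorem pos_injective : Function.Injective (pos (L := L)) :=
  (Fin.castSucc_injective _).comp (Fin.succ_injective _)

/-- The modified equation for generic `τ`. -/
theorem modified_equation_of_generic (P : Params L) (hp0 : 0 < P.p) (hp1 : P.p < 1)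
    (hg : ∀ n : ℤ, theta P.p (P.τ + n * P.γ) ≠ 0) (T : EqType) (x : Fin (L + 2) → ℂ)
    (hx : IsRegular P T x) :
    M P T x * Z P (X x) + ∑ i, N P T i x * Z P (X0 x i.succ) +
      ∑ i, Nbar P T i x * Z P (Xbar x i) = 0 := by
  have hX : ∀ i j : Fin L, i ≠ j → theta P.p (X x i - X x j) ≠ 0 := fun i j hij =>
    hx.1 _ _ fun h => hij (pos_injective h)
  have h0 : ∀ i : Fin L, theta P.p (X x i - x 0) ≠ 0 := fun i => hx.1 _ _ (pos_ne_zero i)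
  have hb : ∀ i : Fin L, theta P.p (X x i - x (bar L)) ≠ 0 := fun i => hx.1 _ _ (pos_ne_bar i)
  have hflip : ∀ (a b : ℂ) (i : Fin L), a / (b * theta P.p (X x i - x 0)) =
      -(a / (b * theta P.p (x 0 - X x i))) := fun a b i => by
    rw [← neg_sub (x 0), theta_neg hp0, mul_neg, div_neg]
  have hflip' : ∀ (a b : ℂ) (i : Fin L), a / (b * theta P.p (x 0 - X x i)) =
      -(a / (b * theta P.p (X x i - x 0))) := fun a b i => by
    rw [hflip, neg_neg]
  cases T with
  | A =>
    obtain ⟨c, hc⟩ := exists_const_A P hp0 hp1 hg (X x) hX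
    -- The constant depends on X alone, so the values at y = x_0 and at the barred variable agree;
    -- their difference is the claim, with a sign moved into the denominators of N.
    have e0 := hc (x 0) h0 (hx.2 0)
    have e1 := hc (x (bar L)) hb (hx.2 _)
    simp only [update_X_zero, update_X_bar] at e0 e1
    have hN : ∑ i, N P .A i x * Z P (X0 x i.succ) = -∑ i,
        (theta P.p P.γ * theta P.p (P.τ + P.γ + x 0 - X x i)) /
          (theta P.p (P.τ + P.γ) * theta P.p (x 0 - X x i)) *
        (∏ j, theta P.p (X x i - P.μ j + P.γ) / theta P.p (x 0 - P.μ j)) *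
        (∏ j ∈ Finset.univ.erase i, theta P.p (X x j - X x i + P.γ) / theta P.p (X x j - X x i)) *
        Z P (X0 x i.succ) := by
      rw [← Finset.sum_neg_distrib]
      refine Finset.sum_congr rfl fun i _ => ?_
      rw [N]
      change theta P.p P.γ * theta P.p (P.τ + P.γ + x 0 - X x i) /
        (theta P.p (P.τ + P.γ) * theta P.p (X x i - x 0)) * _ * _ * _ = _
      rw [hflip]
      simp only [X, neg_mul]
    rw [hN]
    simp only [M, Nbar]
    simp only [X] at e0 e1 ⊢
    linear_combination e1 - e0
  | D =>
    obtain ⟨c, hc⟩ := exists_const_D P hp0 hp1 hg (X x) hX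
    have e0 := hc (x 0) h0 (hx.2 0)
    have e1 := hc (x (bar L)) hb (hx.2 _)
    simp only [update_X_zero, update_X_bar] at e0 e1
    have hN : ∑ i, N P .D i x * Z P (X0 x i.succ) = -∑ i,
        (theta P.p P.γ * theta P.p (P.τ + (L + 1) * P.γ + x 0 - X x i)) /
          (theta P.p (P.τ + (L + 1) * P.γ) * theta P.p (X x i - x 0)) *
        (∏ j, theta P.p (X x i - P.μ j) / theta P.p (x 0 - P.μ j + P.γ)) *
        (∏ j ∈ Finset.univ.erase i, theta P.p (X x i - X x j + P.γ) / theta P.p (X x i - X x j)) *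
        Z P (X0 x i.succ) := by
      rw [← Finset.sum_neg_distrib]
      refine Finset.sum_congr rfl fun i _ => ?_
      rw [N]
      change theta P.p P.γ * theta P.p (P.τ + (L + 1) * P.γ + x 0 - X x i) /
        (theta P.p (P.τ + (L + 1) * P.γ) * theta P.p (x 0 - X x i)) * _ * _ * _ = _
      rw [hflip']
      simp only [X, neg_mul]
    rw [hN]
    simp only [M, Nbar]
    simp only [X] at e0 e1 ⊢
    linear_combination e1 - e0

/-- The modified equation. -/
theorem modified_equation (P : Params L) (hp0 : 0 < P.p) (hp1 : P.p < 1)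
    (hτ : ∀ n : ℕ, 1 ≤ n → n ≤ L + 1 → theta P.p (P.τ + n * P.γ) ≠ 0) (T : EqType)
    (x : Fin (L + 2) → ℂ) (hx : IsRegular P T x) :
    M P T x * Z P (X x) + ∑ i, N P T i x * Z P (X0 x i.succ) +
      ∑ i, Nbar P T i x * Z P (Xbar x i) = 0 := by
  have hθ := continuous_theta hp0 hp1
  have h1 := hτ 1 le_rfl (by omega)
  have h2 := hτ (L + 1) (by omega) le_rfl
  push_cast at h1 h2
  rw [one_mul] at h1
  have hb : ∀ i : Fin L, theta P.p (x (bar L) - x (pos i)) ≠ 0 := fun i =>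
    hx.1 _ _ (pos_ne_bar i).symm
  have hb' : ∀ i : Fin L, theta P.p (x (pos i) - x (bar L)) ≠ 0 := fun i =>
    hx.1 _ _ (pos_ne_bar i)
  have h0 : ∀ i : Fin L, theta P.p (x 0 - x (pos i)) ≠ 0 := fun i =>
    hx.1 _ _ (pos_ne_zero i).symm
  have h0' : ∀ i : Fin L, theta P.p (x (pos i) - x 0) ≠ 0 := fun i =>
    hx.1 _ _ (pos_ne_zero i)
  have hZ := continuousAt_Z_τ P hp0 hp1 hτ
  have hM : ContinuousAt (fun z => M { P with τ := z } T x) P.τ := by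
    cases T <;> exact continuousAt_const
  have hN : ∀ i, ContinuousAt (fun z => N { P with τ := z } T i x) P.τ := fun i => by
    cases T
    · simp only [N]
      refine ContinuousAt.mul (ContinuousAt.mul (ContinuousAt.div ?_ ?_ (mul_ne_zero h1 (h0' i)))
        continuousAt_const) continuousAt_const <;> fun_prop
    · simp only [N]
      refine ContinuousAt.mul (ContinuousAt.mul (ContinuousAt.div ?_ ?_ (mul_ne_zero h2 (h0 i)))
        continuousAt_const) continuousAt_const <;> fun_prop
  have hNbar : ∀ i, ContinuousAt (fun z => Nbar { P with τ := z } T i x) P.τ := fun i => by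
    cases T
    · simp only [Nbar]
      refine ContinuousAt.mul (ContinuousAt.mul (ContinuousAt.div ?_ ?_ (mul_ne_zero h1 (hb i)))
        continuousAt_const) continuousAt_const <;> fun_prop
    · simp only [Nbar]
      refine ContinuousAt.mul (ContinuousAt.mul (ContinuousAt.div ?_ ?_ (mul_ne_zero h2 (hb' i)))
        continuousAt_const) continuousAt_const <;> fun_prop
  refine eq_of_generic hp0 hp1 h1 P.γ P.τ
    (F := fun z => M { P with τ := z } T x * Z { P with τ := z } (X x) +
      ∑ i, N { P with τ := z } T i x * Z { P with τ := z } (X0 x i.succ) +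
      ∑ i, Nbar { P with τ := z } T i x * Z { P with τ := z } (Xbar x i)) (G := fun _ => 0)
    ?_ continuousAt_const fun z hz =>
      modified_equation_of_generic { P with τ := z } hp0 hp1 hz T x hx
  exact ((hM.mul (hZ _)).add (tendsto_finsetSum _ fun i _ => (hN i).mul (hZ _))).add
    (tendsto_finsetSum _ fun i _ => (hNbar i).mul (hZ _))

end ModifiedEquation

/-! ### Selections of the spectral variables -/

section Orbit

variable {L : ℕ}

theorem isRegular_comp {P : Params L} {T : EqType} {x : Fin (L + 2) → ℂ} (hx : IsRegular P T x)
    (σ : Equiv.Perm (Fin (L + 2))) : IsRegular P T (x ∘ σ) := by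
  refine ⟨fun a b hab => hx.1 _ _ fun h => hab (σ.injective h), ?_⟩
  cases T
  · exact fun a j => hx.2 _ j
  · exact fun a j => hx.2 _ j

/-- The sum over all pairs of indices that contain `m`. -/
theorem sum_pairs_containing (f : Fin L → ℂ) (W : Fin L → Fin L → ℂ)
    (hW : ∀ i j, i ≠ j → W i j = W j i) (m : Fin L) :
    ∑ q : {q : Fin L × Fin L // q.1 < q.2},
      (if q.1.2 = m then f q.1.1 else if q.1.1 = m then f q.1.2 else 0) * W q.1.1 q.1.2 =
    ∑ i, if i = m then 0 else f i * W i m := by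
  have h1 : ∀ i j : Fin L, (if i < j then
      (if j = m then f i else if i = m then f j else 0) * W i j else 0) =
      (if j = m then (if i < m then f i * W i m else 0) else 0) +
      (if i = m then (if m < j then f j * W j m else 0) else 0) := by
    intro i j
    by_cases hj : j = m <;> by_cases hi : i = m
    · subst hj hi
      simp
    · subst hj
      simp [hi]
    · subst hi
      rw [if_neg hj, if_pos rfl, if_neg hj, if_pos rfl, zero_add, hW _ _ (Ne.symm hj)]
    · simp [hi, hj]
  rw [← Finset.sum_subtype (Finset.univ.filter fun q : Fin L × Fin L => q.1 < q.2) (by simp)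
    fun q => (if q.2 = m then f q.1 else if q.1 = m then f q.2 else 0) * W q.1 q.2,
    Finset.sum_filter, Fintype.sum_prod_type]
  simp only [h1, Finset.sum_add_distrib, Finset.sum_ite_eq', Finset.mem_univ, if_true]
  rw [Finset.sum_comm (f := fun i j => if i = m then (if m < j then f j * W j m else 0) else 0)]
  simp only [Finset.sum_ite_eq', Finset.mem_univ, if_true]
  rw [← Finset.sum_add_distrib]
  refine Finset.sum_congr rfl fun i _ => ?_
  rcases lt_trichotomy i m with h | rfl | h
  · simp [h, h.ne, h.not_gt]
  · simp
  · simp [h, h.ne', h.not_gt]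

theorem sum_pairs_single (c : ℂ) (W : Fin L → Fin L → ℂ) {l m : Fin L} (h : l < m) :
    ∑ q : {q : Fin L × Fin L // q.1 < q.2},
      (if q.1.1 = l ∧ q.1.2 = m then c else 0) * W q.1.1 q.1.2 = c * W l m := by
  rw [Finset.sum_eq_single ⟨(l, m), h⟩]
  · rw [if_pos ⟨rfl, rfl⟩]
  · rintro ⟨⟨i, j⟩, hij⟩ _ hne
    rw [if_neg, zero_mul]
    rintro ⟨rfl, rfl⟩
    exact hne rfl
  · exact fun h' => absurd (Finset.mem_univ _) h'

section Selections

variable (x : Fin (L + 2) → ℂ)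

theorem swap_bar_zero (m : Fin L) : Equiv.swap (bar L) (pos m) 0 = 0 :=
  Equiv.swap_apply_of_ne_of_ne (Fin.last_pos).ne (pos_ne_zero m).symm

theorem swap_bar_pos {k m : Fin L} (h : k ≠ m) : Equiv.swap (bar L) (pos m) (pos k) = pos k :=
  Equiv.swap_apply_of_ne_of_ne (pos_ne_bar k) fun h' => h (pos_injective h')

theorem swap_zero_bar (l : Fin L) : Equiv.swap 0 (pos l) (bar L) = bar L :=
  Equiv.swap_apply_of_ne_of_ne (Fin.last_pos).ne' (pos_ne_bar l).symm

theorem swap_zero_pos {k l : Fin L} (h : k ≠ l) : Equiv.swap 0 (pos l) (pos k) = pos k :=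
  Equiv.swap_apply_of_ne_of_ne (pos_ne_zero k) fun h' => h (pos_injective h')

theorem X0bar_swap {i j : Fin L} (h : i ≠ j) :
    X0bar x i j ∘ Equiv.swap i j = X0bar x j i := by
  funext k
  rcases eq_or_ne k i with rfl | hi
  · simp [X0bar, h, h.symm]
  · rcases eq_or_ne k j with rfl | hj
    · simp [X0bar]
    · simp [X0bar, Equiv.swap_apply_of_ne_of_ne hi hj, hi, hj]

/-- This and the next lemmas follow the selections through the exchanges Π. The result is always one
of the four families, possibly up to a transposition of the arguments, which the symmetry of Z
absorbs. -/
theorem X_single (m : Fin L) : X (x ∘ Equiv.swap (bar L) (pos m)) = Xbar x m := by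
  funext k
  rcases eq_or_ne k m with rfl | hk
  · simp [X, Xbar]
  · simp [X, Xbar, hk, swap_bar_pos hk]

theorem X0_single_self (m : Fin L) :
    X0 (x ∘ Equiv.swap (bar L) (pos m)) m.succ = X0 x m.succ := by
  funext k
  rcases eq_or_ne k m with rfl | hk
  · simp [X0, swap_bar_zero]
  · simp [X0, hk, swap_bar_pos hk]

theorem X0_single {i m : Fin L} (h : i ≠ m) :
    X0 (x ∘ Equiv.swap (bar L) (pos m)) i.succ = X0bar x i m := by
  funext k
  rcases eq_or_ne k m with rfl | hk
  · simp [X0, X0bar, h.symm]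
  · simp [X0, X0bar, hk, swap_bar_pos hk, swap_bar_zero]

theorem Xbar_single_self (m : Fin L) : Xbar (x ∘ Equiv.swap (bar L) (pos m)) m = X x := by
  funext k
  rcases eq_or_ne k m with rfl | hk
  · simp [X, Xbar]
  · simp [X, Xbar, hk, swap_bar_pos hk]

theorem Xbar_single {i m : Fin L} (h : i ≠ m) :
    Xbar (x ∘ Equiv.swap (bar L) (pos m)) i = Xbar x i ∘ Equiv.swap i m := by
  funext k
  rcases eq_or_ne k m with rfl | hk
  · simp [Xbar, h.symm]
  · rcases eq_or_ne k i with rfl | hi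
    · simp [Xbar, h.symm]
    · simp [Xbar, hi, swap_bar_pos hk, Equiv.swap_apply_of_ne_of_ne hi hk]

theorem double_zero {l m : Fin L} (h : l ≠ m) :
    ((x ∘ Equiv.swap (bar L) (pos m)) ∘ Equiv.swap 0 (pos l)) 0 = x (pos l) := by
  simp [swap_bar_pos h]

theorem double_bar (l m : Fin L) :
    ((x ∘ Equiv.swap (bar L) (pos m)) ∘ Equiv.swap 0 (pos l)) (bar L) = x (pos m) := by
  simp [swap_zero_bar]

theorem double_pos (l m k : Fin L) :
    ((x ∘ Equiv.swap (bar L) (pos m)) ∘ Equiv.swap 0 (pos l)) (pos k) = X0bar x l m k := by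
  rcases eq_or_ne k l with rfl | hl
  · simp [X0bar, swap_bar_zero]
  · rcases eq_or_ne k m with rfl | hm
    · simp [X0bar, hl, swap_zero_pos hl]
    · simp [X0bar, hl, hm, swap_zero_pos hl, swap_bar_pos hm]

theorem X_double (l m : Fin L) :
    X ((x ∘ Equiv.swap (bar L) (pos m)) ∘ Equiv.swap 0 (pos l)) = X0bar x l m :=
  funext fun k => double_pos x l m k

theorem X0_double_left {l m : Fin L} (h : l ≠ m) :
    X0 ((x ∘ Equiv.swap (bar L) (pos m)) ∘ Equiv.swap 0 (pos l)) l.succ = Xbar x m := by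
  funext k
  rw [X0, double_zero x h, double_pos]
  simp only [Fin.succ_inj]
  rcases eq_or_ne k l with rfl | hl
  · simp [Xbar, h]
  · simp [Xbar, X0bar, hl]

theorem X0_double_right {l m : Fin L} (h : l ≠ m) :
    X0 ((x ∘ Equiv.swap (bar L) (pos m)) ∘ Equiv.swap 0 (pos l)) m.succ =
      X0 x m.succ ∘ Equiv.swap l m := by
  funext k
  rw [X0, double_zero x h, double_pos]
  simp only [Fin.succ_inj]
  rcases eq_or_ne k m with rfl | hm
  · simp [X0, h]
  · rcases eq_or_ne k l with rfl | hl
    · simp [X0, X0bar, h]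
    · simp [X0, X0bar, hl, hm, Equiv.swap_apply_of_ne_of_ne hl hm]

theorem X0_double {i l m : Fin L} (h : l ≠ m) (hil : i ≠ l) (him : i ≠ m) :
    X0 ((x ∘ Equiv.swap (bar L) (pos m)) ∘ Equiv.swap 0 (pos l)) i.succ =
      X0bar x i m ∘ Equiv.swap i l := by
  funext k
  rw [X0, double_zero x h, double_pos]
  simp only [Fin.succ_inj]
  rcases eq_or_ne k i with rfl | hi
  · simp [X0bar, h, hil.symm]
  · rcases eq_or_ne k l with rfl | hl
    · simp [X0bar, hi]
    · simp [X0bar, hi, hl, Equiv.swap_apply_of_ne_of_ne hi hl]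

theorem Xbar_double_right {l m : Fin L} (h : l ≠ m) :
    Xbar ((x ∘ Equiv.swap (bar L) (pos m)) ∘ Equiv.swap 0 (pos l)) m = X0 x l.succ := by
  funext k
  rw [Xbar, double_bar, double_pos, X0]
  simp only [Fin.succ_inj]
  rcases eq_or_ne k m with rfl | hm
  · simp [h.symm]
  · simp [X0bar, hm]

theorem Xbar_double_left {l m : Fin L} (h : l ≠ m) :
    Xbar ((x ∘ Equiv.swap (bar L) (pos m)) ∘ Equiv.swap 0 (pos l)) l =
      Xbar x l ∘ Equiv.swap l m := by
  funext k
  rw [Xbar, double_bar, double_pos]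
  rcases eq_or_ne k l with rfl | hl
  · simp [Xbar, h.symm]
  · rcases eq_or_ne k m with rfl | hm
    · simp [Xbar, X0bar, hl]
    · simp [Xbar, X0bar, hl, hm, Equiv.swap_apply_of_ne_of_ne hl hm]

theorem Xbar_double {i l m : Fin L} (h : l ≠ m) (hil : i ≠ l) (him : i ≠ m) :
    Xbar ((x ∘ Equiv.swap (bar L) (pos m)) ∘ Equiv.swap 0 (pos l)) i =
      X0bar x l i ∘ Equiv.swap i m := by
  funext k
  rw [Xbar, double_bar, double_pos]
  rcases eq_or_ne k i with rfl | hi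
  · simp [X0bar, h.symm, him.symm]
  · rcases eq_or_ne k m with rfl | hm
    · simp [X0bar, hi, hil, h.symm]
    · simp [X0bar, hi, hm, Equiv.swap_apply_of_ne_of_ne hi hm]

end Selections

end Orbit

/-! ### The orbit equations and their elimination -/

section OrbitEquations

variable {L : ℕ}

/-- The orbit equations. -/
theorem orbit_equation (P : Params L) (hp0 : 0 < P.p) (hp1 : P.p < 1)
    (hτ : ∀ n : ℕ, 1 ≤ n → n ≤ L + 1 → theta P.p (P.τ + n * P.γ) ≠ 0) (T : EqType)
    (x : Fin (L + 2) → ℂ) (hx : IsRegular P T x) (r : Label L) :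
    coeffP P T r x * Z P (X x) + ∑ i, coeffQ P T r i x * Z P (X0 x i.succ) +
      ∑ i, coeffQbar P T r i x * Z P (Xbar x i) +
      ∑ q : {q : Fin L × Fin L // q.1 < q.2},
        coeffR P T r q.1.1 q.1.2 x * Z P (X0bar x q.1.1 q.1.2) = 0 := by
  have hZ := Z_perm P hp0 hp1 hτ
  have hW : ∀ i j : Fin L, i ≠ j → Z P (X0bar x i j) = Z P (X0bar x j i) := fun i j hij => by
    rw [← hZ (Equiv.swap i j) (X0bar x i j), X0bar_swap x hij]
  rcases r with _ | m | ⟨⟨l, m⟩, hlm⟩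
  · have h := modified_equation P hp0 hp1 hτ T x hx
    simpa [coeffP, coeffQ, coeffQbar, coeffR] using h
  · have h := modified_equation P hp0 hp1 hτ T _ (isRegular_comp hx (Equiv.swap (bar L) (pos m)))
    set x' := x ∘ Equiv.swap (bar L) (pos m) with hx'
    have hP : coeffP P T (.inr (.inl m)) x = Nbar P T m x' := rfl
    have hQ : ∀ i, coeffQ P T (.inr (.inl m)) i x = if i = m then N P T m x' else 0 :=
      fun i => by rw [coeffQ]; split_ifs <;> rfl
    have hQbar : ∀ i, coeffQbar P T (.inr (.inl m)) i x =
        if i = m then M P T x' else Nbar P T i x' :=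
      fun i => by rw [coeffQbar]; split_ifs <;> rfl
    have hR : ∀ i j, coeffR P T (.inr (.inl m)) i j x =
        if j = m then N P T i x' else if i = m then N P T j x' else 0 :=
      fun i j => by rw [coeffR]; split_ifs <;> rfl
    simp only [hP, hQ, hQbar, hR]
    rw [sum_pairs_containing (fun i => N P T i x') (fun i j => Z P (X0bar x i j)) hW]
    have e1 : ∑ i, N P T i x' * Z P (X0 x' i.succ) =
        N P T m x' * Z P (X0 x m.succ) +
          ∑ i, if i = m then 0 else N P T i x' * Z P (X0bar x i m) := by
      rw [← Fintype.sum_ite_eq' m fun i => N P T i x' * Z P (X0 x i.succ),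
        ← Finset.sum_add_distrib]
      refine Finset.sum_congr rfl fun i _ => ?_
      by_cases hi : i = m
      · subst hi
        rw [if_pos rfl, if_pos rfl, add_zero, hx', X0_single_self]
      · rw [if_neg hi, if_neg hi, zero_add, hx', X0_single x hi]
    have e2 : ∑ i, Nbar P T i x' * Z P (Xbar x' i) =
        Nbar P T m x' * Z P (X x) +
          ∑ i, if i = m then 0 else Nbar P T i x' * Z P (Xbar x i) := by
      rw [← Fintype.sum_ite_eq' m fun i => Nbar P T i x' * Z P (X x),
        ← Finset.sum_add_distrib]
      refine Finset.sum_congr rfl fun i _ => ?_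
      by_cases hi : i = m
      · subst hi
        rw [if_pos rfl, if_pos rfl, add_zero, hx', Xbar_single_self]
      · rw [if_neg hi, if_neg hi, zero_add, hx', Xbar_single x hi, hZ]
    have e3 : ∑ i, (if i = m then M P T x' else Nbar P T i x') * Z P (Xbar x i) =
        M P T x' * Z P (Xbar x m) +
          ∑ i, if i = m then 0 else Nbar P T i x' * Z P (Xbar x i) := by
      rw [← Fintype.sum_ite_eq' m fun i => M P T x' * Z P (Xbar x i),
        ← Finset.sum_add_distrib]
      refine Finset.sum_congr rfl fun i _ => ?_
      split_ifs <;> ring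
    have e4 : ∑ i, (if i = m then N P T m x' else 0) * Z P (X0 x i.succ) =
        N P T m x' * Z P (X0 x m.succ) := by
      simp
    rw [e1, e2, hx', X_single, ← hx'] at h
    rw [e3, e4]
    linear_combination h
  · have hne : l ≠ m := hlm.ne
    have h := modified_equation P hp0 hp1 hτ T _ (isRegular_comp (isRegular_comp hx
      (Equiv.swap (bar L) (pos m))) (Equiv.swap 0 (pos l)))
    set x' := (x ∘ Equiv.swap (bar L) (pos m)) ∘ Equiv.swap 0 (pos l) with hx'
    have hP : coeffP P T (.inr (.inr ⟨(l, m), hlm⟩)) x = 0 := rfl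
    have hQ : ∀ i, coeffQ P T (.inr (.inr ⟨(l, m), hlm⟩)) i x =
        (if i = l then Nbar P T m x' else 0) + if i = m then N P T m x' else 0 :=
      fun i => by
        rw [coeffQ]
        by_cases h1 : i = l
        · rw [if_pos h1, if_pos h1, if_neg fun h2 => hne (h1.symm.trans h2), add_zero]
          rfl
        · rw [if_neg h1, if_neg h1, zero_add]
          split_ifs <;> rfl
    have hQbar : ∀ i, coeffQbar P T (.inr (.inr ⟨(l, m), hlm⟩)) i x =
        (if i = l then Nbar P T l x' else 0) + if i = m then N P T l x' else 0 :=
      fun i => by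
        rw [coeffQbar]
        by_cases h1 : i = l
        · rw [if_pos h1, if_pos h1, if_neg fun h2 => hne (h1.symm.trans h2), add_zero]
          rfl
        · rw [if_neg h1, if_neg h1, zero_add]
          split_ifs <;> rfl
    -- The case distinction is split into the pair (l, m), the pairs containing l and the pairs
    -- containing m. The inner zeros keep (l, m) from being counted again.
    have hR : ∀ i j, i < j → coeffR P T (.inr (.inr ⟨(l, m), hlm⟩)) i j x =
        (if i = l ∧ j = m then M P T x' else 0) +
        (if j = l then (fun k => if k = m then 0 else Nbar P T k x') i else
          if i = l then (fun k => if k = m then 0 else Nbar P T k x') j else 0) +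
        (if j = m then (fun k => if k = l then 0 else N P T k x') i else
          if i = m then (fun k => if k = l then 0 else N P T k x') j else 0) := by
      intro i j hij
      have h0 : coeffR P T (.inr (.inr ⟨(l, m), hlm⟩)) i j x =
          if i = l ∧ j = m then M P T x' else if i = l then Nbar P T j x'
          else if i = m then N P T j x' else if j = l then Nbar P T i x'
          else if j = m then N P T i x' else 0 := by
        rw [coeffR]
        split_ifs <;> rfl
      rw [h0]
      have hlm' : l < m := hlm
      beta_reduce
      split_ifs <;> first | (exfalso; omega) | simp
    have hsum : ∑ q : {q : Fin L × Fin L // q.1 < q.2},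
        coeffR P T (.inr (.inr ⟨(l, m), hlm⟩)) q.1.1 q.1.2 x * Z P (X0bar x q.1.1 q.1.2) =
        M P T x' * Z P (X0bar x l m) +
        (∑ i, if i = l then 0 else (if i = m then 0 else Nbar P T i x') * Z P (X0bar x i l)) +
        ∑ i, if i = m then 0 else (if i = l then 0 else N P T i x') * Z P (X0bar x i m) := by
      rw [← sum_pairs_containing (fun k => if k = l then 0 else N P T k x')
          (fun i j => Z P (X0bar x i j)) hW m,
        ← sum_pairs_containing (fun k => if k = m then 0 else Nbar P T k x')
          (fun i j => Z P (X0bar x i j)) hW l,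
        ← sum_pairs_single (M P T x') (fun i j => Z P (X0bar x i j)) hlm,
        ← Finset.sum_add_distrib, ← Finset.sum_add_distrib]
      refine Finset.sum_congr rfl fun q _ => ?_
      rw [hR _ _ q.2]
      ring
    rw [hsum]
    simp only [hP, hQ, hQbar]
    have e1 : ∑ i, N P T i x' * Z P (X0 x' i.succ) =
        N P T l x' * Z P (Xbar x m) + N P T m x' * Z P (X0 x m.succ) +
          ∑ i, if i = m then 0 else (if i = l then 0 else N P T i x') * Z P (X0bar x i m) := by
      rw [← Fintype.sum_ite_eq' l fun i => N P T i x' * Z P (Xbar x m),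
        ← Fintype.sum_ite_eq' m fun i => N P T i x' * Z P (X0 x i.succ),
        ← Finset.sum_add_distrib, ← Finset.sum_add_distrib]
      refine Finset.sum_congr rfl fun i _ => ?_
      by_cases hi : i = m
      · subst hi
        rw [if_neg hne.symm, if_pos rfl, if_pos rfl, add_zero, zero_add, hx',
          X0_double_right x hne, hZ]
      · by_cases hl : i = l
        · subst hl
          rw [if_pos rfl, if_neg hi, if_neg hi, if_pos rfl, hx', X0_double_left x hne]
          ring
        · rw [if_neg hi, if_neg hi, if_neg hl, if_neg hl, hx', X0_double x hne hl hi, hZ]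
          ring
    have e2 : ∑ i, Nbar P T i x' * Z P (Xbar x' i) =
        Nbar P T l x' * Z P (Xbar x l) + Nbar P T m x' * Z P (X0 x l.succ) +
          ∑ i, if i = l then 0 else
            (if i = m then 0 else Nbar P T i x') * Z P (X0bar x i l) := by
      rw [← Fintype.sum_ite_eq' l fun i => Nbar P T i x' * Z P (Xbar x i),
        ← Fintype.sum_ite_eq' m fun i => Nbar P T i x' * Z P (X0 x l.succ),
        ← Finset.sum_add_distrib, ← Finset.sum_add_distrib]
      refine Finset.sum_congr rfl fun i _ => ?_
      by_cases hi : i = m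
      · subst hi
        rw [if_neg hne.symm, if_pos rfl, if_neg hne.symm, if_pos rfl, hx',
          Xbar_double_right x hne]
        ring
      · by_cases hl : i = l
        · subst hl
          rw [if_pos rfl, if_neg hi, if_pos rfl, hx', Xbar_double_left x hne, hZ]
          ring
        · rw [if_neg hi, if_neg hi, if_neg hl, if_neg hl, hx', Xbar_double x hne hl hi, hZ,
            hW _ _ hl]
          ring
    have e3 : ∀ (a b : ℂ) (F : Fin L → ℂ),
        ∑ i, ((if i = l then a else 0) + if i = m then b else 0) * F i = a * F l + b * F m := by
      intro a b F
      simp [add_mul, Finset.sum_add_distrib]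
    rw [e1, e2, hx', X_double, ← hx'] at h
    rw [e3, e3]
    linear_combination h

/-- Elimination by Cramer's rule: the first column may be replaced by any of several columns. -/
theorem sum_det_updateCol_eq_zero {ι κ : Type*} [Fintype ι] [DecidableEq ι] [Fintype κ]
    (A : Matrix ι ι ℂ) (c : ι) (B : κ → ι → ℂ) (z : κ → ℂ) (w : ι → ℂ)
    (h : ∀ r, ∑ k, B k r * z k + ∑ i ∈ Finset.univ.erase c, A r i * w i = 0) :
    ∑ k, (A.updateCol c (B k)).det * z k = 0 := by
  -- The determinant is linear in column `c`; what remains is that the matrix with the combined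
  -- column is singular.
  have h1 : ∑ k, (A.updateCol c (B k)).det * z k =
      (A.updateCol c (∑ k, z k • B k)).det := by
    rw [← Matrix.cramer_apply, map_sum, Finset.sum_apply]
    refine Finset.sum_congr rfl fun k _ => ?_
    rw [map_smul, Pi.smul_apply, Matrix.cramer_apply, smul_eq_mul, mul_comm]
  rw [h1, ← Matrix.exists_mulVec_eq_zero_iff]
  -- The hypothesis says that w, with entry 1 at `c`, lies in the kernel; the entry 1 makes it
  -- nonzero.
  refine ⟨Function.update w c 1, fun h0 => ?_, ?_⟩
  · have := congrFun h0 c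
    simp at this
  · funext r
    rw [Matrix.mulVec, dotProduct, ← Finset.add_sum_erase _ _ (Finset.mem_univ c),
      Matrix.updateCol_self, Function.update_self, mul_one, Finset.sum_apply, Pi.zero_apply,
      ← h r]
    congr 1
    · exact Finset.sum_congr rfl fun k _ => mul_comm _ _
    · refine Finset.sum_congr rfl fun i hi => ?_
      rw [Matrix.updateCol_ne (Finset.ne_of_mem_erase hi),
        Function.update_of_ne (Finset.ne_of_mem_erase hi)]

/-- The fundamental functional equation. -/
theorem functional_equation (P : Params L) (hp0 : 0 < P.p) (hp1 : P.p < 1)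
    (hτ : ∀ n : ℕ, 1 ≤ n → n ≤ L + 1 → theta P.p (P.τ + n * P.γ) ≠ 0) (T : EqType)
    (x : Fin (L + 2) → ℂ) (hx : IsRegular P T x) :
    ∑ i, H P T i x * Z P (X0 x i) = 0 := by
  let A : Matrix (Label L) (Label L) ℂ := Matrix.of fun r c => match c with
    | .inl _ => 0
    | .inr (.inl j) => coeffQbar P T r j x
    | .inr (.inr q) => coeffR P T r q.1.1 q.1.2 x
  have hH : ∀ k, H P T k x = (A.updateCol (.inl ()) fun r => firstCol P T k r x).det := by
    intro k
    -- Rows and columns are numbered by the same equivalence, so the numbering does not affect the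
    -- determinant, not even by a sign.
    rw [H, Omega, Matrix.det_reindex_self]
    congr 1
    ext r c
    rcases c with c | c | c
    · cases c
      rw [Matrix.updateCol_self]
      rfl
    · rw [Matrix.updateCol_ne (by simp)]
      rfl
    · rw [Matrix.updateCol_ne (by simp)]
      rfl
  simp only [hH]
  refine sum_det_updateCol_eq_zero A (.inl ()) _ _ (fun c => match c with
    | .inl _ => 0
    | .inr (.inl j) => Z P (Xbar x j)
    | .inr (.inr q) => Z P (X0bar x q.1.1 q.1.2)) fun r => ?_
  have h := orbit_equation P hp0 hp1 hτ T x hx r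
  have h0 : X0 x 0 = X x := funext fun k => if_neg (Fin.succ_ne_zero k)
  rw [Finset.sum_erase _ (by simp), Fin.sum_univ_succ, Fintype.sum_sum_type,
    Fintype.sum_sum_type, h0, ← h]
  simp [A, firstCol, add_assoc]

end OrbitEquations

end EightVSOS

theorem mainTheorem3 (L : ℕ) (P : EightVSOS.Params L) (hp0 : 0 < P.p) (hp1 : P.p < 1)
    (hτ : ∀ n : ℕ, 1 ≤ n → n ≤ L + 1 → EightVSOS.theta P.p (P.τ + n * P.γ) ≠ 0) :
    (∀ (σ : Equiv.Perm (Fin L)) (y : Fin L → ℂ),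
      EightVSOS.Z P (y ∘ σ) = EightVSOS.Z P y) ∧
    ∀ (T : EightVSOS.EqType) (x : Fin (L + 2) → ℂ), EightVSOS.IsRegular P T x →
      (∀ r : EightVSOS.Label L,
        EightVSOS.coeffP P T r x * EightVSOS.Z P (EightVSOS.X x) +
        ∑ i : Fin L, EightVSOS.coeffQ P T r i x * EightVSOS.Z P (EightVSOS.X0 x i.succ) +
        ∑ i : Fin L, EightVSOS.coeffQbar P T r i x * EightVSOS.Z P (EightVSOS.Xbar x i) +
        ∑ q : {q : Fin L × Fin L // q.1 < q.2},
          EightVSOS.coeffR P T r q.1.1 q.1.2 x *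
            EightVSOS.Z P (EightVSOS.X0bar x q.1.1 q.1.2) = 0) ∧
      ∑ i : Fin (L + 1), EightVSOS.H P T i x * EightVSOS.Z P (EightVSOS.X0 x i) = 0 :=
  ⟨EightVSOS.Z_perm P hp0 hp1 hτ, fun T x hx =>
    ⟨EightVSOS.orbit_equation P hp0 hp1 hτ T x hx,
      EightVSOS.functional_equation P hp0 hp1 hτ T x hx⟩⟩
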